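/- **Conventions.** Graphs are finite and simple. An $h$-queue layout of a graph $G=(V,E)$ is a linear order $\prec$ of $V$ together with a map $\sigma\colon E\to\{1,\dots,h\}$ such that there are no edges $uv,wx\in E$ with $\sigma(uv)=\sigma(wx)$ and $u\prec w\prec x\prec v$. The queue number of $G$ is the least $h$ such that $G$ has an $h$-queue layout. Let $T$ be a rooted tree on the vertex set of $G$. The depth of a vertex is the number of vertices on the path from the root to it, and the height of $T$ is the maximum depth. $T$ is a treedepth decomposition of $G$ if for every edge $xy$ of $G$ one of $x,y$ is an ancestor of the other in $T$. For a vertex $t$, let $P_t$ be the set of ancestors of $t$, including $t$; let $A_t$ be the set of connected components of $G-P_t$ that contain a child of $t$; and let $m_t$ be the maximum number of vertices of a component in $A_t$. For $k\in\mathbb N$ put $\mathrm{size}(k,1)=\#\mathrm{children}(k,1)=0$ and, for $i\ge 2$, $$\mathrm{size}(k,i)=\mathrm{size}(k,i-1)\cdot\#\mathrm{children}(k,i-1)+1,$$ $$\#\mathrm{children}(k,i)=\Big(\big((2^{k+1}+1)^{\mathrm{size}(k,i)^2}+1\big)\cdot(\mathrm{size}(k,i)+k)!\Big)\cdot 2^{(k+\mathrm{size}(k,i))^2}.$$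 **Lemma 1.** Let $G$ be a connected graph, let $T$ be a treedepth decomposition of $G$ of height at most $k$, and let $i\ge 2$. Let $t$ be a vertex (of any depth in $T$) such that $|A_t|\ge\#\mathrm{children}(k,i)$ and $m_t\le\mathrm{size}(k,i)$, and such that every proper descendant $q$ of $t$ in $T$ satisfies $|A_q|\le\#\mathrm{children}(k,i-1)$. Then there is a component $B\in A_t$ such that $G-B$ has queue number one if and only if $G$ has queue number one. Moreover, such a $B$ can be computed in time $\mathrm{size}(k,i)!\cdot\#\mathrm{children}(k,i)^2$. That is, there is one program for a random access machine (registers and arrays of natural numbers, initially zero; the instructions are loading a constant, addition, truncated subtraction, array reads and writes, and reads of the input; control flow by sequencing, conditionals and while loops that test $x<y$ for two registers; each instruction and each test costs one step) that works for all $G,T,k,i,t$ as above. It receives $k$, $i$, $t$ in registers and has read-only random access to $G$ (as adjacency lists, in arbitrary order) and to $T$ (as parent pointers and lists of children, in arbitrary order), the vertices being numbered $0,\dots,|V|-1$ arbitrarily. It halts after at most $\mathrm{size}(k,i)!\cdot\#\mathrm{children}(k,i)^2$ steps with the list of the vertices of such a $B$ as its output. -/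

import Mathlib

open scoped Nat

universe u

namespace QueueTD

/-! ### Queue layouts -/

/-- `G` has an `h`-queue layout: a linear order of the vertices and a map from the edges to `h`
queues such that no two edges `uv`, `wx` of the same queue are ordered `u < w < x < v`. -/
def HasQueueLayout {V : Type u} (G : SimpleGraph V) (h : ℕ) : Prop :=
  ∃ (lo : LinearOrder V) (σ : G.edgeSet → Fin h),
    ∀ (u v w x : V) (huv : G.Adj u v) (hwx : G.Adj w x),
      σ ⟨s(u, v), huv⟩ = σ ⟨s(w, x), hwx⟩ →
        ¬ (lo.lt u w ∧ lo.lt w x ∧ lo.lt x v)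

/-- The queue number: the least `h` such that `G` has an `h`-queue layout. -/
noncomputable def queueNumber {V : Type u} (G : SimpleGraph V) : ℕ :=
  sInf {h | HasQueueLayout G h}

/-! ### Rooted trees and treedepth decompositions -/

/-- A rooted tree with vertex set `V`, given by its parent function (the root is its own parent). -/
structure RTree (V : Type u) where
  root : V
  parent : V → V
  parent_root : parent root = root
  reaches_root : ∀ v, ∃ m, parent^[m] v = root

namespace RTree

variable {V : Type u} (T : RTree V)

/-- `u` is an ancestor of `v`; every vertex is an ancestor of itself. -/
def IsAncestor (u v : V) : Prop := ∃ m, T.parent^[m] v = u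

/-- `q` is a child of `t`. -/
def IsChild (q t : V) : Prop := q ≠ T.root ∧ T.parent q = t

/-- `q` is a (proper) descendant of `t`. -/
def IsDescendant (q t : V) : Prop := q ≠ t ∧ T.IsAncestor t q

open Classical in
/-- The number of vertices on the path from the root to `v`. -/
noncomputable def depth (v : V) : ℕ := Nat.find (T.reaches_root v) + 1

/-- The graph joining every vertex to all its proper ancestors. -/
def closure : SimpleGraph V where
  Adj x y := x ≠ y ∧ (T.IsAncestor x y ∨ T.IsAncestor y x)
  symm := ⟨fun _ _ h => ⟨h.1.symm, h.2.symm⟩⟩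
  loopless := ⟨fun _ h => h.1 rfl⟩

/-- `T` is a treedepth decomposition of `G`. -/
def IsTreedepthDecomposition (G : SimpleGraph V) : Prop := G ≤ T.closure

/-- The set `P_t` of the ancestors of `t`, including `t`. -/
def ancestors (t : V) : Set V := {u | T.IsAncestor u t}

/-- The set `A_t` of the connected components of `G - P_t` (as vertex sets of `G`) that contain a
child of `t`. -/
def comps (G : SimpleGraph V) (t : V) : Set (Set V) :=
  {B | (∃ c : (G.induce (T.ancestors t)ᶜ).ConnectedComponent, B = Subtype.val '' c.supp) ∧
    ∃ q ∈ B, T.IsChild q t}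

/-- `m_t`: the maximum number of vertices in a component in `A_t`. -/
noncomputable def maxCompSize (G : SimpleGraph V) (t : V) : ℕ :=
  sSup (Set.ncard '' T.comps G t)

end RTree

/-! ### The two bounds -/

/-- The expression for `#children(k, i)`, `i ≥ 2`, in terms of `k` and `s = size(k, i)`. -/
def childrenOfSize (k s : ℕ) : ℕ :=
  (((2 ^ (k + 1) + 1) ^ (s ^ 2) + 1) * (s + k)!) * 2 ^ ((k + s) ^ 2)

/-- `size(k, i)`, with the (unused) value `0` at `i = 0`. -/
def size (k : ℕ) : ℕ → ℕ
  | 0 => 0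
  | 1 => 0
  | i + 2 => size k (i + 1) * (if i = 0 then 0 else childrenOfSize k (size k (i + 1))) + 1

/-- `#children(k, i)`, with the (unused) value `0` at `i = 0`. -/
def numChildren (k i : ℕ) : ℕ := if i ≤ 1 then 0 else childrenOfSize k (size k i)

theorem size_succ (k i : ℕ) (hi : 1 ≤ i) :
    size k (i + 1) = size k i * numChildren k i + 1 := by
  obtain ⟨j, rfl⟩ : ∃ j, i = j + 1 := ⟨i - 1, by omega⟩
  rw [size, numChildren]
  congr 2
  by_cases h : j = 0 <;> simp [h]

/-! ### Random access machine with unit cost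

Programs work on natural numbers held in registers and in arrays, and have read-only access to an
input that stores a graph by adjacency lists and a rooted tree by parent pointers and lists of
children. The arithmetic instructions are addition and (truncated) subtraction. -/

/-- The read-only input: vertices are named by natural numbers. -/
structure Input where
  deg : ℕ → ℕ
  nbr : ℕ → ℕ → ℕ
  parent : ℕ → ℕ
  numChild : ℕ → ℕ
  child : ℕ → ℕ → ℕ

/-- The input stores `G` and `T`, where the vertex `v` has the name `name v`: the entries
`nbr (name v) j`, `j < deg (name v)`, list the neighbours of `v` without repetition in any order,
and similarly for the children of `v`. -/
structure Input.Represents (I : Input) {V : Type u} [Fintype V] (G : SimpleGraph V) (T : RTree V)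
    (name : V ≃ Fin (Fintype.card V)) : Prop where
  nbr_bijOn : ∀ v, Set.BijOn (I.nbr (name v)) (Set.Iio (I.deg (name v)))
    ((fun w => (name w : ℕ)) '' {w | G.Adj v w})
  parent_eq : ∀ v, I.parent (name v) = name (T.parent v)
  child_bijOn : ∀ v, Set.BijOn (I.child (name v)) (Set.Iio (I.numChild (name v)))
    ((fun w => (name w : ℕ)) '' {w | T.IsChild w v})

/-- The memory: registers `reg x` and arrays with entries `arr a j`. -/
structure State where
  reg : ℕ → ℕ
  arr : ℕ → ℕ → ℕ

def State.setReg (s : State) (x val : ℕ) : State :=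
  { s with reg := Function.update s.reg x val }

def State.setArr (s : State) (a j val : ℕ) : State :=
  { s with arr := Function.update s.arr a (Function.update (s.arr a) j val) }

/-- Elementary instructions; `x`, `y`, `z` are registers, `a` is an array, `c` is a constant. -/
inductive Instr where
  | const (x c : ℕ)
  | add (x y z : ℕ)
  | sub (x y z : ℕ)
  | load (x a y : ℕ)
  | store (a y z : ℕ)
  | deg (x y : ℕ)
  | nbr (x y z : ℕ)
  | parent (x y : ℕ)
  | numChild (x y : ℕ)
  | child (x y z : ℕ)

def Instr.step (I : Input) (s : State) : Instr → State
  | const x c => s.setReg x c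
  | add x y z => s.setReg x (s.reg y + s.reg z)
  | sub x y z => s.setReg x (s.reg y - s.reg z)
  | load x a y => s.setReg x (s.arr a (s.reg y))
  | store a y z => s.setArr a (s.reg y) (s.reg z)
  | deg x y => s.setReg x (I.deg (s.reg y))
  | nbr x y z => s.setReg x (I.nbr (s.reg y) (s.reg z))
  | parent x y => s.setReg x (I.parent (s.reg y))
  | numChild x y => s.setReg x (I.numChild (s.reg y))
  | child x y z => s.setReg x (I.child (s.reg y) (s.reg z))

/-- Programs. The tests compare two registers: `reg x < reg y`. -/
inductive Prog where
  | skip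
  | instr (c : Instr)
  | seq (p q : Prog)
  | ifLT (x y : ℕ) (p q : Prog)
  | whileLT (x y : ℕ) (p : Prog)

/-- `Exec I p s τ s'`: on input `I`, the program `p` started in state `s` halts in state `s'` after
exactly `τ` steps, where every instruction and every evaluation of a test is one step. -/
inductive Exec (I : Input) : Prog → State → ℕ → State → Prop where
  | skip (s : State) : Exec I .skip s 0 s
  | instr (c : Instr) (s : State) : Exec I (.instr c) s 1 (c.step I s)
  | seq {p q : Prog} {s s' s'' : State} {m n : ℕ} :
      Exec I p s m s' → Exec I q s' n s'' → Exec I (.seq p q) s (m + n) s''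
  | ifTrue {x y : ℕ} {p q : Prog} {s s' : State} {m : ℕ} :
      s.reg x < s.reg y → Exec I p s m s' → Exec I (.ifLT x y p q) s (m + 1) s'
  | ifFalse {x y : ℕ} {p q : Prog} {s s' : State} {m : ℕ} :
      ¬ s.reg x < s.reg y → Exec I q s m s' → Exec I (.ifLT x y p q) s (m + 1) s'
  | whileTrue {x y : ℕ} {p : Prog} {s s' s'' : State} {m n : ℕ} :
      s.reg x < s.reg y → Exec I p s m s' → Exec I (.whileLT x y p) s' n s'' →
        Exec I (.whileLT x y p) s (m + n + 1) s''
  | whileFalse {x y : ℕ} {p : Prog} {s : State} :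
      ¬ s.reg x < s.reg y → Exec I (.whileLT x y p) s 1 s

/-- The initial state: `k`, `i` and the name of `t` in the registers `0`, `1`, `2`, and `0`
everywhere else. -/
def initState (k i t : ℕ) : State where
  reg x := if x = 0 then k else if x = 1 then i else if x = 2 then t else 0
  arr _ _ := 0

/-- The final state lists the names of the elements of `B` without repetition: register `0` holds
their number, and they are the first entries of array `0`. -/
def State.Outputs (s : State) {V : Type u} [Fintype V] (name : V ≃ Fin (Fintype.card V))
    (B : Set V) : Prop :=
  Set.BijOn (s.arr 0) (Set.Iio (s.reg 0)) ((fun w => (name w : ℕ)) '' B)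

end QueueTD

set_option linter.unusedSectionVars false

/-! A component in `A_t` is known, up to relabelling, once the adjacencies of its vertices to each
other and to the ancestors of `t` are known. Write P for the set of these ancestors, d = |P|, and
suppose that 4^(r(r+d)) components with r vertices are copies of one connected graph A, attached to
P in the same way. Then one copy is redundant. Deleting it restricts a layout; the substance is to
put it back into a one-queue layout of the rest (`CopyTriple.exists_insertion`).

Among the remaining copies, pigeonhole on the order pattern (inside the copy and relative to P)
leaves more than 2^(r²) with equal pattern. As A is connected and edges do not nest, any two of
these are ordered alike at all vertices of A. A halving argument (`exists_homogeneous`) then yields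
three copies in which any two vertices of A are interleaved or separated. Interleaving is an
equivalence relation, and non-nesting carries it along edges. Hence the classes form a chain, each
class occupies an interval of positions (its region) free of P, and only the last class has later
neighbours in P, only the first class earlier ones.

The new copy gets one slot in each region and is ordered inside the slots like the middle copy. The
old vertices of a region must be divided into a left and a right part so that, for every old edge
and every two consecutive classes, the earlier end is right of the slot of the first class iff the
later end is right of the slot of the second (`right_iff_right`). A path of the middle copy that
meets each class once would be such a divider. In general there is only a walk that moves back and
forth between classes; the parity of the number of its edges into the class that end before a given
position takes over that role. The middle copy itself goes to the right. New edges to P are compared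
with old edges by means of the first or third copy, and two edges that both use new vertices by
means of the middle copy.

The program gives powers of two as weights to the ancestors and to the vertices found in a
component. The sum of the weights of the neighbours of a vertex is then its row of adjacencies, and
the rows make up a code (`listCode`). Equal codes mean copies (`Input.Represents.isCopyFamily`). The
search stops once the code of the current component, with r vertices, has occurred 4^(r(d+r)) times.
Since there are few codes, this happens before the children of `t` are exhausted (`Searching.lt`,
`le_childrenOfSize`). -/

namespace QueueTD

/-! ### Three homogeneous copies in a one-queue layout -/

/-- Three copies `b 0`, `b 1`, `b 2` of a connected graph `A`, attached in the same way to `P`, in a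
one-queue layout `pos` of the subgraph of `G` induced by `S`. The copies have the same order
pattern, and any two of their vertices are either interleaved or separated. -/
structure CopyTriple {V ι : Type*} (G : SimpleGraph V) (A : SimpleGraph ι) (P S : Set V)
    (Q : ι → V → Prop) (pos : V → ℕ) (b : Fin 3 → ι → V) : Prop where
  conn : A.Connected
  mem : ∀ i x, b i x ∈ S
  subset : P ⊆ S
  notMem : ∀ i x, b i x ∉ P
  eq_of_eq : ∀ i j x y, b i x = b j y → i = j ∧ x = y
  pos_inj : Set.InjOn pos S
  adj_iff : ∀ i x, ∀ v ∈ S, G.Adj (b i x) v ↔ (∃ y, v = b i y ∧ A.Adj x y) ∨ (v ∈ P ∧ Q x v)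
  attached : ∃ x, ∃ p ∈ P, Q x p
  noNest : ∀ u ∈ S, ∀ v ∈ S, ∀ w ∈ S, ∀ x ∈ S, G.Adj u v → G.Adj w x →
    ¬ (pos u < pos w ∧ pos w < pos x ∧ pos x < pos v)
  mono : ∀ x, pos (b 0 x) < pos (b 1 x) ∧ pos (b 1 x) < pos (b 2 x)
  pattern : ∀ i j x y, pos (b i x) < pos (b i y) → pos (b j x) < pos (b j y)
  patternP : ∀ i j x, ∀ p ∈ P, pos (b i x) < pos p → pos (b j x) < pos p
  homogeneous : ∀ x y, x ≠ y →
    (pos (b 0 x) < pos (b 1 y) ∧ pos (b 1 x) < pos (b 2 y) ∧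
      pos (b 0 y) < pos (b 1 x) ∧ pos (b 1 y) < pos (b 2 x)) ∨
    pos (b 2 x) < pos (b 0 y) ∨ pos (b 2 y) < pos (b 0 x)

/-! ### Interleaving as an equivalence relation -/

namespace CopyTriple

variable {V ι : Type*} {G : SimpleGraph V} {A : SimpleGraph ι} {P S : Set V}
  {Q : ι → V → Prop} {pos : V → ℕ} {b : Fin 3 → ι → V}

/-- `x` and `y` are interleaved. -/
def Inter (pos : V → ℕ) (b : Fin 3 → ι → V) (x y : ι) : Prop :=
  pos (b 0 x) < pos (b 1 y) ∧ pos (b 1 x) < pos (b 2 y) ∧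
      pos (b 0 y) < pos (b 1 x) ∧ pos (b 1 y) < pos (b 2 x)

/-- `y` is a neighbour of `x` that comes after `x`. -/
def Up (A : SimpleGraph ι) (pos : V → ℕ) (b : Fin 3 → ι → V) (x y : ι) : Prop :=
  A.Adj x y ∧ pos (b 1 x) < pos (b 1 y)

theorem right_le (h : CopyTriple G A P S Q pos b) {u v w x : V} (hu : u ∈ S) (hv : v ∈ S)
    (hw : w ∈ S) (hx : x ∈ S) (huv : G.Adj u v) (hwx : G.Adj w x) (h1 : pos u < pos w)
    (h2 : pos w < pos x) : pos v ≤ pos x := by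
  by_contra hc
  exact h.noNest u hu v hv w hw x hx huv hwx ⟨h1, h2, by omega⟩

theorem left_le (h : CopyTriple G A P S Q pos b) {u v w x : V} (hu : u ∈ S) (hv : v ∈ S)
    (hw : w ∈ S) (hx : x ∈ S) (huv : G.Adj u v) (hwx : G.Adj w x) (h1 : pos x < pos v)
    (h2 : pos w < pos x) : pos w ≤ pos u := by
  by_contra hc
  exact h.noNest u hu v hv w hw x hx huv hwx ⟨by omega, h2, h1⟩

theorem pos_ne (h : CopyTriple G A P S Q pos b) {i j : Fin 3} {x y : ι} (hne : i ≠ j ∨ x ≠ y) :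
    pos (b i x) ≠ pos (b j y) := by
  intro hp
  have := h.eq_of_eq i j x y (h.pos_inj (h.mem _ _) (h.mem _ _) hp)
  tauto

theorem pos_ne_of_mem (h : CopyTriple G A P S Q pos b) {i : Fin 3} {x : ι} {p : V} (hp : p ∈ P) :
    pos (b i x) ≠ pos p := by
  intro he
  have := h.pos_inj (h.mem _ _) (h.subset hp) he
  exact h.notMem i x (this ▸ hp)

theorem adj_copy (h : CopyTriple G A P S Q pos b) (i : Fin 3) {x y : ι} (hxy : A.Adj x y) :
    G.Adj (b i x) (b i y) :=
  (h.adj_iff i x _ (h.mem i y)).2 (Or.inl ⟨y, rfl, hxy⟩)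

theorem adj_of_mem (h : CopyTriple G A P S Q pos b) (i : Fin 3) {x : ι} {p : V} (hp : p ∈ P)
    (hq : Q x p) : G.Adj (b i x) p :=
  (h.adj_iff i x _ (h.subset hp)).2 (Or.inr ⟨hp, hq⟩)

theorem inter_refl (h : CopyTriple G A P S Q pos b) (x : ι) : Inter pos b x x :=
  ⟨(h.mono x).1, (h.mono x).2, (h.mono x).1, (h.mono x).2⟩

theorem Inter.symm {x y : ι} (hxy : Inter pos b x y) : Inter pos b y x :=
  ⟨hxy.2.2.1, hxy.2.2.2, hxy.1, hxy.2.1⟩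

theorem trichotomy (h : CopyTriple G A P S Q pos b) (x y : ι) :
    Inter pos b x y ∨ pos (b 2 x) < pos (b 0 y) ∨ pos (b 2 y) < pos (b 0 x) := by
  by_cases hxy : x = y
  · subst hxy; exact Or.inl (h.inter_refl x)
  · exact h.homogeneous x y hxy

/-- By homogeneity it is enough to exclude separation. The middle copy of `y` lies after the first
copy of `z` and before the third copy of `x`, so `x` is not entirely before `z`; the other case is
symmetric. -/
theorem inter_trans (h : CopyTriple G A P S Q pos b) {x y z : ι} (hxy : Inter pos b x y)
    (hyz : Inter pos b y z) : Inter pos b x z := by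
  have hx := h.mono x
  have hz := h.mono z
  rcases h.trichotomy x z with h1 | h1 | h1
  · exact h1
  · obtain ⟨h2, h3, h4, h5⟩ := hxy
    obtain ⟨h6, h7, h8, h9⟩ := hyz
    omega
  · obtain ⟨h2, h3, h4, h5⟩ := hxy
    obtain ⟨h6, h7, h8, h9⟩ := hyz
    omega

theorem Inter.not_sep {x y : ι} (h : CopyTriple G A P S Q pos b) (hxy : Inter pos b x y) :
    ¬ pos (b 2 x) < pos (b 0 y) := by
  have hx := h.mono x
  have hy := h.mono y
  obtain ⟨h2, h3, h4, h5⟩ := hxy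
  omega

theorem sep_congr (h : CopyTriple G A P S Q pos b) {x y x' y' : ι} (hs : pos (b 2 x) < pos (b 0 y))
    (hx : Inter pos b x x') (hy : Inter pos b y y') : pos (b 2 x') < pos (b 0 y') := by
  rcases h.trichotomy x' y' with h1 | h1 | h1
  · exact absurd hs (Inter.not_sep h (h.inter_trans (h.inter_trans hx h1) hy.symm))
  · exact h1
  · have := h.mono x
    have := h.mono y
    have := h.mono x'
    have := h.mono y'
    obtain ⟨h2, h3, h4, h5⟩ := hx
    obtain ⟨h6, h7, h8, h9⟩ := hy
    omega

/-! ### Edges between classes -/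

theorem Up.pos_lt (h : CopyTriple G A P S Q pos b) {x y : ι} (hxy : Up A pos b x y) (i : Fin 3) :
    pos (b i x) < pos (b i y) := h.pattern 1 i x y hxy.2

theorem up_or_up (h : CopyTriple G A P S Q pos b) {x y : ι} (hxy : A.Adj x y) :
    Up A pos b x y ∨ Up A pos b y x := by
  have hne : pos (b 1 x) ≠ pos (b 1 y) := h.pos_ne (Or.inr hxy.ne)
  rcases lt_or_gt_of_ne hne with h1 | h1
  · exact Or.inl ⟨hxy, h1⟩
  · exact Or.inr ⟨hxy.symm, h1⟩

/-- Non-nesting edges without common ends have their later ends in the order of their earlier ends.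
This and its mirror image carry every relation between positions along the edges of `A`. -/
theorem up_right_lt (h : CopyTriple G A P S Q pos b) {x y x' y' : ι} (hxy : Up A pos b x y)
    (hxy' : Up A pos b x' y') {i j : Fin 3} (hij : i ≠ j) (hlt : pos (b i x) < pos (b j x')) :
    pos (b i y) < pos (b j y') :=
  lt_of_le_of_ne (h.right_le (h.mem _ _) (h.mem _ _) (h.mem _ _) (h.mem _ _) (h.adj_copy i hxy.1)
    (h.adj_copy j hxy'.1) hlt (hxy'.pos_lt h j)) (h.pos_ne (Or.inl hij))

theorem up_left_lt (h : CopyTriple G A P S Q pos b) {x y x' y' : ι} (hxy : Up A pos b x y)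
    (hxy' : Up A pos b x' y') {i j : Fin 3} (hij : i ≠ j) (hlt : pos (b i y) < pos (b j y')) :
    pos (b i x) < pos (b j x') :=
  lt_of_le_of_ne (h.left_le (h.mem _ _) (h.mem _ _) (h.mem _ _) (h.mem _ _) (h.adj_copy j hxy'.1)
    (h.adj_copy i hxy.1) hlt (hxy.pos_lt h i)) (h.pos_ne (Or.inl hij))

theorem inter_right (h : CopyTriple G A P S Q pos b) {x y x' y' : ι} (hxy : Up A pos b x y)
    (hxy' : Up A pos b x' y') (hi : Inter pos b x x') : Inter pos b y y' :=
  ⟨h.up_right_lt hxy hxy' (by decide) hi.1, h.up_right_lt hxy hxy' (by decide) hi.2.1,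
    h.up_right_lt hxy' hxy (by decide) hi.2.2.1, h.up_right_lt hxy' hxy (by decide) hi.2.2.2⟩

theorem inter_left (h : CopyTriple G A P S Q pos b) {x y x' y' : ι} (hxy : Up A pos b x y)
    (hxy' : Up A pos b x' y') (hi : Inter pos b y y') : Inter pos b x x' :=
  ⟨h.up_left_lt hxy hxy' (by decide) hi.1, h.up_left_lt hxy hxy' (by decide) hi.2.1,
    h.up_left_lt hxy' hxy (by decide) hi.2.2.1, h.up_left_lt hxy' hxy (by decide) hi.2.2.2⟩

theorem patternP' (h : CopyTriple G A P S Q pos b) {i : Fin 3} (j : Fin 3) {x : ι} {p : V}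
    (hp : p ∈ P) (hlt : pos p < pos (b i x)) : pos p < pos (b j x) := by
  by_contra hc
  have h1 : pos (b j x) < pos p := lt_of_le_of_ne (not_lt.1 hc) (h.pos_ne_of_mem hp)
  have := h.patternP j i x p hp h1
  omega

/-- A class with a later neighbour in `P` has no later neighbour in the copies. -/
theorem not_up_of_later (h : CopyTriple G A P S Q pos b) {x a c : ι} {p : V} (hp : p ∈ P)
    (hq : Q x p) (hlt : pos (b 1 x) < pos p) (hi : Inter pos b x a) : ¬ Up A pos b a c := by
  intro hac
  -- All copies of `x` are adjacent to the same `p`. Comparing first with middle copies in both ways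
  -- squeezes `p` between the first and the middle copy of `c`, although all copies of `c` lie on
  -- the same side of `p`.
  have h1 : pos p ≤ pos (b 1 c) := h.right_le (h.mem 0 x) (h.subset hp) (h.mem 1 a) (h.mem 1 c)
    (h.adj_of_mem 0 hp hq) (h.adj_copy 1 hac.1) hi.1 hac.2
  have h2 : pos (b 0 c) ≤ pos p := h.right_le (h.mem 0 a) (h.mem 0 c) (h.mem 1 x) (h.subset hp)
    (h.adj_copy 0 hac.1) (h.adj_of_mem 1 hp hq) hi.2.2.1 hlt
  have h3 := h.pos_ne_of_mem (i := 1) (x := c) hp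
  have h4 := h.pos_ne_of_mem (i := 0) (x := c) hp
  have := h.patternP 0 1 c p hp (by omega)
  omega

theorem not_up_of_earlier (h : CopyTriple G A P S Q pos b) {x a c : ι} {p : V} (hp : p ∈ P)
    (hq : Q x p) (hlt : pos p < pos (b 1 x)) (hi : Inter pos b x c) : ¬ Up A pos b a c := by
  intro hac
  have h1 : pos (b 0 a) ≤ pos p := h.left_le (h.subset hp) (h.mem 1 x) (h.mem 0 a) (h.mem 0 c)
    (h.adj_of_mem 1 hp hq).symm (h.adj_copy 0 hac.1) hi.2.2.1 (hac.pos_lt h 0)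
  have h2 : pos p ≤ pos (b 1 a) := h.left_le (h.mem 1 a) (h.mem 1 c) (h.subset hp) (h.mem 0 x)
    (h.adj_copy 1 hac.1) (h.adj_of_mem 0 hp hq).symm hi.1 (h.patternP' 0 hp hlt)
  have h3 := h.pos_ne_of_mem (i := 1) (x := a) hp
  have h4 := h.pos_ne_of_mem (i := 0) (x := a) hp
  have := h.patternP 0 1 a p hp (by omega)
  omega

/-- Adjacent vertices belong to distinct classes. -/
theorem not_inter_of_up (h : CopyTriple G A P S Q pos b) {a c : ι} (hac : Up A pos b a c) :
    ¬ Inter pos b a c := by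
  intro hi
  -- An edge inside a class lets the class spread to every neighbour, in either direction, and so
  -- over the connected graph `A`. The class then contains a vertex attached to `P`, which admits no
  -- further edge on that side.
  have hall : ∀ x, Inter pos b a x := by
    intro x
    obtain ⟨w⟩ := h.conn.preconnected a x
    have key : ∀ (u v : ι) (w : A.Walk u v), Inter pos b a u → Inter pos b a v := by
      intro u v w
      induction w with
      | nil => exact id
      | @cons u v z huv w ih =>
        intro hu
        apply ih
        rcases h.up_or_up huv with h1 | h1
        · exact h.inter_trans hi (h.inter_right hac h1 hu)
        · exact h.inter_left hac h1 (h.inter_trans hi.symm hu)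
    exact key _ _ w (h.inter_refl a)
  obtain ⟨x, p, hp, hq⟩ := h.attached
  have hne := h.pos_ne_of_mem (i := 1) (x := x) hp
  rcases lt_or_gt_of_ne hne with h1 | h1
  · exact h.not_up_of_later hp hq h1 (hall x).symm hac
  · exact h.not_up_of_earlier hp hq h1 (h.inter_trans (hall x).symm hi) hac

/-! ### Regions -/

section Regions

/-- The first position of the region of the class of `x`. -/
noncomputable def lo (pos : V → ℕ) (b : Fin 3 → ι → V) (x : ι) : ℕ :=
  sInf {n | ∃ y, Inter pos b x y ∧ n = pos (b 0 y)}

theorem lo_mem (h : CopyTriple G A P S Q pos b) (x : ι) :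
    ∃ y, Inter pos b x y ∧ lo pos b x = pos (b 0 y) :=
  Nat.sInf_mem (s := {n | ∃ y, Inter pos b x y ∧ n = pos (b 0 y)}) ⟨_, x, h.inter_refl x, rfl⟩

theorem lo_le {x y : ι} (hxy : Inter pos b x y) : lo pos b x ≤ pos (b 0 y) :=
  Nat.sInf_le ⟨y, hxy, rfl⟩

theorem lo_congr (h : CopyTriple G A P S Q pos b) {x y : ι} (hxy : Inter pos b x y) :
    lo pos b x = lo pos b y := by
  apply le_antisymm
  · obtain ⟨z, hz, he⟩ := h.lo_mem y
    rw [he]; exact lo_le (h.inter_trans hxy hz)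
  · obtain ⟨z, hz, he⟩ := h.lo_mem x
    rw [he]; exact lo_le (h.inter_trans hxy.symm hz)

/-- The last position of the region of the class of `x`. -/
noncomputable def hi (pos : V → ℕ) (b : Fin 3 → ι → V) (x : ι) : ℕ :=
  sSup {n | ∃ y, Inter pos b x y ∧ n = pos (b 2 y)}

variable [Fintype ι]

theorem hi_bdd (x : ι) : BddAbove {n | ∃ y, Inter pos b x y ∧ n = pos (b 2 y)} := by
  apply Set.Finite.bddAbove
  apply (Set.finite_range fun y => pos (b 2 y)).subset
  rintro n ⟨y, -, rfl⟩
  exact ⟨y, rfl⟩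

theorem hi_mem (h : CopyTriple G A P S Q pos b) (x : ι) :
    ∃ y, Inter pos b x y ∧ hi pos b x = pos (b 2 y) :=
  Nat.sSup_mem (s := {n | ∃ y, Inter pos b x y ∧ n = pos (b 2 y)}) ⟨_, x, h.inter_refl x, rfl⟩
    (hi_bdd x)

theorem le_hi {x y : ι} (hxy : Inter pos b x y) : pos (b 2 y) ≤ hi pos b x :=
  le_csSup (hi_bdd x) ⟨y, hxy, rfl⟩

theorem hi_congr (h : CopyTriple G A P S Q pos b) {x y : ι} (hxy : Inter pos b x y) :
    hi pos b x = hi pos b y := by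
  apply le_antisymm
  · obtain ⟨z, hz, he⟩ := h.hi_mem x
    rw [he]; exact le_hi (h.inter_trans hxy.symm hz)
  · obtain ⟨z, hz, he⟩ := h.hi_mem y
    rw [he]; exact le_hi (h.inter_trans hxy hz)

theorem lo_lt_hi (h : CopyTriple G A P S Q pos b) (x : ι) : lo pos b x < hi pos b x := by
  have h1 := lo_le (h.inter_refl x)
  have h2 := le_hi (h.inter_refl x)
  have := h.mono x
  omega

theorem hi_lt_lo (h : CopyTriple G A P S Q pos b) {x y : ι} (hs : pos (b 2 x) < pos (b 0 y)) :
    hi pos b x < lo pos b y := by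
  obtain ⟨x', hx, hex⟩ := h.hi_mem x
  obtain ⟨y', hy, hey⟩ := h.lo_mem y
  rw [hex, hey]
  exact h.sep_congr hs hx hy

theorem inter_or (h : CopyTriple G A P S Q pos b) (x y : ι) :
    Inter pos b x y ∨ hi pos b x < lo pos b y ∨ hi pos b y < lo pos b x := by
  rcases h.trichotomy x y with h1 | h1 | h1
  · exact Or.inl h1
  · exact Or.inr (Or.inl (h.hi_lt_lo h1))
  · exact Or.inr (Or.inr (h.hi_lt_lo h1))

theorem inter_of_mem (h : CopyTriple G A P S Q pos b) {x y : ι} {n : ℕ} (h1 : lo pos b x ≤ n)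
    (h2 : n ≤ hi pos b x) (h3 : lo pos b y ≤ n) (h4 : n ≤ hi pos b y) : Inter pos b x y := by
  rcases h.inter_or x y with h | h | h
  · exact h
  · omega
  · omega

theorem pos_mem_region (h : CopyTriple G A P S Q pos b) (i : Fin 3) (x : ι) :
    lo pos b x ≤ pos (b i x) ∧ pos (b i x) ≤ hi pos b x := by
  have h1 := lo_le (h.inter_refl x)
  have h2 := le_hi (h.inter_refl x)
  have := h.mono x
  fin_cases i <;> simp <;> omega

theorem hi_lt_lo_of_up (h : CopyTriple G A P S Q pos b) {x y : ι} (hxy : Up A pos b x y) :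
    hi pos b x < lo pos b y := by
  rcases h.inter_or x y with h1 | h1 | h1
  · exact absurd h1 (h.not_inter_of_up hxy)
  · exact h1
  · have h2 := h.pos_mem_region 1 x
    have h3 := h.pos_mem_region 1 y
    have := hxy.2
    omega

/-- Vertices of `P` lie outside all regions. -/
theorem not_mem_region (h : CopyTriple G A P S Q pos b) {p : V} (hp : p ∈ P) (x : ι) :
    pos p < lo pos b x ∨ hi pos b x < pos p := by
  by_contra hc
  push Not at hc
  obtain ⟨y, hy, hey⟩ := h.lo_mem x
  obtain ⟨z, hz, hez⟩ := h.hi_mem x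
  have h1 := h.pos_ne_of_mem (i := 0) (x := y) hp
  have h2 := h.pos_ne_of_mem (i := 2) (x := z) hp
  -- If `p` were inside the region, the common pattern would put it after the third copy of `y` and
  -- before the first copy of `z`, which separates two members of one class.
  have h3 := h.patternP 0 2 y p hp (by omega)
  have h4 := h.patternP' (i := 2) 0 (x := z) hp (by omega)
  exact Inter.not_sep h (h.inter_trans hy.symm hz) (by omega)

/-! ### The classes form a chain -/

/-- `n` and `m` are the first positions of the regions of adjacent classes. -/
def Next (A : SimpleGraph ι) (pos : V → ℕ) (b : Fin 3 → ι → V) (n m : ℕ) : Prop :=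
  ∃ x y, lo pos b x = n ∧ lo pos b y = m ∧ Up A pos b x y

theorem lo_eq_iff (h : CopyTriple G A P S Q pos b) {x y : ι} :
    lo pos b x = lo pos b y ↔ Inter pos b x y := by
  refine ⟨fun he => ?_, h.lo_congr⟩
  have := h.lo_lt_hi x
  have := h.lo_lt_hi y
  exact h.inter_of_mem (n := lo pos b x) le_rfl (by omega) (by omega) (by omega)

theorem Next.right_unique (h : CopyTriple G A P S Q pos b) {n m m' : ℕ}
    (h1 : Next A pos b n m) (h2 : Next A pos b n m') : m = m' := by
  obtain ⟨x, y, hx, rfl, hxy⟩ := h1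
  obtain ⟨x', y', hx', rfl, hxy'⟩ := h2
  exact h.lo_congr (h.inter_right hxy hxy' (h.lo_eq_iff.1 (hx.trans hx'.symm)))

theorem Next.left_unique (h : CopyTriple G A P S Q pos b) {n n' m : ℕ}
    (h1 : Next A pos b n m) (h2 : Next A pos b n' m) : n = n' := by
  obtain ⟨x, y, rfl, hy, hxy⟩ := h1
  obtain ⟨x', y', rfl, hy', hxy'⟩ := h2
  exact h.lo_congr (h.inter_left hxy hxy' (h.lo_eq_iff.1 (hy.trans hy'.symm)))

theorem Next.lt (h : CopyTriple G A P S Q pos b) {n m : ℕ} (h1 : Next A pos b n m) : n < m := by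
  obtain ⟨x, y, rfl, rfl, hxy⟩ := h1
  have := h.hi_lt_lo_of_up hxy
  have := h.lo_lt_hi x
  omega

theorem le_of_next_chain (h : CopyTriple G A P S Q pos b) {n m : ℕ}
    (h1 : Relation.ReflTransGen (Next A pos b) n m) : n ≤ m := by
  induction h1 with
  | refl => exact le_rfl
  | tail _ h2 ih => exact ih.trans (h2.lt h).le

/-- A class has at most one successor and one predecessor under `Next`. Each step of a walk in `A`
moves to one of them, hence forwards or backwards along one chain. -/
theorem chain (h : CopyTriple G A P S Q pos b) (x y : ι) :
    Relation.ReflTransGen (Next A pos b) (lo pos b x) (lo pos b y) ∨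
    Relation.ReflTransGen (Next A pos b) (lo pos b y) (lo pos b x) := by
  obtain ⟨w⟩ := h.conn.preconnected y x
  induction w with
  | nil => exact Or.inl .refl
  | @cons u v z huv w ih =>
    rcases h.up_or_up huv with h1 | h1
    · have hn : Next A pos b (lo pos b u) (lo pos b v) := ⟨u, v, rfl, rfl, h1⟩
      rcases ih with ih | ih
      · rcases Relation.ReflTransGen.cases_tail ih with h2 | ⟨c, hc, h2⟩
        · exact Or.inr (h2 ▸ .single hn)
        · exact Or.inl (h2.left_unique h hn ▸ hc)
      · exact Or.inr (ih.head hn)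
    · have hn : Next A pos b (lo pos b v) (lo pos b u) := ⟨v, u, rfl, rfl, h1⟩
      rcases ih with ih | ih
      · exact Or.inl (ih.tail hn)
      · rcases Relation.ReflTransGen.cases_head ih with h2 | ⟨c, hc, h2⟩
        · exact Or.inl (h2 ▸ .single hn)
        · exact Or.inr (hc.right_unique h hn ▸ h2)

/-- No class lies strictly between two adjacent classes. -/
theorem inter_of_between (h : CopyTriple G A P S Q pos b) {x y a : ι} (hxy : Up A pos b x y)
    (h1 : lo pos b x ≤ lo pos b a) (h2 : lo pos b a < lo pos b y) : Inter pos b x a := by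
  rw [← h.lo_eq_iff]
  rcases h.chain x a with h3 | h3
  · rcases Relation.ReflTransGen.cases_head h3 with h4 | ⟨c, hc, h4⟩
    · exact h4
    · have : c = lo pos b y := hc.right_unique h ⟨x, y, rfl, rfl, hxy⟩
      have := h.le_of_next_chain h4
      omega
  · exact le_antisymm h1 (h.le_of_next_chain h3)

theorem exists_up_of_lt (h : CopyTriple G A P S Q pos b) {x y : ι}
    (h1 : lo pos b x < lo pos b y) : ∃ a c, Inter pos b x a ∧ Up A pos b a c := by
  rcases h.chain x y with h3 | h3
  · rcases Relation.ReflTransGen.cases_head h3 with h4 | ⟨c, ⟨a, c, ha, hc, hac⟩, h4⟩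
    · omega
    · exact ⟨a, c, h.lo_eq_iff.1 ha.symm, hac⟩
  · have := h.le_of_next_chain h3
    omega

theorem exists_up_of_gt (h : CopyTriple G A P S Q pos b) {x y : ι}
    (h1 : lo pos b y < lo pos b x) : ∃ a c, Inter pos b x c ∧ Up A pos b a c := by
  rcases h.chain y x with h3 | h3
  · rcases Relation.ReflTransGen.cases_tail h3 with h4 | ⟨c, hc, ⟨a, c, ha, hc, hac⟩⟩
    · omega
    · exact ⟨a, c, h.lo_eq_iff.1 hc.symm, hac⟩
  · have := h.le_of_next_chain h3
    omega

end Regions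

end CopyTriple

namespace CopyTriple

variable {V ι : Type*} {G : SimpleGraph V} {A : SimpleGraph ι} {P S : Set V}
  {Q : ι → V → Prop} {pos : V → ℕ} {b : Fin 3 → ι → V} [Fintype ι]

/-! ### The side of a vertex -/

open Classical in
/-- The indicator of the vertices in the class of `a` whose middle copy precedes position `n`. -/
noncomputable def before (pos : V → ℕ) (b : Fin 3 → ι → V) (a : ι) (n : ℕ) (x : ι) : ZMod 2 :=
  if Inter pos b a x ∧ pos (b 1 x) < n then 1 else 0

/-- For a walk in the middle copy that starts at `w₀` and has the edges `l`, each listed with its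
earlier end first: the parity of the number of edges into the class of `a` that precede position
`n`, corrected at the start of the walk. -/
noncomputable def parity (pos : V → ℕ) (b : Fin 3 → ι → V) (l : List (ι × ι)) (w₀ : ι) (a : ι)
    (n : ℕ) : ZMod 2 :=
  (l.map fun e => before pos b a n e.2).sum + before pos b a n w₀

/-- The edges `l`, each listed with its earlier end first, form a walk from a vertex `w₀` of the
first class to a vertex `w₁` of the last class. -/
structure IsCrossing (A : SimpleGraph ι) (pos : V → ℕ) (b : Fin 3 → ι → V) (l : List (ι × ι))
    (w₀ w₁ : ι) : Prop where
  up : ∀ e ∈ l, Up A pos b e.1 e.2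
  sum_eq : ∀ f : ι → ZMod 2, (l.map fun e => f e.1 + f e.2).sum = f w₀ + f w₁
  first : ∀ x, lo pos b w₀ ≤ lo pos b x
  last : ∀ x, lo pos b x ≤ lo pos b w₁

theorem exists_isCrossing (h : CopyTriple G A P S Q pos b) :
    ∃ l w₀ w₁, IsCrossing A pos b l w₀ w₁ := by
  have hne : Nonempty ι := h.conn.nonempty
  obtain ⟨w₀, h0⟩ := Finite.exists_min (fun x => lo pos b x)
  obtain ⟨w₁, h1⟩ := Finite.exists_max (fun x => lo pos b x)
  obtain ⟨w⟩ := h.conn.preconnected w₀ w₁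
  have key : ∀ (u v : ι) (w : A.Walk u v), ∃ l : List (ι × ι), (∀ e ∈ l, Up A pos b e.1 e.2) ∧
      ∀ f : ι → ZMod 2, (l.map fun e => f e.1 + f e.2).sum = f u + f v := by
    intro u v w
    induction w with
    | nil => exact ⟨[], by simp, fun f => by simp [CharTwo.add_self_eq_zero]⟩
    | @cons u v z huv w ih =>
      obtain ⟨l, hl, hf⟩ := ih
      -- Modulo two, the vertex shared by consecutive edges cancels, whichever end of each edge it
      -- is.
      have e1 : ∀ a b c : ZMod 2, a + b + (b + c) = a + c := by decide
      have e2 : ∀ a b c : ZMod 2, b + a + (b + c) = a + c := by decide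
      rcases h.up_or_up huv with h1 | h1
      · refine ⟨(u, v) :: l, by simpa using ⟨h1, fun a c hm => hl (a, c) hm⟩, fun f => ?_⟩
        rw [List.map_cons, List.sum_cons, hf, e1]
      · refine ⟨(v, u) :: l, by simpa using ⟨h1, fun a c hm => hl (a, c) hm⟩, fun f => ?_⟩
        rw [List.map_cons, List.sum_cons, hf, e2]
  obtain ⟨l, hl, hf⟩ := key _ _ w
  exact ⟨l, w₀, w₁, hl, hf, h0, h1⟩

variable {l : List (ι × ι)} {w₀ w₁ : ι}

/-- An inner visit of the walk uses two edge ends, so modulo two the count of later ends corrected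
at the start equals the count of earlier ends corrected at the finish. This lets the same parity be
read from the edges below or above a class. -/
theorem parity_eq (hl : IsCrossing A pos b l w₀ w₁) (a : ι) (n : ℕ) :
    parity pos b l w₀ a n = (l.map fun e => before pos b a n e.1).sum + before pos b a n w₁ := by
  have h1 := hl.sum_eq (before pos b a n)
  rw [List.sum_map_add] at h1
  have e : ∀ x y z w : ZMod 2, x + y = z + w → y + z = x + w := by decide
  exact e _ _ _ _ h1

theorem before_congr (h : CopyTriple G A P S Q pos b) {a a' : ι} (haa : Inter pos b a a') (n : ℕ)
    (x : ι) : before pos b a n x = before pos b a' n x := by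
  have : Inter pos b a x ↔ Inter pos b a' x :=
    ⟨fun hx => h.inter_trans haa.symm hx, fun hx => h.inter_trans haa hx⟩
  rw [before, before, this]

theorem parity_congr (h : CopyTriple G A P S Q pos b) {a a' : ι} (haa : Inter pos b a a') (n : ℕ) :
    parity pos b l w₀ a n = parity pos b l w₀ a' n := by
  simp only [parity, h.before_congr haa]

theorem before_eq_zero_of_lt (h : CopyTriple G A P S Q pos b) {a x : ι} {n : ℕ}
    (hn : n < lo pos b a) : before pos b a n x = 0 := by
  rw [before, if_neg]
  rintro ⟨h1, h2⟩
  have := h.pos_mem_region 1 x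
  rw [← h.lo_congr h1] at this
  omega

theorem parity_eq_zero (h : CopyTriple G A P S Q pos b) {a : ι} {n : ℕ} (hn : n < lo pos b a) :
    parity pos b l w₀ a n = 0 := by
  simp [parity, h.before_eq_zero_of_lt hn]

theorem not_inter_last (h : CopyTriple G A P S Q pos b) (hl : IsCrossing A pos b l w₀ w₁) {a c : ι}
    (hac : Up A pos b a c) : ¬ Inter pos b a w₁ := by
  intro hi
  have h1 := h.lo_congr hi
  have h2 := h.hi_lt_lo_of_up hac
  have h3 := h.lo_lt_hi a
  have := hl.last c
  omega

theorem not_inter_first (h : CopyTriple G A P S Q pos b) (hl : IsCrossing A pos b l w₀ w₁)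
    {a c : ι} (hac : Up A pos b a c) : ¬ Inter pos b c w₀ := by
  intro hi
  have h1 := h.lo_congr hi
  have h2 := h.hi_lt_lo_of_up hac
  have h3 := h.lo_lt_hi a
  have := hl.first a
  omega

/-- The walk crosses between two adjacent classes an odd number of times. -/
theorem parity_eq_one (h : CopyTriple G A P S Q pos b) (hl : IsCrossing A pos b l w₀ w₁) {a : ι}
    {n : ℕ} (hn : hi pos b a < n) : parity pos b l w₀ a n = 1 := by
  classical
  have hb : ∀ x, before pos b a n x = if Inter pos b a x then 1 else 0 := by
    intro x
    rw [before]
    congr 1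
    simp only [eq_iff_iff, and_iff_left_iff_imp]
    intro hx
    have := (h.pos_mem_region 1 x).2
    rw [← h.hi_congr hx] at this
    omega
  by_cases hw : Inter pos b a w₀
  · have hz : (l.map fun e => before pos b a n e.2).sum = 0 := by
      apply List.sum_eq_zero
      intro z hz
      obtain ⟨e, he, rfl⟩ := List.mem_map.1 hz
      rw [hb, if_neg]
      exact fun hi => h.not_inter_first hl (hl.up e he) (h.inter_trans hi.symm hw)
    rw [parity, hz, hb, if_pos hw, zero_add]
  -- The cut below the class of `a`: an edge changes the indicator exactly when its later end is in
  -- this class, and the indicator is 0 at the start of the walk and 1 at its end.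
  · have h1 := hl.sum_eq (fun x => if lo pos b a ≤ lo pos b x then 1 else 0)
    have hlt : ¬ lo pos b a ≤ lo pos b w₀ := by
      intro hle
      exact hw (h.lo_eq_iff.1 (le_antisymm hle (hl.first a)))
    have hlist : (l.map fun e => before pos b a n e.2) =
        l.map fun e => ((if lo pos b a ≤ lo pos b e.1 then 1 else 0) +
          (if lo pos b a ≤ lo pos b e.2 then 1 else 0) : ZMod 2) := by
      apply List.map_congr_left
      intro e he
      have hu := hl.up e he
      have h3 := h.hi_lt_lo_of_up hu
      have h4 := h.lo_lt_hi e.1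
      rw [hb]
      by_cases hi : Inter pos b a e.2
      · have h5 := h.lo_congr hi
        rw [if_pos hi, if_neg (by omega), if_pos (by omega), zero_add]
      · rw [if_neg hi]
        by_cases h6 : lo pos b a ≤ lo pos b e.1
        · rw [if_pos h6, if_pos (by omega)]; decide
        · rw [if_neg h6, if_neg, add_zero]
          intro h7
          rcases Nat.lt_or_ge (lo pos b a) (lo pos b e.2) with h8 | h8
          · have := h.lo_congr (h.inter_of_between hu (by omega) h8)
            omega
          · exact hi (h.lo_eq_iff.1 (le_antisymm h7 h8))
    rw [parity, hb, if_neg hw, add_zero, hlist, h1, if_neg hlt, if_pos (hl.last a), zero_add]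

/-- `v` belongs to the right of the slot of the new copy in the region of `a`. -/
def Right (pos : V → ℕ) (b : Fin 3 → ι → V) (l : List (ι × ι)) (w₀ : ι) (v : V) (a : ι) : Prop :=
  (v ∈ Set.range (b 1) ∧ lo pos b a ≤ pos v) ∨
    (v ∉ Set.range (b 1) ∧ parity pos b l w₀ a (pos v) = 1)

theorem right_copy (x a : ι) : Right pos b l w₀ (b 1 x) a ↔ lo pos b a ≤ pos (b 1 x) := by
  simp [Right]

theorem right_of_notMem {v : V} (hv : v ∉ Set.range (b 1)) (a : ι) :
    Right pos b l w₀ v a ↔ parity pos b l w₀ a (pos v) = 1 := by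
  simp [Right, hv]

theorem Right.congr (h : CopyTriple G A P S Q pos b) {a a' : ι} (haa : Inter pos b a a') {v : V} :
    Right pos b l w₀ v a ↔ Right pos b l w₀ v a' := by
  rw [Right, Right, h.lo_congr haa, h.parity_congr haa]

theorem not_right_of_lt (h : CopyTriple G A P S Q pos b) {v : V} {a : ι}
    (hv : pos v < lo pos b a) : ¬ Right pos b l w₀ v a := by
  rintro (⟨-, h1⟩ | ⟨-, h1⟩)
  · omega
  · rw [h.parity_eq_zero hv] at h1
    exact zero_ne_one h1

theorem right_of_gt (h : CopyTriple G A P S Q pos b) (hl : IsCrossing A pos b l w₀ w₁) {v : V}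
    {a : ι} (hv : hi pos b a < pos v) : Right pos b l w₀ v a := by
  by_cases hr : v ∈ Set.range (b 1)
  · exact Or.inl ⟨hr, by have := h.lo_lt_hi a; omega⟩
  · exact Or.inr ⟨hr, h.parity_eq_one hl hv⟩

/-- Count the walk edges from the class of `a` to that of `c`, by earlier ends on one side and by
later ends on the other. Since none of them nests with `yz`, such an edge starts before `y` iff it
ends before `z`. Excluding the middle copy rules out ties. -/
theorem parity_right (h : CopyTriple G A P S Q pos b) (hl : IsCrossing A pos b l w₀ w₁) {a c : ι}
    (hac : Up A pos b a c) {y z : V} (hy : y ∈ S) (hz : z ∈ S) (hy1 : y ∉ Set.range (b 1))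
    (hz1 : z ∉ Set.range (b 1)) (hyz : G.Adj y z) (hlt : pos y < pos z) :
    parity pos b l w₀ a (pos y) = parity pos b l w₀ c (pos z) := by
  have h1 : before pos b a (pos y) w₁ = 0 := by
    rw [before, if_neg]
    exact fun hi => h.not_inter_last hl hac hi.1
  have h2 : before pos b c (pos z) w₀ = 0 := by
    rw [before, if_neg]
    exact fun hi => h.not_inter_first hl hac hi.1
  rw [parity_eq hl, h1, add_zero, parity, h2, add_zero]
  congr 1
  apply List.map_congr_left
  intro e he
  have hu := hl.up e he
  rw [before, before]
  congr 1
  have hne : ∀ (v : V), v ∈ S → v ∉ Set.range (b 1) → ∀ x, pos (b 1 x) ≠ pos v := by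
    intro v hv hv1 x hx
    exact hv1 ⟨x, h.pos_inj (h.mem 1 x) hv hx⟩
  have hin : Inter pos b a e.1 ↔ Inter pos b c e.2 :=
    ⟨h.inter_right hac hu, h.inter_left hac hu⟩
  have hlt' : pos (b 1 e.1) < pos y ↔ pos (b 1 e.2) < pos z := by
    constructor
    · intro hx
      exact lt_of_le_of_ne (h.right_le (h.mem 1 _) (h.mem 1 _) hy hz (h.adj_copy 1 hu.1) hyz hx hlt)
        (hne z hz hz1 _)
    · intro hx
      exact lt_of_le_of_ne (h.left_le hy hz (h.mem 1 _) (h.mem 1 _) hyz (h.adj_copy 1 hu.1) hx hu.2)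
        (hne y hy hy1 _)
  rw [hin, hlt']

theorem sep_of_hi_lt (h : CopyTriple G A P S Q pos b) {x y : ι} (hs : hi pos b x < lo pos b y) :
    pos (b 2 x) < pos (b 0 y) := by
  have := (h.pos_mem_region 2 x).2
  have := (h.pos_mem_region 0 y).1
  omega

/-- Both ends of an edge lie on the same side of the new copy. -/
theorem right_iff_right (h : CopyTriple G A P S Q pos b) (hl : IsCrossing A pos b l w₀ w₁)
    {a c : ι} (hac : Up A pos b a c) {y z : V} (hy : y ∈ S) (hz : z ∈ S) (hyz : G.Adj y z)
    (hlt : pos y < pos z) : Right pos b l w₀ y a ↔ Right pos b l w₀ z c := by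
  by_cases hy1 : y ∈ Set.range (b 1)
  · obtain ⟨x, rfl⟩ := hy1
    rcases (h.adj_iff 1 x z hz).1 hyz with ⟨x', rfl, hxx⟩ | ⟨hp, hq⟩
    · have hu : Up A pos b x x' := ⟨hxx, hlt⟩
      rw [right_copy, right_copy]
      have h1 := h.pos_mem_region 1 x
      have h2 := h.pos_mem_region 1 x'
      -- An edge of the middle copy either joins the classes of `a` and `c`, or lies before or after
      -- both of its comparison classes; the relative order of regions is carried along the two
      -- edges.
      rcases h.inter_or a x with h3 | h3 | h3
      · have := h.lo_congr h3
        have := h.lo_congr (h.inter_right hac hu h3)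
        omega
      · have h4 := h.up_right_lt hac hu (i := 2) (j := 0) (by decide) (h.sep_of_hi_lt h3)
        have := h.hi_lt_lo h4
        have := h.lo_lt_hi a
        have := h.lo_lt_hi c
        omega
      · have h4 := h.up_right_lt hu hac (i := 2) (j := 0) (by decide) (h.sep_of_hi_lt h3)
        have := h.hi_lt_lo h4
        omega
    · rw [right_copy]
      have hax : ¬ Inter pos b x a := fun hi => h.not_up_of_later hp hq hlt hi hac
      -- A later neighbour in `P` puts `x` into the last class. Hence the region of `a` is strictly
      -- earlier, and comparing with the edge from `a` to `c` in the third copy places `z` beyond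
      -- the region of `c`.
      have hlo : ¬ lo pos b x < lo pos b a := by
        intro hc
        obtain ⟨a', c', hi, hu⟩ := h.exists_up_of_lt hc
        exact h.not_up_of_later hp hq hlt hi hu
      rcases h.inter_or x a with h3 | h3 | h3
      · exact absurd h3 hax
      · have := h.lo_lt_hi x
        omega
      · have h1 := h.pos_mem_region 1 x
        have := h.lo_lt_hi a
        refine iff_of_true (by omega) (h.right_of_gt hl ?_)
        have h4 : pos (b 2 c) ≤ pos z := h.right_le (h.mem 2 a) (h.mem 2 c) (h.mem 0 x) hz
          (h.adj_copy 2 hac.1) (h.adj_of_mem 0 hp hq) (h.sep_of_hi_lt h3) (h.patternP 1 0 x z hp hlt)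
        have h5 := h.pos_mem_region 2 c
        rcases h.not_mem_region hp c with h6 | h6
        · omega
        · exact h6
  · by_cases hz1 : z ∈ Set.range (b 1)
    · obtain ⟨x, rfl⟩ := hz1
      rcases (h.adj_iff 1 x y hy).1 hyz.symm with ⟨x', rfl, hxx⟩ | ⟨hp, hq⟩
      · exact absurd ⟨x', rfl⟩ hy1
      · rw [right_copy]
        -- The mirror image: `x` is in the first class, so both ends lie to the left.
        have hax : ¬ Inter pos b x c := fun hi => h.not_up_of_earlier hp hq hlt hi hac
        have hlo : ¬ lo pos b c < lo pos b x := by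
          intro hc
          obtain ⟨a', c', hi, hu⟩ := h.exists_up_of_gt hc
          exact h.not_up_of_earlier hp hq hlt hi hu
        rcases h.inter_or x c with h3 | h3 | h3
        · exact absurd h3 hax
        · have h1 := h.pos_mem_region 1 x
          refine iff_of_false (h.not_right_of_lt ?_) (by omega)
          have h4 : pos y ≤ pos (b 0 a) := h.left_le (h.mem 0 a) (h.mem 0 c) hy (h.mem 2 x)
            (h.adj_copy 0 hac.1) (h.adj_of_mem 2 hp hq).symm (h.sep_of_hi_lt h3)
            (h.patternP' 2 hp hlt)
          have h5 := h.pos_mem_region 0 a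
          rcases h.not_mem_region hp a with h6 | h6
          · exact h6
          · omega
        · have := h.lo_lt_hi c
          omega
    · rw [right_of_notMem hy1, right_of_notMem hz1, h.parity_right hl hac hy hz hy1 hz1 hyz hlt]

/-- The class of `a` has no later class. -/
def IsTop (A : SimpleGraph ι) (pos : V → ℕ) (b : Fin 3 → ι → V) (a : ι) : Prop :=
  ∀ x y, Inter pos b a x → ¬ Up A pos b x y

/-- The class of `a` has no earlier class. -/
def IsBot (A : SimpleGraph ι) (pos : V → ℕ) (b : Fin 3 → ι → V) (a : ι) : Prop :=
  ∀ x y, Inter pos b a y → ¬ Up A pos b x y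

/-- No walk edge starts in the last class, so only the final correction of `parity_eq` survives: the
divider there is the middle copy of `w₁` alone. -/
theorem IsTop.right_iff (h : CopyTriple G A P S Q pos b) (hl : IsCrossing A pos b l w₀ w₁) {a : ι}
    (ha : IsTop A pos b a) : Inter pos b a w₁ ∧ ∀ v ∉ Set.range (b 1),
      (Right pos b l w₀ v a ↔ pos (b 1 w₁) < pos v) := by
  have hw : Inter pos b a w₁ := by
    rw [← h.lo_eq_iff]
    by_contra hne
    obtain ⟨x, y, hx, hu⟩ := h.exists_up_of_lt (lt_of_le_of_ne (hl.last a) hne)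
    exact ha x y hx hu
  refine ⟨hw, fun v hv => ?_⟩
  have hz : (l.map fun e => before pos b a (pos v) e.1).sum = 0 := by
    apply List.sum_eq_zero
    intro z hz
    obtain ⟨e, he, rfl⟩ := List.mem_map.1 hz
    rw [before, if_neg]
    exact fun hi => ha _ _ hi.1 (hl.up e he)
  rw [right_of_notMem hv, parity_eq hl, hz, zero_add, before]
  simp [hw]

theorem IsBot.right_iff (h : CopyTriple G A P S Q pos b) (hl : IsCrossing A pos b l w₀ w₁) {a : ι}
    (ha : IsBot A pos b a) : Inter pos b a w₀ ∧ ∀ v ∉ Set.range (b 1),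
      (Right pos b l w₀ v a ↔ pos (b 1 w₀) < pos v) := by
  have hw : Inter pos b a w₀ := by
    rw [← h.lo_eq_iff]
    by_contra hne
    obtain ⟨x, y, hx, hu⟩ := h.exists_up_of_gt (lt_of_le_of_ne (hl.first a) (Ne.symm hne))
    exact ha x y hx hu
  refine ⟨hw, fun v hv => ?_⟩
  have hz : (l.map fun e => before pos b a (pos v) e.2).sum = 0 := by
    apply List.sum_eq_zero
    intro z hz
    obtain ⟨e, he, rfl⟩ := List.mem_map.1 hz
    rw [before, if_neg]
    exact fun hi => ha _ _ hi.1 (hl.up e he)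
  rw [right_of_notMem hv, parity, hz, zero_add, before]
  simp [hw]

/-- In the first and last classes the slot is effectively between the first and the third copy. So
one of these old copies can stand in for a new vertex with a neighbour in `P`. -/
theorem lt_of_right (h : CopyTriple G A P S Q pos b) (hl : IsCrossing A pos b l w₀ w₁) {a : ι}
    (ha : IsTop A pos b a ∨ IsBot A pos b a) {v : V} (hv : Right pos b l w₀ v a) :
    pos (b 0 a) < pos v := by
  by_cases hr : v ∈ Set.range (b 1)
  · obtain ⟨x, rfl⟩ := hr
    rw [right_copy] at hv
    rcases h.inter_or a x with h3 | h3 | h3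
    · exact h3.1
    · have := h.sep_of_hi_lt h3
      have := h.mono x
      have := h.mono a
      omega
    · have := h.pos_mem_region 1 x
      omega
  · rcases ha with ha | ha
    · obtain ⟨hi, hiff⟩ := ha.right_iff h hl
      have := (hiff v hr).1 hv
      have := hi.1
      omega
    · obtain ⟨hi, hiff⟩ := ha.right_iff h hl
      have := (hiff v hr).1 hv
      have := hi.1
      omega

theorem lt_of_not_right (h : CopyTriple G A P S Q pos b) (hl : IsCrossing A pos b l w₀ w₁) {a : ι}
    (ha : IsTop A pos b a ∨ IsBot A pos b a) {v : V} (hvS : v ∈ S)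
    (hv : ¬ Right pos b l w₀ v a) : pos v < pos (b 2 a) := by
  by_cases hr : v ∈ Set.range (b 1)
  · obtain ⟨x, rfl⟩ := hr
    rw [right_copy] at hv
    have := h.pos_mem_region 2 a
    omega
  · have hne : ∀ x, pos (b 1 x) ≠ pos v := fun x hx => hr ⟨x, h.pos_inj (h.mem 1 x) hvS hx⟩
    rcases ha with ha | ha
    · obtain ⟨hi, hiff⟩ := ha.right_iff h hl
      have := mt (hiff v hr).2 hv
      have := hi.2.2.2
      omega
    · obtain ⟨hi, hiff⟩ := ha.right_iff h hl
      have := mt (hiff v hr).2 hv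
      have := hi.2.2.2
      omega

theorem isTop_of_later (h : CopyTriple G A P S Q pos b) {x : ι} {p : V} (hp : p ∈ P)
    (hq : Q x p) (hlt : pos (b 1 x) < pos p) : IsTop A pos b x :=
  fun _ _ hi => h.not_up_of_later hp hq hlt hi

theorem isBot_of_earlier (h : CopyTriple G A P S Q pos b) {x : ι} {p : V} (hp : p ∈ P)
    (hq : Q x p) (hlt : pos p < pos (b 1 x)) : IsBot A pos b x :=
  fun _ _ hi => h.not_up_of_earlier hp hq hlt hi

end CopyTriple
namespace CopyTriple

variable {V ι : Type*} {G : SimpleGraph V} {A : SimpleGraph ι} {P S : Set V}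
  {Q : ι → V → Prop} {pos : V → ℕ} {b : Fin 3 → ι → V} [Fintype ι]
  {l : List (ι × ι)} {w₀ w₁ : ι}

/-! ### The new order -/

open Classical in
/-- Collapses every region to its first position. -/
noncomputable def reg (pos : V → ℕ) (b : Fin 3 → ι → V) (n : ℕ) : ℕ :=
  if h : ∃ a, lo pos b a ≤ n ∧ n ≤ hi pos b a then lo pos b h.choose else n

open Classical in
/-- The key of an old vertex in the new order. -/
noncomputable def oldKey (pos : V → ℕ) (b : Fin 3 → ι → V) (l : List (ι × ι)) (w₀ : ι) (v : V) :
    ℕ ×ₗ ℕ ×ₗ ℕ :=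
  toLex (reg pos b (pos v), toLex (if ∃ a, (lo pos b a ≤ pos v ∧ pos v ≤ hi pos b a) ∧
    Right pos b l w₀ v a then 2 else 0, pos v))

/-- The key of the vertex `a` of the new copy in the new order. -/
noncomputable def slot (pos : V → ℕ) (b : Fin 3 → ι → V) (a : ι) : ℕ ×ₗ ℕ ×ₗ ℕ :=
  toLex (lo pos b a, toLex (1, pos (b 1 a)))

theorem reg_of_mem (h : CopyTriple G A P S Q pos b) {a : ι} {n : ℕ} (h1 : lo pos b a ≤ n)
    (h2 : n ≤ hi pos b a) : reg pos b n = lo pos b a := by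
  have hex : ∃ a, lo pos b a ≤ n ∧ n ≤ hi pos b a := ⟨a, h1, h2⟩
  rw [reg, dif_pos hex]
  exact h.lo_congr (h.inter_of_mem hex.choose_spec.1 hex.choose_spec.2 h1 h2)

theorem reg_of_notMem {n : ℕ} (hn : ¬ ∃ a, lo pos b a ≤ n ∧ n ≤ hi pos b a) :
    reg pos b n = n := by
  rw [reg, dif_neg hn]

theorem reg_le (h : CopyTriple G A P S Q pos b) (n : ℕ) : reg pos b n ≤ n := by
  by_cases hn : ∃ a, lo pos b a ≤ n ∧ n ≤ hi pos b a
  · obtain ⟨a, h1, h2⟩ := hn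
    rw [h.reg_of_mem h1 h2]; exact h1
  · rw [reg_of_notMem hn]

theorem lo_lt_reg (h : CopyTriple G A P S Q pos b) {a : ι} {n : ℕ} (hn : hi pos b a < n) :
    lo pos b a < reg pos b n := by
  have h0 := h.lo_lt_hi a
  by_cases hc : ∃ c, lo pos b c ≤ n ∧ n ≤ hi pos b c
  · obtain ⟨c, h1, h2⟩ := hc
    rw [h.reg_of_mem h1 h2]
    rcases h.inter_or a c with h3 | h3 | h3
    · have := h.hi_congr h3
      omega
    · omega
    · omega
  · rw [reg_of_notMem hc]; omega

theorem reg_mono (h : CopyTriple G A P S Q pos b) {n m : ℕ} (hnm : n ≤ m) :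
    reg pos b n ≤ reg pos b m := by
  by_cases hn : ∃ a, lo pos b a ≤ n ∧ n ≤ hi pos b a
  · obtain ⟨a, h1, h2⟩ := hn
    rw [h.reg_of_mem h1 h2]
    rcases Nat.lt_or_ge (hi pos b a) m with h3 | h3
    · exact (h.lo_lt_reg h3).le
    · rw [h.reg_of_mem (by omega) h3]
  · by_cases hm : ∃ a, lo pos b a ≤ m ∧ m ≤ hi pos b a
    · obtain ⟨a, h1, h2⟩ := hm
      rw [reg_of_notMem hn, h.reg_of_mem h1 h2]
      by_contra hc
      exact hn ⟨a, by omega, by omega⟩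
    · rwa [reg_of_notMem hn, reg_of_notMem hm]

theorem oldKey_of_mem (h : CopyTriple G A P S Q pos b) {a : ι} {v : V} (h1 : lo pos b a ≤ pos v)
    (h2 : pos v ≤ hi pos b a) [Decidable (Right pos b l w₀ v a)] : oldKey pos b l w₀ v =
      toLex (lo pos b a, toLex (if Right pos b l w₀ v a then 2 else 0, pos v)) := by
  rw [oldKey, h.reg_of_mem h1 h2]
  have : (∃ a, (lo pos b a ≤ pos v ∧ pos v ≤ hi pos b a) ∧ Right pos b l w₀ v a) ↔
      Right pos b l w₀ v a := by
    refine ⟨?_, fun hr => ⟨a, ⟨h1, h2⟩, hr⟩⟩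
    rintro ⟨c, ⟨h3, h4⟩, hr⟩
    exact (Right.congr h (h.inter_of_mem h3 h4 h1 h2)).1 hr
  simp only [this]

theorem oldKey_lt_slot (h : CopyTriple G A P S Q pos b) (hl : IsCrossing A pos b l w₀ w₁) {a : ι}
    {v : V} (hr : ¬ Right pos b l w₀ v a) : oldKey pos b l w₀ v < slot pos b a := by
  classical
  have h2 : pos v ≤ hi pos b a := by
    by_contra hc
    exact hr (h.right_of_gt hl (not_le.1 hc))
  rcases Nat.lt_or_ge (pos v) (lo pos b a) with h1 | h1
  · have := h.reg_le (pos v)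
    rw [oldKey, slot, Prod.Lex.toLex_lt_toLex]
    exact Or.inl (by omega)
  · rw [h.oldKey_of_mem h1 h2, if_neg hr, slot, Prod.Lex.toLex_lt_toLex]
    refine Or.inr ⟨rfl, ?_⟩
    rw [Prod.Lex.toLex_lt_toLex]
    exact Or.inl Nat.zero_lt_one

theorem slot_lt_oldKey (h : CopyTriple G A P S Q pos b) {a : ι} {v : V}
    (hr : Right pos b l w₀ v a) : slot pos b a < oldKey pos b l w₀ v := by
  classical
  have h1 : lo pos b a ≤ pos v := by
    by_contra hc
    exact h.not_right_of_lt (not_le.1 hc) hr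
  rcases Nat.lt_or_ge (hi pos b a) (pos v) with h2 | h2
  · have := h.lo_lt_reg h2
    rw [oldKey, slot, Prod.Lex.toLex_lt_toLex]
    exact Or.inl this
  · rw [h.oldKey_of_mem h1 h2, if_pos hr, slot, Prod.Lex.toLex_lt_toLex]
    refine Or.inr ⟨rfl, ?_⟩
    rw [Prod.Lex.toLex_lt_toLex]
    exact Or.inl Nat.one_lt_two

/-- Two old vertices change their order only if they lie in a common region on different sides. -/
theorem exists_of_swap (h : CopyTriple G A P S Q pos b) {v v' : V} (hlt : pos v < pos v')
    (hk : oldKey pos b l w₀ v' < oldKey pos b l w₀ v) :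
    ∃ a, (lo pos b a ≤ pos v ∧ pos v ≤ hi pos b a) ∧ (lo pos b a ≤ pos v' ∧ pos v' ≤ hi pos b a) ∧
      Right pos b l w₀ v a ∧ ¬ Right pos b l w₀ v' a := by
  classical
  have hm := h.reg_mono hlt.le
  by_cases hin : ∃ a, (lo pos b a ≤ pos v ∧ pos v ≤ hi pos b a) ∧
      (lo pos b a ≤ pos v' ∧ pos v' ≤ hi pos b a)
  · obtain ⟨a, h1, h2⟩ := hin
    refine ⟨a, h1, h2, ?_⟩
    rw [h.oldKey_of_mem h1.1 h1.2, h.oldKey_of_mem h2.1 h2.2, Prod.Lex.toLex_lt_toLex] at hk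
    rcases hk with hk | ⟨-, hk⟩
    · exact absurd hk (lt_irrefl _)
    · rw [Prod.Lex.toLex_lt_toLex] at hk
      rcases hk with hk | ⟨-, hk⟩
      · dsimp only at hk
        split_ifs at hk with h3 h4 h4 <;> simp_all
      · dsimp only at hk
        omega
  · exfalso
    have hne : reg pos b (pos v) < reg pos b (pos v') := by
      apply lt_of_le_of_ne hm
      intro he
      by_cases h1 : ∃ a, lo pos b a ≤ pos v ∧ pos v ≤ hi pos b a
      · obtain ⟨a, h1⟩ := h1
        rw [h.reg_of_mem h1.1 h1.2] at he
        rcases Nat.lt_or_ge (hi pos b a) (pos v') with h3 | h3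
        · have := h.lo_lt_reg h3
          omega
        · exact hin ⟨a, h1, by omega, h3⟩
      · rw [reg_of_notMem h1] at he
        by_cases h2 : ∃ a, lo pos b a ≤ pos v' ∧ pos v' ≤ hi pos b a
        · obtain ⟨a, h2⟩ := h2
          rw [h.reg_of_mem h2.1 h2.2] at he
          exact h1 ⟨a, by omega, by omega⟩
        · rw [reg_of_notMem h2] at he
          omega
    rw [oldKey, oldKey, Prod.Lex.toLex_lt_toLex] at hk
    dsimp only at hk
    omega

theorem oldKey_inj (h : CopyTriple G A P S Q pos b) {v v' : V} (hv : v ∈ S) (hv' : v' ∈ S)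
    (hk : oldKey pos b l w₀ v = oldKey pos b l w₀ v') : v = v' := by
  rw [oldKey, oldKey] at hk
  have := congrArg (fun z => (ofLex (ofLex z).2).2) hk
  exact h.pos_inj hv hv' this

/-- Vertices are only rearranged inside regions, which `P` avoids. -/
theorem pos_lt_of_left_mem (h : CopyTriple G A P S Q pos b) {p v : V} (hp : p ∈ P) (hv : v ∈ S)
    (hk : oldKey pos b l w₀ p < oldKey pos b l w₀ v) : pos p < pos v := by
  rcases Nat.lt_trichotomy (pos p) (pos v) with h1 | h1 | h1
  · exact h1
  · rw [h.pos_inj (h.subset hp) hv h1] at hk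
    exact absurd hk (lt_irrefl _)
  · obtain ⟨a, -, h2, -⟩ := h.exists_of_swap h1 hk
    rcases h.not_mem_region hp a with h3 | h3 <;> omega

theorem pos_lt_of_right_mem (h : CopyTriple G A P S Q pos b) {p v : V} (hp : p ∈ P) (hv : v ∈ S)
    (hk : oldKey pos b l w₀ v < oldKey pos b l w₀ p) : pos v < pos p := by
  rcases Nat.lt_trichotomy (pos v) (pos p) with h1 | h1 | h1
  · exact h1
  · rw [h.pos_inj hv (h.subset hp) h1] at hk
    exact absurd hk (lt_irrefl _)
  · obtain ⟨a, h2, -⟩ := h.exists_of_swap h1 hk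
    rcases h.not_mem_region hp a with h3 | h3 <;> omega

theorem right_of_mem (h : CopyTriple G A P S Q pos b) (hl : IsCrossing A pos b l w₀ w₁) {p : V}
    (hp : p ∈ P) (a : ι) : Right pos b l w₀ p a ↔ pos (b 1 a) < pos p := by
  have h1 := h.pos_mem_region 1 a
  rcases h.not_mem_region hp a with h3 | h3
  · exact iff_of_false (h.not_right_of_lt h3) (by omega)
  · exact iff_of_true (h.right_of_gt hl h3) (by omega)

theorem pos_lt_of_slot_lt (h : CopyTriple G A P S Q pos b) {a c : ι}
    (hk : slot pos b a < slot pos b c) : pos (b 1 a) < pos (b 1 c) := by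
  rw [slot, slot, Prod.Lex.toLex_lt_toLex] at hk
  rcases hk with hk | ⟨-, hk⟩
  · dsimp only at hk
    have h1 := h.pos_mem_region 1 a
    have h2 := h.pos_mem_region 1 c
    have := h.lo_lt_hi a
    have := h.lo_lt_hi c
    rcases h.inter_or a c with h3 | h3 | h3
    · have := h.lo_congr h3
      omega
    · omega
    · omega
  · rw [Prod.Lex.toLex_lt_toLex] at hk
    rcases hk with hk | ⟨-, hk⟩
    · exact absurd hk (lt_irrefl _)
    · exact hk

/-- Edges between old vertices keep their direction. -/
theorem pos_lt_of_oldKey_lt (h : CopyTriple G A P S Q pos b) (hl : IsCrossing A pos b l w₀ w₁)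
    {y z : V} (hy : y ∈ S) (hz : z ∈ S) (hyz : G.Adj y z)
    (hk : oldKey pos b l w₀ y < oldKey pos b l w₀ z) : pos y < pos z := by
  rcases Nat.lt_trichotomy (pos y) (pos z) with h1 | h1 | h1
  · exact h1
  · rw [h.pos_inj hy hz h1] at hk
    exact absurd hk (lt_irrefl _)
  · exfalso
    obtain ⟨a, hza, hya, hzr, hyr⟩ := h.exists_of_swap h1 hk
    -- A reversed edge would have `z` right and `y` left in one region. In the last class this
    -- leaves `z` in the middle copy, and then `y` is in `P` or in the middle copy. Otherwise the
    -- next class also has `y` on its right, although `y` lies before that region.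
    by_cases ht : IsTop A pos b a
    · have hy1 : y ∉ Set.range (b 1) := by
        rintro ⟨x, rfl⟩
        exact hyr ((right_copy x a).2 hya.1)
      obtain ⟨hi, hiff⟩ := ht.right_iff h hl
      have h2 := mt (hiff y hy1).2 hyr
      by_cases hz1 : z ∈ Set.range (b 1)
      · obtain ⟨x, rfl⟩ := hz1
        rcases (h.adj_iff 1 x y hy).1 hyz.symm with ⟨x', rfl, -⟩ | ⟨hp, -⟩
        · exact hy1 ⟨x', rfl⟩
        · rcases h.not_mem_region hp a with h3 | h3 <;> omega
      · have := (hiff z hz1).1 hzr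
        omega
    · simp only [IsTop, not_forall, not_not] at ht
      obtain ⟨a', c, haa, hu⟩ := ht
      have h2 := (h.right_iff_right hl hu hz hy hyz.symm h1).1 ((Right.congr h haa).1 hzr)
      apply h.not_right_of_lt _ h2
      have := h.hi_lt_lo_of_up hu
      have := h.hi_congr haa
      omega

/-- Two edges between old vertices are not nested in the new order. -/
theorem oldKey_noNest (h : CopyTriple G A P S Q pos b) (hl : IsCrossing A pos b l w₀ w₁)
    {u v w x : V} (hu : u ∈ S) (hv : v ∈ S) (hw : w ∈ S) (hx : x ∈ S) (huv : G.Adj u v)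
    (hwx : G.Adj w x) (h1 : oldKey pos b l w₀ u < oldKey pos b l w₀ w)
    (h2 : oldKey pos b l w₀ w < oldKey pos b l w₀ x)
    (h3 : oldKey pos b l w₀ x < oldKey pos b l w₀ v) : False := by
  have hpuv := h.pos_lt_of_oldKey_lt hl hu hv huv (h1.trans (h2.trans h3))
  have hpwx := h.pos_lt_of_oldKey_lt hl hw hx hwx h2
  have hne1 : pos u ≠ pos w := fun he => by
    rw [h.pos_inj hu hw he] at h1; exact lt_irrefl _ h1
  have hne2 : pos x ≠ pos v := fun he => by
    rw [h.pos_inj hx hv he] at h3; exact lt_irrefl _ h3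
  rcases Nat.lt_or_ge (pos w) (pos u) with h4 | h4
  · obtain ⟨a, hwa, hua, hwr, hur⟩ := h.exists_of_swap h4 h1
    -- Here `w` was before `u` and was moved past it, so `w` is right and `u` is left in the region
    -- of `a`.
    by_cases ht : IsTop A pos b a
    · have hu1 : u ∉ Set.range (b 1) := by
        rintro ⟨x, rfl⟩
        exact hur ((right_copy x a).2 hua.1)
      obtain ⟨hi', hiff⟩ := ht.right_iff h hl
      have h5 := mt (hiff u hu1).2 hur
      by_cases hw1 : w ∈ Set.range (b 1)
      · obtain ⟨x₀, rfl⟩ := hw1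
        have hreg := h.pos_mem_region 1 x₀
        have hin : Inter pos b a x₀ := h.inter_of_mem hwa.1 hwa.2 hreg.1 hreg.2
        rcases (h.adj_iff 1 x₀ x hx).1 hwx with ⟨x', rfl, hadj⟩ | ⟨hp, hq⟩
        · exact ht x₀ x' hin ⟨hadj, hpwx⟩
        -- `w` is the middle copy of `x₀`. Its third copy is adjacent to the same `x` and comes
        -- after `u`, so `v` cannot lie beyond `x`.
        · have h6 := h.pos_lt_of_left_mem hp hv h3
          have h7 := (h.inter_trans hin.symm hi').2.2.2
          have := h.right_le hu hv (h.mem 2 x₀) hx huv (h.adj_of_mem 2 hp hq) (by omega)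
            (h.patternP 1 2 x₀ x hp hpwx)
          omega
      · have := (hiff w hw1).1 hwr
        omega
    · simp only [IsTop, not_forall, not_not] at ht
      obtain ⟨a', c, haa, hup⟩ := ht
      -- The sides are passed on to the next class: `x` is right and `v` is left of its slot, so `v`
      -- precedes `x`.
      have h5 := (h.right_iff_right hl hup hw hx hwx hpwx).1 ((Right.congr h haa).1 hwr)
      have h6 := mt (h.right_iff_right hl hup hu hv huv hpuv).2 (mt (Right.congr h haa).2 hur)
      exact lt_asymm h3 ((h.oldKey_lt_slot hl h6).trans (h.slot_lt_oldKey h5))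
  · rcases Nat.lt_or_ge (pos v) (pos x) with h5 | h5
    · obtain ⟨a, hva, hxa, hvr, hxr⟩ := h.exists_of_swap h5 h3
      -- The same argument at the later ends, with the previous class in place of the next one.
      by_cases ht : IsBot A pos b a
      · have hx1 : x ∉ Set.range (b 1) := by
          rintro ⟨y, rfl⟩
          exact hxr ((right_copy y a).2 hxa.1)
        obtain ⟨hi', hiff⟩ := ht.right_iff h hl
        have h5 := mt (hiff x hx1).2 hxr
        by_cases hv1 : v ∈ Set.range (b 1)
        · obtain ⟨x₀, rfl⟩ := hv1
          have hreg := h.pos_mem_region 1 x₀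
          have hin : Inter pos b a x₀ := h.inter_of_mem hva.1 hva.2 hreg.1 hreg.2
          rcases (h.adj_iff 1 x₀ u hu).1 huv.symm with ⟨x', rfl, hadj⟩ | ⟨hp, hq⟩
          · exact ht x' x₀ hin ⟨hadj.symm, hpuv⟩
          · have h6 := h.pos_lt_of_left_mem hp hw h1
            have h7 := (h.inter_trans hin.symm hi').2.2.2
            have := h.left_le hu (h.mem 2 x₀) hw hx (h.adj_of_mem 2 hp hq).symm hwx (by omega) hpwx
            omega
        · have := (hiff v hv1).1 hvr
          omega
      · simp only [IsBot, not_forall, not_not] at ht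
        obtain ⟨c, a', haa, hup⟩ := ht
        have h6 := (h.right_iff_right hl hup hu hv huv hpuv).2 ((Right.congr h haa).1 hvr)
        have h7 := mt (h.right_iff_right hl hup hw hx hwx hpwx).1 (mt (Right.congr h haa).2 hxr)
        exact lt_asymm h1 ((h.oldKey_lt_slot hl h7).trans (h.slot_lt_oldKey h6))
    · exact h.noNest u hu v hv w hw x hx huv hwx ⟨by omega, hpwx, by omega⟩

/-! ### Inserting the fourth copy -/

open Classical in
/-- The new order: a copy `c` of `A` is inserted into the old layout. -/
noncomputable def newKey (pos : V → ℕ) (b : Fin 3 → ι → V) (l : List (ι × ι)) (w₀ : ι) (c : ι → V)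
    (v : V) : ℕ ×ₗ ℕ ×ₗ ℕ :=
  if h : ∃ a, c a = v then slot pos b h.choose else oldKey pos b l w₀ v

theorem newKey_copy {c : ι → V} (hc : Function.Injective c) (a : ι) :
    newKey pos b l w₀ c (c a) = slot pos b a := by
  have hex : ∃ x, c x = c a := ⟨a, rfl⟩
  rw [newKey, dif_pos hex, hc hex.choose_spec]

theorem newKey_old {c : ι → V} {v : V} (hv : v ∉ Set.range c) :
    newKey pos b l w₀ c v = oldKey pos b l w₀ v := by
  rw [newKey, dif_neg]
  rintro ⟨a, rfl⟩
  exact hv ⟨a, rfl⟩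

/-- A further copy of `A` can be added to a one-queue layout that contains three homogeneous
copies. -/
theorem exists_insertion (h : CopyTriple G A P S Q pos b) {c : ι → V} (hc : Function.Injective c)
    (hS : ∀ v, v ∈ S ↔ v ∉ Set.range c)
    (hadj : ∀ x v, G.Adj (c x) v ↔ (∃ y, v = c y ∧ A.Adj x y) ∨ (v ∈ P ∧ Q x v)) :
    ∃ f : V → ℕ ×ₗ ℕ ×ₗ ℕ, Function.Injective f ∧ ∀ u v w x, G.Adj u v → G.Adj w x →
      ¬ (f u < f w ∧ f w < f x ∧ f x < f v) := by
  obtain ⟨l, w₀, w₁, hl⟩ := h.exists_isCrossing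
  have hnew : ∀ a, newKey pos b l w₀ c (c a) = slot pos b a := newKey_copy hc
  have hold : ∀ v ∈ S, newKey pos b l w₀ c v = oldKey pos b l w₀ v :=
    fun v hv => newKey_old ((hS v).1 hv)
  have hcases : ∀ v, v ∈ S ∨ ∃ a, v = c a := by
    intro v
    by_cases hv : v ∈ Set.range c
    · obtain ⟨a, rfl⟩ := hv; exact Or.inr ⟨a, rfl⟩
    · exact Or.inl ((hS v).2 hv)
  have hlt_slot : ∀ {v a}, v ∈ S → oldKey pos b l w₀ v < slot pos b a → ¬ Right pos b l w₀ v a :=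
    fun hv hk hr => lt_asymm hk (h.slot_lt_oldKey hr)
  have hslot_lt : ∀ {v a}, v ∈ S → slot pos b a < oldKey pos b l w₀ v → Right pos b l w₀ v a :=
    fun hv hk => by_contra fun hr => lt_asymm hk (h.oldKey_lt_slot hl hr)
  refine ⟨newKey pos b l w₀ c, ?_, ?_⟩
  · intro v v' hv
    rcases hcases v with h1 | ⟨a, rfl⟩ <;> rcases hcases v' with h2 | ⟨a', rfl⟩
    · rw [hold v h1, hold v' h2] at hv
      exact h.oldKey_inj h1 h2 hv
    · rw [hold v h1, hnew] at hv
      by_cases hr : Right pos b l w₀ v a'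
      · exact absurd hv (h.slot_lt_oldKey hr).ne'
      · exact absurd hv (h.oldKey_lt_slot hl hr).ne
    · rw [hold v' h2, hnew] at hv
      by_cases hr : Right pos b l w₀ v' a
      · exact absurd hv (h.slot_lt_oldKey hr).ne
      · exact absurd hv (h.oldKey_lt_slot hl hr).ne'
    · rw [hnew, hnew] at hv
      have h3 : pos (b 1 a) = pos (b 1 a') := congrArg (fun z => (ofLex (ofLex z).2).2) hv
      rw [(h.eq_of_eq 1 1 a a' (h.pos_inj (h.mem _ _) (h.mem _ _) h3)).2]
  -- the vertices of the new copy and of `P` are ordered like the middle copy and `P`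
  · let R : V → V → Prop := fun v v' => (∃ a, v = c a ∧ v' = b 1 a) ∨ (v ∈ P ∧ v' = v)
    have hRS : ∀ {v v'}, R v v' → v' ∈ S := by
      rintro v v' (⟨a, -, rfl⟩ | ⟨hp, rfl⟩)
      exacts [h.mem 1 a, h.subset hp]
    have hRlt : ∀ {u u' v v'}, R u u' → R v v' →
        newKey pos b l w₀ c u < newKey pos b l w₀ c v → pos u' < pos v' := by
      rintro u u' v v' (⟨a, rfl, rfl⟩ | ⟨hp, rfl⟩) (⟨a', rfl, rfl⟩ | ⟨hp', rfl⟩) hk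
      · rw [hnew, hnew] at hk
        exact h.pos_lt_of_slot_lt hk
      · rw [hnew, hold _ (h.subset hp')] at hk
        exact (h.right_of_mem hl hp' a).1 (hslot_lt (h.subset hp') hk)
      · rw [hnew, hold _ (h.subset hp)] at hk
        have h1 := mt (h.right_of_mem hl hp a').2 (hlt_slot (h.subset hp) hk)
        exact lt_of_le_of_ne (not_lt.1 h1) (h.pos_ne_of_mem hp).symm
      · rw [hold _ (h.subset hp), hold _ (h.subset hp')] at hk
        exact h.pos_lt_of_left_mem hp (h.subset hp') hk
    have hRadj : ∀ a v, G.Adj (c a) v → ∃ v', R v v' ∧ G.Adj (b 1 a) v' := by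
      intro a v hav
      rcases (hadj a v).1 hav with ⟨y, rfl, hy⟩ | ⟨hp, hq⟩
      · exact ⟨b 1 y, Or.inl ⟨y, rfl, rfl⟩, h.adj_copy 1 hy⟩
      · exact ⟨v, Or.inr ⟨hp, rfl⟩, h.adj_of_mem 1 hp hq⟩
    have hRedge : ∀ u v, G.Adj u v → (u ∈ S ∧ v ∈ S) ∨
        ((u ∉ S ∨ v ∉ S) ∧ ∃ u' v', R u u' ∧ R v v' ∧ G.Adj u' v') := by
      intro u v huv
      rcases hcases u with h1 | ⟨a, rfl⟩
      · rcases hcases v with h2 | ⟨a, rfl⟩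
        · exact Or.inl ⟨h1, h2⟩
        · obtain ⟨u', hu', ha⟩ := hRadj a u huv.symm
          exact Or.inr ⟨Or.inr fun hs => (hS _).1 hs ⟨a, rfl⟩,
            u', b 1 a, hu', Or.inl ⟨a, rfl, rfl⟩, ha.symm⟩
      · obtain ⟨v', hv', ha⟩ := hRadj a v huv
        exact Or.inr ⟨Or.inl fun hs => (hS _).1 hs ⟨a, rfl⟩,
          b 1 a, v', Or.inl ⟨a, rfl, rfl⟩, hv', ha⟩
    have hPS : ∀ {v v'}, R v v' → (v ∉ S ∧ ∃ a, v = c a ∧ v' = b 1 a) ∨ (v ∈ P ∧ v' = v) := by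
      rintro v v' (⟨a, rfl, rfl⟩ | hp)
      · exact Or.inl ⟨fun hs => (hS _).1 hs ⟨a, rfl⟩, a, rfl, rfl⟩
      · exact Or.inr hp
    rintro u v w x huv hwx ⟨k1, k2, k3⟩
    rcases hRedge u v huv with ⟨hu, hv⟩ | ⟨hnuv, u', v', hu, hv, huv'⟩ <;>
      rcases hRedge w x hwx with ⟨hw, hx⟩ | ⟨hnwx, w', x', hw, hx, hwx'⟩
    · rw [hold u hu, hold w hw] at k1
      rw [hold w hw, hold x hx] at k2
      rw [hold x hx, hold v hv] at k3
      exact h.oldKey_noNest hl hu hv hw hx huv hwx k1 k2 k3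
    · have hpuv : pos u < pos v := by
        have := k1.trans (k2.trans k3)
        rw [hold u hu, hold v hv] at this
        exact h.pos_lt_of_oldKey_lt hl hu hv huv this
      have hlt' := hRlt hw hx k2
      rcases hPS hw with ⟨-, a, rfl, rfl⟩ | ⟨hp, rfl⟩ <;>
        rcases hPS hx with ⟨-, a', rfl, rfl⟩ | ⟨hp', rfl⟩
      · rw [hold u hu, hnew] at k1
        rw [hold v hv, hnew] at k3
        rcases (h.adj_iff 1 a _ (h.mem 1 a')).1 hwx' with ⟨y, hy, hA⟩ | ⟨hp, -⟩
        -- An old edge cannot enclose an edge of the new copy: its ends would be on different sides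
        -- of two consecutive slots.
        · obtain rfl := (h.eq_of_eq _ _ _ _ hy).2
          exact hlt_slot hu k1 ((h.right_iff_right hl ⟨hA, hlt'⟩ hu hv huv hpuv).2 (hslot_lt hv k3))
        · exact h.notMem 1 a' hp
      · rw [hold u hu, hnew] at k1
        rw [hold v hv, hold _ (h.subset hp')] at k3
        rcases (h.adj_iff 1 a _ (h.subset hp')).1 hwx' with ⟨y, rfl, -⟩ | ⟨-, hq⟩
        · exact h.notMem 1 y hp'
        -- The third copy of `a` has the same neighbour in `P` and still begins after `u`; it
        -- replaces the new vertex.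
        · have h1 := h.lt_of_not_right hl (Or.inl (h.isTop_of_later hp' hq hlt')) hu
            (hlt_slot hu k1)
          have h2 := h.pos_lt_of_left_mem hp' hv k3
          have := h.right_le hu hv (h.mem 2 a) (h.subset hp') huv (h.adj_of_mem 2 hp' hq) h1
            (h.patternP 1 2 a _ hp' hlt')
          omega
      · rw [hold u hu, hold _ (h.subset hp)] at k1
        rw [hold v hv, hnew] at k3
        rcases (h.adj_iff 1 a' _ (h.subset hp)).1 hwx'.symm with ⟨y, rfl, -⟩ | ⟨-, hq⟩
        · exact h.notMem 1 y hp
        · have h1 := h.lt_of_right hl (Or.inr (h.isBot_of_earlier hp hq hlt')) (hslot_lt hv k3)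
          have h2 := h.pos_lt_of_right_mem hp hu k1
          have := h.left_le hu hv (h.subset hp) (h.mem 0 a') huv (h.adj_of_mem 0 hp hq).symm h1
            (h.patternP' 0 hp hlt')
          omega
      · rcases hnwx with hn | hn
        exacts [hn (h.subset hp), hn (h.subset hp')]
    · have hpwx : pos w < pos x := by
        rw [hold w hw, hold x hx] at k2
        exact h.pos_lt_of_oldKey_lt hl hw hx hwx k2
      have hlt' := hRlt hu hv (k1.trans (k2.trans k3))
      rcases hPS hu with ⟨-, a, rfl, rfl⟩ | ⟨hp, rfl⟩ <;>
        rcases hPS hv with ⟨-, a', rfl, rfl⟩ | ⟨hp', rfl⟩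
      · rw [hold w hw, hnew] at k1
        rw [hold x hx, hnew] at k3
        rcases (h.adj_iff 1 a _ (h.mem 1 a')).1 huv' with ⟨y, hy, hA⟩ | ⟨hp, -⟩
        · obtain rfl := (h.eq_of_eq _ _ _ _ hy).2
          exact hlt_slot hx k3 ((h.right_iff_right hl ⟨hA, hlt'⟩ hw hx hwx hpwx).1 (hslot_lt hw k1))
        · exact h.notMem 1 a' hp
      · rw [hold w hw, hnew] at k1
        rw [hold x hx, hold _ (h.subset hp')] at k3
        rcases (h.adj_iff 1 a _ (h.subset hp')).1 huv' with ⟨y, rfl, -⟩ | ⟨-, hq⟩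
        · exact h.notMem 1 y hp'
        -- Now the new edge is the outer one, so the first copy, which begins before `w`, is the
        -- right substitute.
        · have h1 := h.lt_of_right hl (Or.inl (h.isTop_of_later hp' hq hlt')) (hslot_lt hw k1)
          have h2 := h.pos_lt_of_right_mem hp' hx k3
          have := h.right_le (h.mem 0 a) (h.subset hp') hw hx (h.adj_of_mem 0 hp' hq) hwx h1 hpwx
          omega
      · rw [hold w hw, hold _ (h.subset hp)] at k1
        rw [hold x hx, hnew] at k3
        rcases (h.adj_iff 1 a' _ (h.subset hp)).1 huv'.symm with ⟨y, rfl, -⟩ | ⟨-, hq⟩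
        · exact h.notMem 1 y hp
        · have h1 := h.lt_of_not_right hl (Or.inr (h.isBot_of_earlier hp hq hlt')) hx
            (hlt_slot hx k3)
          have h2 := h.pos_lt_of_left_mem hp hw k1
          have := h.left_le (h.subset hp) (h.mem 2 a') hw hx (h.adj_of_mem 2 hp hq).symm hwx h1 hpwx
          omega
      · rcases hnuv with hn | hn
        exacts [hn (h.subset hp), hn (h.subset hp')]
    -- Both edges contain a new vertex; the middle copy shows the same nesting in the old layout.
    · exact h.noNest u' (hRS hu) v' (hRS hv) w' (hRS hw) x' (hRS hx) huv' hwx'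
        ⟨hRlt hu hw k1, hRlt hw hx k2, hRlt hx hv k3⟩

end CopyTriple

/-! ### Homogeneous triples of copies -/

/-- Among sufficiently many points of a family of increasing sequences there are three indices at
which any two of the sequences are interleaved or separated. -/
theorem exists_homogeneous {ι : Type*} [DecidableEq ι] {X : ι → ℕ → ℕ} {N : ℕ}
    (hmono : ∀ x n m, n < m → m ≤ N → X x n < X x m)
    (hne : ∀ x y n m, x ≠ y → n ≤ N → m ≤ N → X x n ≠ X y m) (D : Finset (ι × ι)) (u : ℕ)
    (hu : u + 2 * 2 ^ D.card ≤ N)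
    (hsep : ∀ x y, x ≠ y → (x, y) ∉ D →
      X x (u + 2 * 2 ^ D.card) < X y u ∨ X y (u + 2 * 2 ^ D.card) < X x u) :
    ∃ i j k, i < j ∧ j < k ∧ k ≤ N ∧ ∀ x y, x ≠ y →
      (X x i < X y j ∧ X x j < X y k ∧ X y i < X x j ∧ X y j < X x k) ∨
      X x k < X y i ∨ X y k < X x i := by
  induction hD : D.card generalizing D u with
  | zero =>
    rw [hD] at hu hsep
    have hD' : D = ∅ := Finset.card_eq_zero.1 hD
    refine ⟨u, u + 1, u + 2, by omega, by omega, by omega, fun x y hxy => Or.inr ?_⟩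
    exact hsep x y hxy (by simp [hD'])
  | succ n ih =>
    rw [hD] at hu hsep
    have hpos : 0 < 2 ^ n := by positivity
    rw [pow_succ] at hu hsep
    set L := 2 ^ n with hL
    -- The interval of indices has length 4L. Test its ends and its midpoint: if some pair of `D` is
    -- not interleaved there, one of four comparisons fails, and the pair is separated throughout
    -- one half. That half and `D` without the pair satisfy the induction hypothesis.
    by_cases hall : ∀ x y, (x, y) ∈ D → x ≠ y →
        (X x u < X y (u + 2 * L) ∧ X x (u + 2 * L) < X y (u + 2 * (L * 2)) ∧
          X y u < X x (u + 2 * L) ∧ X y (u + 2 * L) < X x (u + 2 * (L * 2)))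
    · refine ⟨u, u + 2 * L, u + 2 * (L * 2), by omega, by omega, hu, fun x y hxy => ?_⟩
      by_cases hm : (x, y) ∈ D
      · exact Or.inl (hall x y hm hxy)
      · exact Or.inr (hsep x y hxy hm)
    · push Not at hall
      obtain ⟨x, y, hm, hxy, hf⟩ := hall
      have hcard : (D.erase (x, y)).card = n := by
        rw [Finset.card_erase_of_mem hm, hD]; rfl
      have hlt : ∀ z a b, a < b → b ≤ u + 2 * (L * 2) → X z a < X z b :=
        fun z a b h1 h2 => hmono z a b h1 (by omega)
      have hle : ∀ z a b, a ≤ b → b ≤ u + 2 * (L * 2) → X z a ≤ X z b := by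
        intro z a b h1 h2
        rcases h1.lt_or_eq with h3 | rfl
        · exact (hlt z a b h3 h2).le
        · exact le_rfl
      have key : ∀ v, u ≤ v → v + 2 * L ≤ u + 2 * (L * 2) →
          (X x (v + 2 * L) < X y v ∨ X y (v + 2 * L) < X x v) →
          ∃ i j k, i < j ∧ j < k ∧ k ≤ N ∧ ∀ x y, x ≠ y →
            (X x i < X y j ∧ X x j < X y k ∧ X y i < X x j ∧ X y j < X x k) ∨
            X x k < X y i ∨ X y k < X x i := by
        intro v h1 h2 h3
        refine ih (D.erase (x, y)) v (by rw [hcard]; omega) ?_ hcard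
        rw [hcard, ← hL]
        intro x' y' hxy' hm'
        by_cases he : (x', y') = (x, y)
        · obtain ⟨rfl, rfl⟩ := Prod.mk.inj he
          exact h3
        · have h4 := hsep x' y' hxy' (fun hm2 => hm' (Finset.mem_erase.2 ⟨he, hm2⟩))
          have h5 := hle x' (v + 2 * L) (u + 2 * (L * 2)) h2 le_rfl
          have h6 := hle y' (v + 2 * L) (u + 2 * (L * 2)) h2 le_rfl
          have h7 := hle x' u v h1 (by omega)
          have h8 := hle y' u v h1 (by omega)
          omega
      have n1 := hne x y u (u + 2 * L) hxy (by omega) (by omega)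
      have n2 := hne x y (u + 2 * L) (u + 2 * (L * 2)) hxy (by omega) (by omega)
      have n3 := hne y x u (u + 2 * L) hxy.symm (by omega) (by omega)
      have n4 := hne y x (u + 2 * L) (u + 2 * (L * 2)) hxy.symm (by omega) (by omega)
      have e : u + 2 * (L * 2) = u + 2 * L + 2 * L := by ring
      by_cases c1 : X x u < X y (u + 2 * L)
      · by_cases c2 : X x (u + 2 * L) < X y (u + 2 * (L * 2))
        · by_cases c3 : X y u < X x (u + 2 * L)
          · have c4 := hf c1 c2 c3
            exact key (u + 2 * L) (by omega) (by omega) (Or.inl (by rw [← e]; omega))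
          · exact key u le_rfl (by omega) (Or.inl (by omega))
        · exact key (u + 2 * L) (by omega) (by omega) (Or.inr (by rw [← e]; omega))
      · exact key u le_rfl (by omega) (Or.inr (by omega))

/-- The copies `β j`, `j : J`, of the connected graph `A` are attached to `P` in the same way. -/
structure IsCopyFamily {V ι J : Type*} (G : SimpleGraph V) (A : SimpleGraph ι) (P : Set V)
    (Q : ι → V → Prop) (β : J → ι → V) : Prop where
  conn : A.Connected
  notMem : ∀ j x, β j x ∉ P
  eq_of_eq : ∀ i j x y, β i x = β j y → i = j ∧ x = y
  adj_iff : ∀ j x v, G.Adj (β j x) v ↔ (∃ y, v = β j y ∧ A.Adj x y) ∨ (v ∈ P ∧ Q x v)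
  attached : ∃ x, ∃ p ∈ P, Q x p

/-- If the order of two copies changed along an edge, its two copies, which point the same way by
the common pattern, would nest. -/
theorem lt_of_adj {V ι : Type*} {G : SimpleGraph V} {pos : V → ℕ} {S : Set V}
    (hnest : ∀ u ∈ S, ∀ v ∈ S, ∀ w ∈ S, ∀ x ∈ S, G.Adj u v → G.Adj w x →
      ¬ (pos u < pos w ∧ pos w < pos x ∧ pos x < pos v))
    {c c' : ι → V} (hc : ∀ x, c x ∈ S) (hc' : ∀ x, c' x ∈ S) (hinj : ∀ x y, pos (c x) ≠ pos (c' y))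
    (hpat : ∀ x y, pos (c x) < pos (c y) ↔ pos (c' x) < pos (c' y)) {x y : ι}
    (h1 : G.Adj (c x) (c y)) (h2 : G.Adj (c' x) (c' y)) (hxy : pos (c x) ≠ pos (c y))
    (hlt : pos (c x) < pos (c' x)) : pos (c y) < pos (c' y) := by
  have hp := hpat x y
  have hp' := hpat y x
  have := hinj y y
  by_contra hcon
  rcases lt_or_gt_of_ne hxy with h3 | h3
  · exact hnest _ (hc x) _ (hc y) _ (hc' x) _ (hc' y) h1 h2 ⟨hlt, hp.1 h3, by omega⟩
  · exact hnest _ (hc' y) _ (hc' x) _ (hc y) _ (hc x) h2.symm h1.symm ⟨by omega, h3, hlt⟩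

theorem exists_enumeration {J : Type*} (F : Finset J) (f : J → ℕ) (hf : Function.Injective f)
    {N : ℕ} (hN : N < F.card) :
    ∃ τ : ℕ → J, (∀ n, τ n ∈ F) ∧ ∀ n m, n < m → m ≤ N → f (τ n) < f (τ m) := by
  classical
  have hcard : (F.image f).card = F.card := Finset.card_image_of_injective _ hf
  have hex : ∀ n : Fin (F.image f).card, ∃ j ∈ F, f j = (F.image f).orderEmbOfFin rfl n :=
    fun n => Finset.mem_image.1 ((F.image f).orderEmbOfFin_mem rfl n)
  choose σ hσF hσ using hex
  have hpos : 0 < (F.image f).card := by omega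
  -- The values beyond the range do not matter, except that they must belong to `F`.
  refine ⟨fun n => if hn : n < (F.image f).card then σ ⟨n, hn⟩ else σ ⟨0, hpos⟩, fun n => ?_,
    fun n m hnm hm => ?_⟩
  · dsimp only
    split_ifs
    · exact hσF _
    · exact hσF _
  · have h1 : n < (F.image f).card := by omega
    have h2 : m < (F.image f).card := by omega
    simp only [dif_pos h1, dif_pos h2, hσ]
    exact ((F.image f).orderEmbOfFin rfl).strictMono (by simpa using hnm)

/-- Many copies in a one-queue layout contain a homogeneous triple. -/
theorem IsCopyFamily.exists_copyTriple {V ι J : Type*} [Fintype ι] [Fintype J] {G : SimpleGraph V}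
    {A : SimpleGraph ι} {P S : Set V} {Q : ι → V → Prop} {β : J → ι → V} {pos : V → ℕ}
    (h : IsCopyFamily G A P Q β) [Fintype P] (hβ : ∀ j x, β j x ∈ S) (hP : P ⊆ S)
    (hinj : Set.InjOn pos S)
    (hnest : ∀ u ∈ S, ∀ v ∈ S, ∀ w ∈ S, ∀ x ∈ S, G.Adj u v → G.Adj w x →
      ¬ (pos u < pos w ∧ pos w < pos x ∧ pos x < pos v))
    (hcard : 2 ^ (Fintype.card ι * Fintype.card ι + Fintype.card ι * Fintype.card P) *
      2 ^ (Fintype.card ι * Fintype.card ι) < Fintype.card J) :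
    ∃ e : Fin 3 → J, CopyTriple G A P S Q pos (fun i => β (e i)) := by
  classical
  have hne0 : Nonempty ι := h.conn.nonempty
  -- The order pattern of a copy, inside the copy and relative to `P`.
  let f : J → Set (ι × ι) × Set (ι × P) := fun j =>
    ({e | pos (β j e.1) < pos (β j e.2)}, {e | pos (β j e.1) < pos e.2.1})
  obtain ⟨y, hy⟩ := Fintype.exists_lt_card_fiber_of_mul_lt_card f
    (n := 2 ^ (Fintype.card ι * Fintype.card ι)) (by
      simpa [Fintype.card_prod, Fintype.card_set, pow_add] using hcard)
  set F : Finset J := Finset.univ.filter (fun x => f x = y) with hF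
  have hpos_ne : ∀ i j x y, (i ≠ j ∨ x ≠ y) → pos (β i x) ≠ pos (β j y) := by
    intro i j x y hn he
    have := h.eq_of_eq i j x y (hinj (hβ _ _) (hβ _ _) he)
    tauto
  have hpat : ∀ i ∈ F, ∀ j ∈ F, ∀ x y, pos (β i x) < pos (β i y) ↔ pos (β j x) < pos (β j y) := by
    intro i hi j hj x z
    have hi' : f i = y := by simpa [hF] using hi
    have hj' : f j = y := by simpa [hF] using hj
    have := Set.ext_iff.1 (congrArg Prod.fst (hi'.trans hj'.symm)) (x, z)
    exact this
  have hpatP : ∀ i ∈ F, ∀ j ∈ F, ∀ x, ∀ p ∈ P, pos (β i x) < pos p ↔ pos (β j x) < pos p := by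
    intro i hi j hj x p hp
    have hi' : f i = y := by simpa [hF] using hi
    have hj' : f j = y := by simpa [hF] using hj
    have := Set.ext_iff.1 (congrArg Prod.snd (hi'.trans hj'.symm)) (x, ⟨p, hp⟩)
    exact this
  -- Connectivity makes the order of two copies independent of the vertex at which they are
  -- compared, so sorting them at one vertex `x₀` sorts them everywhere.
  have hlt : ∀ i ∈ F, ∀ j ∈ F, ∀ x y, pos (β i x) < pos (β j x) → pos (β i y) < pos (β j y) := by
    intro i hi j hj x y hlt
    have hij : i ≠ j := by rintro rfl; exact lt_irrefl _ hlt
    obtain ⟨w⟩ := h.conn.preconnected x y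
    induction w with
    | nil => exact hlt
    | @cons u v z huv w ihw =>
      apply ihw
      have hadj : ∀ i, G.Adj (β i u) (β i v) :=
        fun i => (h.adj_iff i u _).2 (Or.inl ⟨v, rfl, huv⟩)
      exact lt_of_adj hnest (hβ i) (hβ j) (fun x y => hpos_ne i j x y (Or.inl hij))
        (hpat i hi j hj) (hadj i) (hadj j) (hpos_ne i i u v (Or.inr huv.ne)) hlt
  obtain ⟨x₀⟩ := hne0
  obtain ⟨τ, hτF, hmono₀⟩ := exists_enumeration F (fun j => pos (β j x₀)) (by
    intro i j he
    by_contra hij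
    exact hpos_ne i j x₀ x₀ (Or.inl hij) he) hy
  have hmono : ∀ x n m, n < m → m ≤ 2 ^ (Fintype.card ι * Fintype.card ι) →
      pos (β (τ n) x) < pos (β (τ m) x) := fun x n m hnm hm =>
    hlt _ (hτF n) _ (hτF m) x₀ x (hmono₀ n m hnm hm)
  have hr : 0 < Fintype.card ι := Fintype.card_pos_iff.2 ⟨x₀⟩
  have hD : (Finset.univ.offDiag : Finset (ι × ι)).card =
      Fintype.card ι * Fintype.card ι - Fintype.card ι := by
    rw [Finset.offDiag_card, Finset.card_univ]
  -- All r² - r off-diagonal pairs are undecided at first; 2 · 2^(r² - r) ≤ 2^(r²) because r ≥ 1.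
  obtain ⟨i, j, k, hij, hjk, hk, hhom⟩ := exists_homogeneous (X := fun x n => pos (β (τ n) x))
    (N := 2 ^ (Fintype.card ι * Fintype.card ι)) hmono (fun x y n m hxy _ _ => hpos_ne _ _ _ _ (Or.inr hxy))
    (Finset.univ.offDiag : Finset (ι × ι)) 0 (by
      rw [hD, zero_add, ← pow_succ']
      apply Nat.pow_le_pow_right (by norm_num)
      have : Fintype.card ι ≤ Fintype.card ι * Fintype.card ι := Nat.le_mul_self _
      omega) (by
      intro x y hxy hm
      exact absurd (by simp [hxy]) hm)
  have hlt_ij := fun x => hmono x i j hij (hjk.le.trans hk)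
  have hlt_jk := fun x => hmono x j k hjk hk
  have hlt' : ∀ x, pos (β (τ i) x) < pos (β (τ k) x) := fun x => (hlt_ij x).trans (hlt_jk x)
  refine ⟨![τ i, τ j, τ k], ?_⟩
  have hmemF : ∀ a : Fin 3, (![τ i, τ j, τ k] : Fin 3 → J) a ∈ F :=
    Fin.forall_fin_succ.2 ⟨hτF _, Fin.forall_fin_succ.2 ⟨hτF _, Fin.forall_fin_one.2 (hτF _)⟩⟩
  have hne : Function.Injective (![τ i, τ j, τ k] : Fin 3 → J) := by
    have n1 : τ i ≠ τ j := fun he => (hlt_ij x₀).ne (by rw [he])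
    have n2 : τ j ≠ τ k := fun he => (hlt_jk x₀).ne (by rw [he])
    have n3 : τ i ≠ τ k := fun he => (hlt' x₀).ne (by rw [he])
    intro a c hac
    fin_cases a <;> fin_cases c
    exacts [rfl, absurd hac n1, absurd hac n3, absurd hac.symm n1, rfl, absurd hac n2,
      absurd hac.symm n3, absurd hac.symm n2, rfl]
  have hm : ∀ x, pos (β (![τ i, τ j, τ k] 0) x) < pos (β (![τ i, τ j, τ k] 1) x) ∧
      pos (β (![τ i, τ j, τ k] 1) x) < pos (β (![τ i, τ j, τ k] 2) x) :=
    fun x => ⟨hlt_ij x, hlt_jk x⟩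
  exact
    { conn := h.conn
      mem := fun a x => hβ _ _
      subset := hP
      notMem := fun a x => h.notMem _ _
      eq_of_eq := fun a c x z he => by
        obtain ⟨h1, h2⟩ := h.eq_of_eq _ _ _ _ he
        exact ⟨hne h1, h2⟩
      pos_inj := hinj
      adj_iff := fun a x v _ => h.adj_iff _ _ _
      attached := h.attached
      noNest := hnest
      mono := hm
      pattern := fun a c x y => (hpat _ (hmemF a) _ (hmemF c) x y).1
      patternP := fun a c x p hp => (hpatP _ (hmemF a) _ (hmemF c) x p hp).1
      homogeneous := hhom }

/-! ### One-queue layouts -/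

theorem hasQueueLayout_one_of_injective {V α : Type*} [LinearOrder α] {G : SimpleGraph V}
    (f : V → α) (hf : Function.Injective f)
    (h : ∀ u v w x, G.Adj u v → G.Adj w x → ¬ (f u < f w ∧ f w < f x ∧ f x < f v)) :
    HasQueueLayout G 1 :=
  ⟨LinearOrder.lift' f hf, fun _ => 0, fun u v w x huv hwx _ => h u v w x huv hwx⟩

/-- The rank in the linear order serves as position, so that inequalities become linear arithmetic
over the natural numbers. -/
theorem HasQueueLayout.exists_pos {V : Type*} [Finite V] {G : SimpleGraph V}
    (h : HasQueueLayout G 1) : ∃ f : V → ℕ, Function.Injective f ∧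
      ∀ u v w x, G.Adj u v → G.Adj w x → ¬ (f u < f w ∧ f w < f x ∧ f x < f v) := by
  classical
  have := Fintype.ofFinite V
  obtain ⟨lo, σ, hσ⟩ := h
  let f : V → ℕ := fun v => (Finset.univ.filter (fun u => lo.lt u v)).card
  have hmono : ∀ u v, lo.lt u v → f u < f v := by
    intro u v huv
    apply Finset.card_lt_card
    rw [Finset.ssubset_iff_of_subset]
    · exact ⟨u, by simpa using huv, by simp⟩
    · intro w hw
      simp only [Finset.mem_filter, Finset.mem_univ, true_and] at hw ⊢
      exact @lt_trans _ lo.toPartialOrder.toPreorder _ _ _ hw huv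
  have hle : ∀ u v, f u < f v → lo.lt u v := by
    intro u v huv
    by_contra hc
    rcases lo.le_total u v with h1 | h1
    · rcases @lt_or_eq_of_le _ lo.toPartialOrder _ _ h1 with h2 | h2
      · exact hc h2
      · rw [h2] at huv; exact lt_irrefl _ huv
    · rcases @lt_or_eq_of_le _ lo.toPartialOrder _ _ h1 with h2 | h2
      · exact lt_asymm huv (hmono _ _ h2)
      · rw [h2] at huv; exact lt_irrefl _ huv
  refine ⟨f, ?_, ?_⟩
  · intro u v huv
    by_contra hne
    rcases @lt_or_gt_of_ne _ lo _ _ hne with h1 | h1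
    · exact absurd huv (hmono _ _ h1).ne
    · exact absurd huv (hmono _ _ h1).ne'
  · rintro u v w x huv hwx ⟨h1, h2, h3⟩
    exact hσ u v w x huv hwx (Subsingleton.elim _ _) ⟨hle _ _ h1, hle _ _ h2, hle _ _ h3⟩

theorem HasQueueLayout.induce {V : Type*} {G : SimpleGraph V} {h : ℕ} (hG : HasQueueLayout G h)
    (s : Set V) : HasQueueLayout (G.induce s) h := by
  obtain ⟨lo, σ, hσ⟩ := hG
  refine ⟨@LinearOrder.lift' _ _ lo Subtype.val Subtype.val_injective,
    fun e => σ ⟨e.1.map Subtype.val, ?_⟩, ?_⟩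
  · obtain ⟨e, he⟩ := e
    induction e with
    | h u v => exact he
  · intro u v w x huv hwx heq
    exact hσ u v w x huv hwx heq

theorem hasQueueLayout_zero_iff {V : Type*} [Finite V] {G : SimpleGraph V} :
    HasQueueLayout G 0 ↔ ∀ u v, ¬ G.Adj u v := by
  constructor
  · rintro ⟨-, σ, -⟩ u v huv
    exact (σ ⟨s(u, v), huv⟩).elim0
  · intro h
    obtain ⟨n, ⟨e⟩⟩ := Finite.exists_equiv_fin V
    have hE : IsEmpty G.edgeSet := ⟨fun ⟨x, hx⟩ => by
      induction x with
      | h u v => exact h u v hx⟩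
    exact ⟨LinearOrder.lift' e e.injective, isEmptyElim, fun u v w x huv => absurd huv (h u v)⟩

theorem queueNumber_eq_one_iff {V : Type*} [Finite V] {G : SimpleGraph V} :
    queueNumber G = 1 ↔ HasQueueLayout G 1 ∧ ∃ u v, G.Adj u v := by
  have h0 : (∃ u v, G.Adj u v) ↔ ¬ HasQueueLayout G 0 := by
    rw [hasQueueLayout_zero_iff]; push Not; rfl
  rw [h0]
  constructor
  · intro h
    -- The infimum of the empty set is 0, so the value 1 already shows that some layout exists.
    have hne : {h | HasQueueLayout G h}.Nonempty := by
      by_contra hc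
      rw [Set.not_nonempty_iff_eq_empty] at hc
      rw [queueNumber, hc, Nat.sInf_empty] at h
      exact zero_ne_one h
    refine ⟨h ▸ Nat.sInf_mem hne, fun hz => ?_⟩
    have := Nat.sInf_le (s := {h | HasQueueLayout G h}) hz
    rw [queueNumber] at h
    omega
  · rintro ⟨h1, h2⟩
    have hle := Nat.sInf_le (s := {h | HasQueueLayout G h}) h1
    have hmem := Nat.sInf_mem (s := {h | HasQueueLayout G h}) ⟨1, h1⟩
    rw [queueNumber]
    rcases Nat.le_one_iff_eq_zero_or_eq_one.1 hle with h3 | h3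
    · rw [h3] at hmem; exact absurd hmem h2
    · exact h3

/-- Removing one of many copies does not change whether the queue number is one. -/
theorem IsCopyFamily.queueNumber_eq_one_iff {V ι J : Type*} [Fintype ι] [Fintype J] [Finite V]
    {G : SimpleGraph V} {A : SimpleGraph ι} {P : Set V} {Q : ι → V → Prop} {β : J → ι → V}
    (h : IsCopyFamily G A P Q β) [Fintype P]
    (hcard : 4 ^ (Fintype.card ι * (Fintype.card ι + Fintype.card P)) ≤ Fintype.card J) (j₀ : J) :
    queueNumber (G.induce (Set.range (β j₀))ᶜ) = 1 ↔ queueNumber G = 1 := by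
  classical
  have hne0 : Nonempty ι := h.conn.nonempty
  obtain ⟨x₀, p₀, hp₀, hq₀⟩ := h.attached
  have hneP : Nonempty P := ⟨⟨p₀, hp₀⟩⟩
  have hr : 0 < Fintype.card ι := Fintype.card_pos
  have hd : 0 < Fintype.card P := Fintype.card_pos
  set r := Fintype.card ι
  set d := Fintype.card P
  have hrd : 0 < r * d := Nat.mul_pos hr hd
  have h4 : 4 ^ (r * (r + d)) = 2 ^ (r * r + r * d) * 2 ^ (r * r) * 2 ^ (r * d) := by
    rw [← pow_add, ← pow_add, show (4 : ℕ) = 2 ^ 2 by norm_num, ← pow_mul]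
    congr 1; ring
  -- The spare factor 2^(rd) ≥ 2 pays for the deleted copy and for the strict inequality.
  have hbig : 2 ^ (r * r + r * d) * 2 ^ (r * r) < Fintype.card {j // j ≠ j₀} := by
    have h5 : Fintype.card {j // j ≠ j₀} = Fintype.card J - 1 := by
      simp [Fintype.card_subtype_compl]
    have h6 : 2 ≤ 2 ^ (r * d) := by
      calc 2 = 2 ^ 1 := rfl
        _ ≤ _ := Nat.pow_le_pow_right (by norm_num) hrd
    have h7 : 2 ≤ 2 ^ (r * r + r * d) := by
      calc 2 = 2 ^ 1 := rfl
        _ ≤ _ := Nat.pow_le_pow_right (by norm_num) (by omega)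
    have h8 : 1 ≤ 2 ^ (r * r) := Nat.one_le_two_pow
    have h9 : 2 ≤ 2 ^ (r * r + r * d) * 2 ^ (r * r) := by nlinarith
    have h10 := Nat.mul_le_mul_left (2 ^ (r * r + r * d) * 2 ^ (r * r)) h6
    omega
  have hPc : ∀ p ∈ P, p ∈ (Set.range (β j₀))ᶜ := by
    rintro p hp ⟨x, rfl⟩
    exact h.notMem _ _ hp
  have hβc : ∀ (j : {j // j ≠ j₀}) x, β j x ∈ (Set.range (β j₀))ᶜ := by
    rintro ⟨j, hj⟩ x ⟨y, hy⟩
    exact hj (h.eq_of_eq _ _ _ _ hy).1.symm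
  have hedge : ∀ j, G.Adj (β j x₀) p₀ := fun j => (h.adj_iff j x₀ p₀).2 (Or.inr ⟨hp₀, hq₀⟩)
  have hJ : Nonempty {j // j ≠ j₀} := Fintype.card_pos_iff.1 (by omega)
  obtain ⟨j₁⟩ := hJ
  rw [QueueTD.queueNumber_eq_one_iff, QueueTD.queueNumber_eq_one_iff]
  constructor
  · rintro ⟨hl, -⟩
    refine ⟨?_, _, _, hedge j₀⟩
    obtain ⟨f, hf, hn⟩ := hl.exists_pos
    let pos : V → ℕ := fun v => if hv : v ∈ (Set.range (β j₀))ᶜ then f ⟨v, hv⟩ else 0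
    have hpos : ∀ v (hv : v ∈ (Set.range (β j₀))ᶜ), pos v = f ⟨v, hv⟩ := fun v hv => dif_pos hv
    have hfam : IsCopyFamily G A P Q (fun j : {j // j ≠ j₀} => β j) :=
      { conn := h.conn
        notMem := fun j x => h.notMem _ _
        eq_of_eq := fun i j x y he => by
          have := h.eq_of_eq _ _ _ _ he
          exact ⟨Subtype.ext this.1, this.2⟩
        adj_iff := fun j x v => h.adj_iff _ _ _
        attached := h.attached }
    obtain ⟨e, he⟩ := hfam.exists_copyTriple (S := (Set.range (β j₀))ᶜ) (pos := pos) hβc hPc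
      (by
        intro u hu v hv huv
        rw [hpos u hu, hpos v hv] at huv
        exact congrArg Subtype.val (hf huv))
      (by
        intro u hu v hv w hw x hx huv hwx
        rw [hpos u hu, hpos v hv, hpos w hw, hpos x hx]
        exact hn ⟨u, hu⟩ ⟨v, hv⟩ ⟨w, hw⟩ ⟨x, hx⟩ huv hwx)
      hbig
    obtain ⟨g, hg, hgn⟩ := he.exists_insertion (c := β j₀)
      (fun x y hxy => (h.eq_of_eq _ _ _ _ hxy).2) (fun v => Iff.rfl) (h.adj_iff j₀)
    exact hasQueueLayout_one_of_injective g hg hgn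
  · rintro ⟨hl, -⟩
    exact ⟨hl.induce _, ⟨_, hβc j₁ x₀⟩, ⟨_, hPc p₀ hp₀⟩, hedge j₁⟩

/-! ### Ancestors and components -/

namespace RTree

variable {V : Type u} (T : RTree V)

theorem iterate_parent_root (m : ℕ) : T.parent^[m] T.root = T.root := by
  induction m with
  | zero => rfl
  | succ m ih => rw [Function.iterate_succ_apply, T.parent_root, ih]

/-- Going round the cycle m times, where m steps lead to the root, ends both in `v` and in the root,
which is fixed. -/
theorem eq_root_of_iterate_eq {v : V} {n : ℕ} (h : T.parent^[n + 1] v = v) : v = T.root := by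
  obtain ⟨m, hm⟩ := T.reaches_root v
  have h1 : ∀ a, (T.parent^[n + 1])^[a] v = v := fun a => Function.iterate_fixed h a
  have h2 := h1 m
  rw [← Function.iterate_mul, show (n + 1) * m = n * m + m by ring, Function.iterate_add_apply, hm,
    T.iterate_parent_root] at h2
  exact h2.symm

variable {T}

theorem IsAncestor.refl (v : V) : T.IsAncestor v v := ⟨0, rfl⟩

theorem IsAncestor.trans {u v w : V} (h1 : T.IsAncestor u v) (h2 : T.IsAncestor v w) :
    T.IsAncestor u w := by
  obtain ⟨m, rfl⟩ := h1
  obtain ⟨n, rfl⟩ := h2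
  exact ⟨m + n, Function.iterate_add_apply _ _ _ _⟩

theorem IsAncestor.comparable {u v w : V} (h1 : T.IsAncestor u w) (h2 : T.IsAncestor v w) :
    T.IsAncestor u v ∨ T.IsAncestor v u := by
  obtain ⟨m, rfl⟩ := h1
  obtain ⟨n, rfl⟩ := h2
  rcases le_total m n with h | h
  · exact Or.inr ⟨n - m, by rw [← Function.iterate_add_apply, Nat.sub_add_cancel h]⟩
  · exact Or.inl ⟨m - n, by rw [← Function.iterate_add_apply, Nat.sub_add_cancel h]⟩

theorem IsAncestor.eq_or_of_isChild {u q t : V} (h : T.IsAncestor u q) (hq : T.IsChild q t) :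
    u = q ∨ T.IsAncestor u t := by
  obtain ⟨m, rfl⟩ := h
  cases m with
  | zero => exact Or.inl rfl
  | succ m => exact Or.inr ⟨m, by rw [Function.iterate_succ_apply, hq.2]⟩

theorem IsChild.notMem_ancestors {q t : V} (hq : T.IsChild q t) : q ∉ T.ancestors t := by
  rintro ⟨m, hm⟩
  refine hq.1 (T.eq_root_of_iterate_eq (n := m) ?_)
  rw [Function.iterate_succ_apply, hq.2, hm]

theorem IsChild.depth_eq {q t : V} (hq : T.IsChild q t) : T.depth q = T.depth t + 1 := by
  classical
  unfold depth
  congr 1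
  rw [Nat.find_eq_iff]
  constructor
  · rw [Function.iterate_succ_apply, hq.2]
    exact Nat.find_spec (T.reaches_root t)
  · intro n hn h
    cases n with
    | zero => exact hq.1 h
    | succ n =>
      rw [Function.iterate_succ_apply, hq.2] at h
      exact Nat.find_min (T.reaches_root t) (by omega) h

theorem iterate_parent_injOn (t : V) :
    Set.InjOn (fun m => T.parent^[m] t) (Set.Iio (T.depth t)) := by
  classical
  have key : ∀ m n, m < n → n < T.depth t → T.parent^[m] t ≠ T.parent^[n] t := by
    intro m n hmn hn h
    have h1 : T.parent^[m] t = T.root := by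
      refine T.eq_root_of_iterate_eq (n := n - m - 1) ?_
      rw [← Function.iterate_add_apply, show n - m - 1 + 1 + m = n by omega, h]
    refine Nat.find_min (T.reaches_root t) (m := m) ?_ h1
    rw [depth] at hn
    omega
  intro m hm n hn h
  by_contra hne
  rcases lt_or_gt_of_ne hne with h1 | h1
  · exact key _ _ h1 hn h
  · exact key _ _ h1 hm h.symm

theorem depth_pos (t : V) : 0 < T.depth t := Nat.succ_pos _

theorem iterate_parent_of_depth_le {t : V} {m : ℕ} (h : T.depth t ≤ m + 1) :
    T.parent^[m] t = T.root := by
  classical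
  rw [depth] at h
  rw [show m = (m - Nat.find (T.reaches_root t)) + Nat.find (T.reaches_root t) by omega,
    Function.iterate_add_apply, Nat.find_spec (T.reaches_root t), T.iterate_parent_root]

theorem mem_ancestors_iff {t u : V} :
    u ∈ T.ancestors t ↔ ∃ m, m < T.depth t ∧ T.parent^[m] t = u := by
  constructor
  · rintro ⟨m, rfl⟩
    by_cases h : m < T.depth t
    · exact ⟨m, h, rfl⟩
    · refine ⟨T.depth t - 1, by have := T.depth_pos t; omega, ?_⟩
      rw [iterate_parent_of_depth_le (m := m) (by omega), iterate_parent_of_depth_le (by omega)]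
  · rintro ⟨m, -, rfl⟩
    exact ⟨m, rfl⟩

theorem ncard_ancestors (t : V) : (T.ancestors t).ncard = T.depth t := by
  have : T.ancestors t = (fun m => T.parent^[m] t) '' Set.Iio (T.depth t) := by
    ext u; rw [mem_ancestors_iff]; rfl
  rw [this, (iterate_parent_injOn t).ncard_image]
  simp [Set.ncard_eq_toFinset_card']

end RTree

/-! ### Components as sets of reachable vertices -/

/-- The vertices that can be reached from `q` without entering `P`. -/
def reach {V : Type u} (G : SimpleGraph V) (P : Set V) (q : V) : Set V :=
  {v | Relation.ReflTransGen (fun a b => G.Adj a b ∧ b ∉ P) q v}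

section reach

variable {V : Type u} {G : SimpleGraph V} {P : Set V} {q : V}

theorem mem_reach_self : q ∈ reach G P q := Relation.ReflTransGen.refl

theorem reach_closed {v w : V} (hv : v ∈ reach G P q) (h : G.Adj v w) (hw : w ∉ P) :
    w ∈ reach G P q := Relation.ReflTransGen.tail hv ⟨h, hw⟩

theorem reach_subset {X : Set V} (hq : q ∈ X)
    (hX : ∀ v ∈ X, v ∈ reach G P q → ∀ w, G.Adj v w → w ∉ P → w ∈ X) : reach G P q ⊆ X := by
  intro v hv
  have : v ∈ X ∧ v ∈ reach G P q := by
    induction hv with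
    | refl => exact ⟨hq, mem_reach_self⟩
    | tail _ h ih => exact ⟨hX _ ih.1 ih.2 _ h.1 h.2, reach_closed ih.2 h.1 h.2⟩
  exact this.1

theorem notMem_of_mem_reach (hq : q ∉ P) {v : V} (hv : v ∈ reach G P q) : v ∉ P :=
  reach_subset (X := Pᶜ) hq (fun _ _ _ _ _ h => h) hv

theorem reach_eq_image_supp (hq : q ∉ P) : reach G P q =
    Subtype.val '' ((G.induce Pᶜ).connectedComponentMk ⟨q, hq⟩).supp := by
  apply Set.Subset.antisymm
  · apply reach_subset
    · exact ⟨⟨q, hq⟩, rfl, rfl⟩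
    · rintro _ ⟨v, hv, rfl⟩ - w h hw
      refine ⟨⟨w, hw⟩, ?_, rfl⟩
      rw [SimpleGraph.ConnectedComponent.mem_supp_iff] at hv ⊢
      rw [← hv]
      exact SimpleGraph.ConnectedComponent.sound (SimpleGraph.Adj.reachable (by exact h.symm))
  · rintro _ ⟨v, hv, rfl⟩
    rw [SimpleGraph.ConnectedComponent.mem_supp_iff] at hv
    obtain ⟨w⟩ := (SimpleGraph.ConnectedComponent.exact hv).symm
    have : ∀ (a b : (Pᶜ : Set V)), (G.induce Pᶜ).Walk a b → a.1 ∈ reach G P q →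
        b.1 ∈ reach G P q := by
      intro a b w
      induction w with
      | nil => exact id
      | @cons a b c h _ ih => exact fun ha => ih (reach_closed ha h b.2)
    exact this _ _ w mem_reach_self

/-- A walk from `q` to `P` must leave the component, and it can only do so into `P`. This is where
connectivity of `G` enters, as the `attached` condition on copies. -/
theorem exists_adj_of_mem_reach (hG : G.Connected) (hP : P.Nonempty) (hq : q ∉ P) :
    ∃ v ∈ reach G P q, ∃ p ∈ P, G.Adj v p := by
  by_contra hc
  push Not at hc
  obtain ⟨p, hp⟩ := hP
  obtain ⟨w⟩ := hG.preconnected q p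
  have : ∀ a b, G.Walk a b → a ∈ reach G P q → b ∈ reach G P q := by
    intro a b w
    induction w with
    | nil => exact id
    | @cons a b c h _ ih =>
      exact fun ha => ih (reach_closed ha h fun hb => hc a ha b hb h)
  exact notMem_of_mem_reach hq (this _ _ w mem_reach_self) hp

end reach

section comps

variable {V : Type u} {G : SimpleGraph V} {T : RTree V} {t : V}

theorem reach_mem_comps {q : V} (hq : T.IsChild q t) :
    reach G (T.ancestors t) q ∈ T.comps G t :=
  ⟨⟨_, reach_eq_image_supp hq.notMem_ancestors⟩, q, mem_reach_self, hq⟩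

theorem exists_eq_reach {B : Set V} (hB : B ∈ T.comps G t) :
    ∃ q, T.IsChild q t ∧ B = reach G (T.ancestors t) q := by
  obtain ⟨⟨c, rfl⟩, q, ⟨v, hv, rfl⟩, hq⟩ := hB
  refine ⟨v, hq, ?_⟩
  rw [SimpleGraph.ConnectedComponent.mem_supp_iff] at hv
  rw [reach_eq_image_supp v.2, ← hv]

theorem comps_ncard_le [Finite V] : (T.comps G t).ncard ≤ {q | T.IsChild q t}.ncard := by
  have : T.comps G t ⊆ reach G (T.ancestors t) '' {q | T.IsChild q t} := by
    intro B hB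
    obtain ⟨q, hq, rfl⟩ := exists_eq_reach hB
    exact ⟨q, hq, rfl⟩
  exact (Set.ncard_le_ncard this).trans (Set.ncard_image_le (Set.toFinite _))

theorem ncard_reach_le [Finite V] {q : V} (hq : T.IsChild q t) :
    (reach G (T.ancestors t) q).ncard ≤ T.maxCompSize G t :=
  le_csSup (Set.toFinite _).bddAbove ⟨_, reach_mem_comps hq, rfl⟩

/-- An edge joins comparable vertices, so leaving the subtree below `q` means entering a proper
ancestor of `q`, hence an ancestor of `t`. -/
theorem isAncestor_of_mem_reach (hT : T.IsTreedepthDecomposition G) {q v : V}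
    (hq : T.IsChild q t) (hv : v ∈ reach G (T.ancestors t) q) : T.IsAncestor q v := by
  refine reach_subset (X := {v | T.IsAncestor q v}) (RTree.IsAncestor.refl q) ?_ hv
  intro a ha _ b hab hb
  rcases (hT hab).2 with h | h
  · exact RTree.IsAncestor.trans ha h
  · rcases RTree.IsAncestor.comparable ha h with h1 | h1
    · exact h1
    · rcases h1.eq_or_of_isChild hq with rfl | h2
      · exact RTree.IsAncestor.refl _
      · exact absurd h2 hb

/-- Distinct children of `t` have disjoint components; the program can therefore explore one
component per child without a test for repetitions. -/
theorem eq_of_mem_reach (hT : T.IsTreedepthDecomposition G) {q q' v : V}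
    (hq : T.IsChild q t) (hq' : T.IsChild q' t) (hv : v ∈ reach G (T.ancestors t) q)
    (hv' : v ∈ reach G (T.ancestors t) q') : q = q' := by
  rcases (isAncestor_of_mem_reach hT hq hv).comparable (isAncestor_of_mem_reach hT hq' hv')
    with h | h
  · exact (h.eq_or_of_isChild hq').resolve_right hq.notMem_ancestors
  · exact ((h.eq_or_of_isChild hq).resolve_right hq'.notMem_ancestors).symm

end comps

/-! ### Reasoning about programs -/

/-- Started in `s`, the program `p` halts within `τ` steps in a state that satisfies `Q`. -/
def Runs (I : Input) (p : Prog) (s : State) (τ : ℕ) (Q : State → Prop) : Prop :=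
  ∃ τ' ≤ τ, ∃ s', Exec I p s τ' s' ∧ Q s'

/-- The instructions of a list one after the other. -/
def Prog.block : List Instr → Prog
  | [] => .skip
  | c :: l => .seq (.instr c) (Prog.block l)

section Runs

variable {I : Input} {p q : Prog} {s : State} {τ m n x y : ℕ} {Q R : State → Prop}

theorem Runs.mono (h : Runs I p s m R) (hmn : m ≤ n) (hR : ∀ s, R s → Q s) : Runs I p s n Q := by
  obtain ⟨τ, hτ, s', he, hs⟩ := h
  exact ⟨τ, hτ.trans hmn, s', he, hR _ hs⟩

theorem Runs.skip (h : Q s) : Runs I .skip s 0 Q := ⟨0, le_rfl, s, .skip s, h⟩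

theorem Runs.seq (hp : Runs I p s m R) (hq : ∀ s', R s' → Runs I q s' n Q) :
    Runs I (.seq p q) s (m + n) Q := by
  obtain ⟨τ, hτ, s', he, hs⟩ := hp
  obtain ⟨τ', hτ', s'', he', hs'⟩ := hq s' hs
  exact ⟨τ + τ', by omega, s'', .seq he he', hs'⟩

theorem Runs.block (l : List Instr) (h : Q (l.foldl (Instr.step I) s)) :
    Runs I (Prog.block l) s l.length Q := by
  induction l generalizing s with
  | nil => exact Runs.skip h
  | cons c l ih =>
    refine (Runs.seq (m := 1) (R := fun s' => s' = c.step I s)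
      ⟨1, le_rfl, _, .instr c s, rfl⟩ (n := l.length) ?_).mono (by simp; omega) fun _ h => h
    rintro _ rfl
    exact ih h

theorem Runs.ifLT (hp : s.reg x < s.reg y → Runs I p s n Q)
    (hq : ¬ s.reg x < s.reg y → Runs I q s n Q) : Runs I (.ifLT x y p q) s (n + 1) Q := by
  by_cases h : s.reg x < s.reg y
  · obtain ⟨τ, hτ, s', he, hs⟩ := hp h
    exact ⟨τ + 1, by omega, s', .ifTrue h he, hs⟩
  · obtain ⟨τ, hτ, s', he, hs⟩ := hq h
    exact ⟨τ + 1, by omega, s', .ifFalse h he, hs⟩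

/-- The invariant carries the number of rounds. Showing that it is below `N` whenever the test
succeeds proves termination and the time bound at once; the last summand is the failing test. -/
theorem Runs.whileLT {N : ℕ} (Inv : ℕ → State → Prop)
    (hbody : ∀ n s, Inv n s → s.reg x < s.reg y → n < N ∧ Runs I p s τ (Inv (n + 1)))
    (h0 : Inv 0 s) : Runs I (.whileLT x y p) s (N * (τ + 1) + 1)
      (fun s' => ∃ n, Inv n s' ∧ ¬ s'.reg x < s'.reg y) := by
  have key : ∀ a n s, n + a = N → Inv n s → Runs I (.whileLT x y p) s (a * (τ + 1) + 1)
      (fun s' => ∃ n, Inv n s' ∧ ¬ s'.reg x < s'.reg y) := by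
    intro a
    induction a with
    | zero =>
      intro n s hn hs
      by_cases h : s.reg x < s.reg y
      · exact absurd (hbody n s hs h).1 (by omega)
      · exact ⟨1, by omega, s, .whileFalse h, n, hs, h⟩
    | succ a ih =>
      intro n s hn hs
      by_cases h : s.reg x < s.reg y
      · obtain ⟨-, τ', hτ', s', he, hs'⟩ := hbody n s hs h
        obtain ⟨τ'', hτ'', s'', he', hs''⟩ := ih (n + 1) s' (by omega) hs'
        refine ⟨τ' + τ'' + 1, ?_, s'', .whileTrue h he he', hs''⟩
        rw [add_mul, one_mul]
        omega
      · exact ⟨1, by omega, s, .whileFalse h, n, hs, h⟩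
  exact key N 0 s (by omega) h0

end Runs

section State

variable (s : State) (x a j val : ℕ)

theorem State.setReg_reg (y : ℕ) : (s.setReg x val).reg y = if y = x then val else s.reg y := by
  simp [State.setReg, Function.update_apply]

theorem State.setReg_arr : (s.setReg x val).arr = s.arr := rfl

theorem State.setArr_reg : (s.setArr a j val).reg = s.reg := rfl

theorem State.setArr_arr (b : ℕ) : (s.setArr a j val).arr b =
    if b = a then Function.update (s.arr a) j val else s.arr b := by
  simp [State.setArr, Function.update_apply]

end State

/-! ### The program

The registers `2`, `3`, `5`, `7` hold `t`, the constant `1`, `2 ^ d` and `d`, where `d` is the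
number of ancestors of `t`. Array `1` holds the weights of the ancestors of `t` and of the vertices
of the components that were explored; array `0` lists the vertices of the current component, and
array `2` holds the sums of the weights of their neighbours. Register `19` holds the code of the
component, register `9` the number of components of that code that are needed, and array `3` counts
the components of each code. -/

open Instr Prog in
/-- Give the weights `2 ^ 0`, `2 ^ 1`, ... to the ancestors of `t`. -/
def weighAncestors : Prog :=
  .seq (block [const 3 1, add 4 4 2, const 5 1])
    (.whileLT 6 3 (block [store 1 4 5, add 5 5 5, add 7 7 3, parent 4 4, load 6 1 4]))

open Instr Prog in
/-- Process one neighbour of the vertex in register `4`. -/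
def scanNeighbour : Prog :=
  .seq (block [nbr 17 4 16, load 6 1 17])
    (.seq (.ifLT 6 3 (block [store 0 0 17, add 0 0 3, store 1 17 12, const 6 0, add 6 6 12,
        add 12 12 12]) .skip)
      (block [add 14 14 6, add 16 16 3]))

open Instr Prog in
/-- Process all neighbours of the next vertex of the list. -/
def scanVertex : Prog :=
  .seq (block [load 4 0 13, const 14 0, deg 15 4, const 16 0])
    (.seq (.whileLT 16 15 scanNeighbour) (block [store 2 13 14, add 13 13 3]))

open Instr Prog in
/-- List the component of the next child of `t`. -/
def explore : Prog :=
  .seq (block [child 11 2 10, add 10 10 3, const 0 0, store 0 0 11, const 12 0, add 12 12 5,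
      store 1 11 12, add 12 12 12, const 0 1, const 13 0])
    (.whileLT 13 0 scanVertex)

open Instr Prog in
/-- Compute the code of the component. -/
def encode : Prog :=
  .seq (block [add 18 7 0, const 19 1, const 9 1, const 20 0])
    (.whileLT 20 0 (.seq (block [const 21 0])
      (.seq (.whileLT 21 18 (block [add 19 19 19, add 9 9 9, add 9 9 9, add 21 21 3]))
        (block [load 14 2 20, add 19 19 14, add 20 20 3]))))

open Instr Prog in
/-- Explore components until one code has occurred often enough. -/
def findComponent : Prog :=
  .seq weighAncestors (.seq (block [const 9 1])
    (.whileLT 8 9 (.seq explore (.seq encode (block [load 8 3 19, add 8 8 3, store 3 19 8])))))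

/-! ### The weights of the ancestors -/

/-- The ancestors of `t` have their weights, and nothing else has been done. -/
structure Weighed (I : Input) (t d : ℕ) (s : State) : Prop where
  reg_two : s.reg 2 = t
  reg_one : s.reg 3 = 1
  reg_pow : s.reg 5 = 2 ^ d
  reg_depth : s.reg 7 = d
  reg_count : s.reg 8 = 0
  reg_next : s.reg 10 = 0
  weight : ∀ i < d, s.arr 1 (I.parent^[i] t) = 2 ^ i
  weight_zero : ∀ x, (∀ i < d, x ≠ I.parent^[i] t) → s.arr 1 x = 0
  count : ∀ x, s.arr 3 x = 0

theorem runs_weighAncestors {I : Input} {k i t d : ℕ}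
    (hinj : Set.InjOn (fun m => I.parent^[m] t) (Set.Iio d))
    (hlast : ∃ i < d, I.parent^[d] t = I.parent^[i] t) :
    Runs I weighAncestors (initState k i t) (3 + (d * (5 + 1) + 1)) (Weighed I t d) := by
  refine Runs.seq (R := fun s => (Weighed I t 0 s ∧ s.reg 4 = I.parent^[0] t ∧
    s.reg 6 = s.arr 1 (I.parent^[0] t)) ∧ 0 ≤ d) (Runs.block _ ?_) ?_
  · simp only [List.foldl, Instr.step]
    refine ⟨⟨⟨?_, ?_, ?_, ?_, ?_, ?_, ?_, ?_, ?_⟩, ?_, ?_⟩, ?_⟩ <;>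
      simp [State.setReg_reg, State.setReg_arr, initState]
  · intro s hs
    refine (Runs.whileLT (τ := 5) (N := d) (fun n s => (Weighed I t n s ∧
      s.reg 4 = I.parent^[n] t ∧ s.reg 6 = s.arr 1 (I.parent^[n] t)) ∧ n ≤ d) ?_ hs).mono le_rfl ?_
    · rintro n s ⟨⟨h, hv, hm⟩, hn⟩ hlt
      rw [h.reg_one, hm] at hlt
      -- The root is its own parent, so the vertex with index `d` repeats an earlier one. Its weight
      -- is already positive, and this ends the loop.
      have hnd : n < d := by
        refine lt_of_le_of_ne hn ?_
        rintro rfl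
        obtain ⟨j, hj, he⟩ := hlast
        rw [he, h.weight j hj] at hlt
        have : 0 < 2 ^ j := by positivity
        omega
      refine ⟨hnd, Runs.block _ ?_⟩
      have hv' : I.parent (I.parent^[n] t) = I.parent^[n + 1] t :=
        (Function.iterate_succ_apply' _ _ _).symm
      simp only [List.foldl, Instr.step]
      refine ⟨⟨⟨?_, ?_, ?_, ?_, ?_, ?_, ?_, ?_, ?_⟩, ?_, ?_⟩, hnd⟩
      case refine_1.refine_7 =>
        intro j hj
        simp only [State.setReg_reg, State.setReg_arr, State.setArr_reg, State.setArr_arr, hv,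
          h.reg_pow, reduceIte]
        rw [Function.update_apply]
        split_ifs with h1
        · rw [hinj (show j < d by omega) hnd h1]
        · refine h.weight j (lt_of_le_of_ne (by omega) ?_)
          rintro rfl
          exact h1 rfl
      case refine_1.refine_8 =>
        intro x hx
        have hxn := hx n (by omega)
        simp only [State.setReg_reg, State.setReg_arr, State.setArr_reg, State.setArr_arr, hv,
          Function.update_apply, hxn, reduceIte]
        exact h.weight_zero x fun i hi => hx i (by omega)
      all_goals
        simp [State.setReg_reg, State.setReg_arr, State.setArr_reg, State.setArr_arr, hv, hv',
          h.reg_two, h.reg_one, h.reg_pow, h.reg_depth, h.reg_count, h.reg_next, h.count]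
      ring
    · rintro s ⟨n, ⟨⟨h, hv, hm⟩, hn⟩, hlt⟩
      rw [h.reg_one, hm] at hlt
      rcases hn.lt_or_eq with hnd | rfl
      -- Conversely, a vertex with smaller index is new and has weight 0, so the loop does not stop
      -- early.
      · exfalso
        apply hlt
        rw [h.weight_zero]
        · exact one_pos
        · intro i hi he
          have := hinj (show n < d from hnd) (show i < d by omega) he
          omega
      · exact h

/-! ### Exploring a component -/

/-- `B` is the set of the vertices that can be reached from `q` without meeting one of the `d`
ancestors of `t`. -/
structure IsPart (I : Input) (t d : ℕ) (B : Finset ℕ) (q : ℕ) : Prop where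
  mem : q ∈ B
  notMem : ∀ i < d, I.parent^[i] t ∉ B
  anc_inj : Set.InjOn (fun m => I.parent^[m] t) (Set.Iio d)
  nbr_mem : ∀ v ∈ B, ∀ e < I.deg v, I.nbr v e ∈ B ∨ ∃ i < d, I.nbr v e = I.parent^[i] t
  nbr_inj : ∀ v ∈ B, Set.InjOn (I.nbr v) (Set.Iio (I.deg v))
  subset : ∀ X : Set ℕ, q ∈ X →
    (∀ v ∈ X, v ∈ B → ∀ e < I.deg v, I.nbr v e ∈ B → I.nbr v e ∈ X) → ∀ v ∈ B, v ∈ X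

/-- The ancestors of `t` followed by the list `l`. -/
def ancestorsThen (I : Input) (t d : ℕ) (l : ℕ → ℕ) (i : ℕ) : ℕ :=
  if i < d then I.parent^[i] t else l (i - d)

/-- The positions of the neighbours of `v` among the ancestors of `t` and the list `l`. -/
noncomputable def nbrPositions (I : Input) (t d : ℕ) (l : ℕ → ℕ) (r v : ℕ) : Finset ℕ :=
  open Classical in
  (Finset.range (d + r)).filter (fun i => ∃ e < I.deg v, I.nbr v e = ancestorsThen I t d l i)

/-- The state of the exploration of `B`: `l` lists `r` vertices, the neighbours of the first `head`
of which have been scanned, `pw` are the weights, and `S` the sums of the weights of neighbours. -/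
structure Exploring (I : Input) (t d : ℕ) (B : Finset ℕ) (q : ℕ) (pw₀ : ℕ → ℕ)
    (l pw S : ℕ → ℕ) (r head : ℕ) : Prop where
  pos : 0 < r
  first : l 0 = q
  mem : ∀ i < r, l i ∈ B
  weight : ∀ i < d, pw (I.parent^[i] t) = 2 ^ i
  weight_list : ∀ i < r, pw (l i) = 2 ^ (d + i)
  listed : ∀ x ∈ B, pw x ≠ 0 → ∃ i < r, l i = x
  outside : ∀ x ∉ B, pw x = pw₀ x
  scanned : ∀ h < head, ∀ e < I.deg (l h), pw (I.nbr (l h) e) ≠ 0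
  sums : ∀ h < head, S h = ∑ e ∈ Finset.range (I.deg (l h)), pw (I.nbr (l h) e)
  le : head ≤ r

section Exploring

variable {I : Input} {t d q r head : ℕ} {B : Finset ℕ} {pw₀ l pw S : ℕ → ℕ}

/-- Bounds the rounds of the loop over neighbours: every neighbour is an ancestor of `t` or lies in
the component. -/
theorem IsPart.deg_le (hB : IsPart I t d B q) {v : ℕ} (hv : v ∈ B) : I.deg v ≤ d + B.card := by
  classical
  have h : (Finset.range (I.deg v)).image (I.nbr v) ⊆
      (Finset.range d).image (fun i => I.parent^[i] t) ∪ B := by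
    intro x hx
    obtain ⟨e, he, rfl⟩ := Finset.mem_image.1 hx
    rcases hB.nbr_mem v hv e (Finset.mem_range.1 he) with h | ⟨i, hi, h⟩
    · exact Finset.mem_union_right _ h
    · exact Finset.mem_union_left _ (Finset.mem_image.2 ⟨i, Finset.mem_range.2 hi, h.symm⟩)
  have h1 := Finset.card_le_card h
  rw [Finset.card_image_of_injOn (by simpa using hB.nbr_inj v hv), Finset.card_range] at h1
  have h2 := Finset.card_union_le ((Finset.range d).image (fun i => I.parent^[i] t)) B
  have h3 : ((Finset.range d).image (fun i => I.parent^[i] t)).card ≤ d :=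
    Finset.card_image_le.trans_eq (Finset.card_range d)
  omega

theorem Exploring.injOn (h : Exploring I t d B q pw₀ l pw S r head) :
    Set.InjOn l (Set.Iio r) := by
  intro i hi j hj hij
  have h1 := h.weight_list i hi
  rw [hij, h.weight_list j hj] at h1
  have := Nat.pow_right_injective le_rfl h1
  omega

theorem Exploring.le_card (h : Exploring I t d B q pw₀ l pw S r head) : r ≤ B.card := by
  rw [← Finset.card_range r]
  exact Finset.card_le_card_of_injOn l (fun i hi => h.mem i (Finset.mem_range.1 hi))
    (by simpa using h.injOn)

theorem IsPart.exploring_start (hB : IsPart I t d B q)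
    (hw : ∀ i < d, pw₀ (I.parent^[i] t) = 2 ^ i) (hz : ∀ x ∈ B, pw₀ x = 0) :
    Exploring I t d B q pw₀ (Function.update l 0 q) (Function.update pw₀ q (2 ^ d)) S 1 0 where
  pos := one_pos
  first := by simp
  mem i hi := by
    obtain rfl : i = 0 := by omega
    simpa using hB.mem
  weight i hi := by
    rw [Function.update_of_ne, hw i hi]
    rintro rfl
    exact hB.notMem i hi hB.mem
  weight_list i hi := by
    obtain rfl : i = 0 := by omega
    simp
  listed x hx h := by
    refine ⟨0, one_pos, ?_⟩
    by_contra hne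
    rw [Function.update_self] at hne
    rw [Function.update_of_ne (Ne.symm hne)] at h
    exact h (hz x hx)
  outside x hx := by
    rw [Function.update_of_ne]
    rintro rfl
    exact hx hB.mem
  scanned h hh := absurd hh (Nat.not_lt_zero _)
  sums h hh := absurd hh (Nat.not_lt_zero _)
  le := Nat.zero_le _

/-- The new weight changes no sum computed before: scanned neighbours have positive weight, whereas
`u` has weight 0. -/
theorem Exploring.append (h : Exploring I t d B q pw₀ l pw S r head) {u : ℕ} (hu : u ∈ B) (hz : pw u = 0) :
    Exploring I t d B q pw₀ (Function.update l r u) (Function.update pw u (2 ^ (d + r))) S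
      (r + 1) head := by
  have hl : ∀ i < r, Function.update l r u i = l i := fun i hi =>
    Function.update_of_ne (by omega) _ _
  have hp : ∀ x, pw x ≠ 0 → Function.update pw u (2 ^ (d + r)) x = pw x := fun x hx =>
    Function.update_of_ne (by rintro rfl; exact hx hz) _ _
  have hscan : ∀ h < head, ∀ e < I.deg (l h),
      Function.update pw u (2 ^ (d + r)) (I.nbr (l h) e) = pw (I.nbr (l h) e) :=
    fun i hi e he => hp _ (h.scanned i hi e he)
  have hle := h.le
  exact
    { pos := by omega
      first := by rw [hl 0 h.pos, h.first]
      mem := fun i hi => by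
        rcases (Nat.lt_succ_iff.1 hi).lt_or_eq with h1 | rfl
        · rw [hl i h1]; exact h.mem i h1
        · simpa using hu
      weight := fun i hi => by
        rw [hp _ (by rw [h.weight i hi]; positivity), h.weight i hi]
      weight_list := fun i hi => by
        rcases (Nat.lt_succ_iff.1 hi).lt_or_eq with h1 | rfl
        · rw [hl i h1, hp _ (by rw [h.weight_list i h1]; positivity), h.weight_list i h1]
        · simp
      listed := fun x hx hne => by
        by_cases hxu : x = u
        · exact ⟨r, by omega, by simp [hxu]⟩
        · rw [Function.update_of_ne hxu] at hne
          obtain ⟨i, hi, he⟩ := h.listed x hx hne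
          exact ⟨i, by omega, by rw [hl i hi, he]⟩
      outside := fun x hx => by
        rw [Function.update_of_ne, h.outside x hx]
        rintro rfl
        exact hx hu
      scanned := fun i hi => by
        rw [hl i (by omega)]
        intro e he
        rw [hscan i hi e he]
        exact h.scanned i hi e he
      sums := fun i hi => by
        rw [hl i (by omega), h.sums i hi]
        exact Finset.sum_congr rfl fun e he => (hscan i hi e (Finset.mem_range.1 he)).symm
      le := by omega }

theorem Exploring.scan (h : Exploring I t d B q pw₀ l pw S r head) (hlt : head < r)
    (hne : ∀ e < I.deg (l head), pw (I.nbr (l head) e) ≠ 0) :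
    Exploring I t d B q pw₀ l pw (Function.update S head
      (∑ e ∈ Finset.range (I.deg (l head)), pw (I.nbr (l head) e))) r (head + 1) :=
  { h with
    scanned := fun i hi => by
      rcases (Nat.lt_succ_iff.1 hi).lt_or_eq with h1 | rfl
      · exact h.scanned i h1
      · exact hne
    sums := fun i hi => by
      rcases (Nat.lt_succ_iff.1 hi).lt_or_eq with h1 | rfl
      · rw [Function.update_of_ne (by omega), h.sums i h1]
      · simp
    le := hlt }

theorem Exploring.weight_ancestorsThen (h : Exploring I t d B q pw₀ l pw S r head) {i : ℕ}
    (hi : i < d + r) : pw (ancestorsThen I t d l i) = 2 ^ i := by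
  unfold ancestorsThen
  split_ifs with h1
  · exact h.weight i h1
  · rw [h.weight_list _ (by omega)]
    congr 1
    omega

/-- Once every listed vertex is scanned, the list is closed under neighbours in `B` and hence
exhausts `B`. -/
theorem Exploring.bijOn (h : Exploring I t d B q pw₀ l pw S r r) (hB : IsPart I t d B q) :
    Set.BijOn l (Set.Iio r) B := by
  refine ⟨fun i hi => h.mem i hi, h.injOn, ?_⟩
  intro v hv
  refine hB.subset (l '' Set.Iio r) ⟨0, h.pos, h.first⟩ ?_ v hv
  rintro _ ⟨i, hi, rfl⟩ - e he hm
  exact h.listed _ hm (h.scanned i hi e he)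

/-- The weights are distinct powers of two and each neighbour is listed once, so the sum is the
binary form of the set of neighbour positions. -/
theorem Exploring.sums_eq (h : Exploring I t d B q pw₀ l pw S r r) (hB : IsPart I t d B q)
    {a : ℕ} (ha : a < r) : S a = ∑ i ∈ nbrPositions I t d l r (l a), 2 ^ i := by
  classical
  rw [h.sums a ha]
  have hex : ∀ e < I.deg (l a), ∃ i < d + r, ancestorsThen I t d l i = I.nbr (l a) e := by
    intro e he
    rcases hB.nbr_mem _ (h.mem a ha) e he with h1 | ⟨i, hi, h1⟩
    · obtain ⟨i, hi, h2⟩ := h.listed _ h1 (h.scanned a ha e he)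
      exact ⟨d + i, by omega, by simp [ancestorsThen, h2]⟩
    · exact ⟨i, by omega, by simp [ancestorsThen, hi, h1]⟩
  choose! g hg hg' using hex
  refine Finset.sum_bij (fun e _ => g e) ?_ ?_ ?_ ?_
  · intro e he
    have he := Finset.mem_range.1 he
    exact Finset.mem_filter.2 ⟨Finset.mem_range.2 (hg e he), e, he, (hg' e he).symm⟩
  · intro e he e' he' heq
    have he := Finset.mem_range.1 he
    have he' := Finset.mem_range.1 he'
    refine hB.nbr_inj _ (h.mem a ha) he he' ?_
    rw [← hg' e he, ← hg' e' he', heq]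
  · intro i hi
    obtain ⟨hi, e, he, hee⟩ := Finset.mem_filter.1 hi
    refine ⟨e, Finset.mem_range.2 he, ?_⟩
    apply Nat.pow_right_injective le_rfl
    dsimp only
    rw [← h.weight_ancestorsThen (Finset.mem_range.1 hi), ← h.weight_ancestorsThen (hg e he),
      hg' e he, hee]
  · intro e he
    have he := Finset.mem_range.1 he
    rw [← h.weight_ancestorsThen (hg e he), hg' e he]

end Exploring

/-! ### Running the exploration -/

/-- The registers and arrays that are not changed by the exploration of a component. -/
structure Between (t d J : ℕ) (cnt : ℕ → ℕ) (s : State) : Prop where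
  reg_two : s.reg 2 = t
  reg_one : s.reg 3 = 1
  reg_pow : s.reg 5 = 2 ^ d
  reg_depth : s.reg 7 = d
  reg_next : s.reg 10 = J
  count : s.arr 3 = cnt

/-- The state of the memory during the exploration. -/
structure ExploringState (I : Input) (t d J : ℕ) (cnt : ℕ → ℕ) (B : Finset ℕ) (q : ℕ)
    (pw₀ : ℕ → ℕ) (r head : ℕ) (s : State) : Prop extends Between t d J cnt s where
  exploring : Exploring I t d B q pw₀ (s.arr 0) (s.arr 1) (s.arr 2) r head
  reg_len : s.reg 0 = r
  reg_cur : s.reg 12 = 2 ^ (d + r)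
  reg_head : s.reg 13 = head

/-- The state of the memory while the neighbours of one vertex are scanned. -/
structure ScanningState (I : Input) (t d J : ℕ) (cnt : ℕ → ℕ) (B : Finset ℕ) (q : ℕ)
    (pw₀ : ℕ → ℕ) (r head e : ℕ) (s : State) : Prop
    extends ExploringState I t d J cnt B q pw₀ r head s where
  lt : head < r
  reg_vertex : s.reg 4 = s.arr 0 head
  reg_deg : s.reg 15 = I.deg (s.arr 0 head)
  reg_nbr : s.reg 16 = e
  nonzero : ∀ e' < e, s.arr 1 (I.nbr (s.arr 0 head) e') ≠ 0
  reg_sum : s.reg 14 = ∑ e' ∈ Finset.range e, s.arr 1 (I.nbr (s.arr 0 head) e')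
  nbr_le : e ≤ I.deg (s.arr 0 head)

section runs

variable {I : Input} {t d J q : ℕ} {B : Finset ℕ} {pw₀ cnt : ℕ → ℕ}

theorem runs_scanNeighbour (hB : IsPart I t d B q) {r head e : ℕ} {s : State}
    (h : ScanningState I t d J cnt B q pw₀ r head e s) (he : e < I.deg (s.arr 0 head)) :
    Runs I scanNeighbour s (2 + (7 + 2))
      (fun s' => ∃ r', ScanningState I t d J cnt B q pw₀ r' head (e + 1) s') := by
  refine Runs.seq (R := fun s' => ScanningState I t d J cnt B q pw₀ r head e s' ∧
    e < I.deg (s'.arr 0 head) ∧ s'.reg 17 = I.nbr (s'.arr 0 head) e ∧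
    s'.reg 6 = s'.arr 1 (I.nbr (s'.arr 0 head) e)) (Runs.block _ ?_) ?_
  · simp only [List.foldl, Instr.step]
    refine ⟨⟨⟨⟨?_, ?_, ?_, ?_, ?_, ?_⟩, ?_, ?_, ?_, ?_⟩, h.lt, ?_, ?_, ?_, ?_, ?_, ?_⟩, ?_, ?_, ?_⟩ <;>
      simp only [State.setReg_reg, State.setReg_arr, reduceIte, Nat.reduceEqDiff, h.reg_vertex,
        h.reg_nbr]
    exacts [h.reg_two, h.reg_one, h.reg_pow, h.reg_depth, h.reg_next, h.count, h.exploring,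
      h.reg_len, h.reg_cur, h.reg_head, h.reg_deg, h.nonzero, h.reg_sum,
      h.nbr_le, he]
  · clear h he s
    rintro s ⟨h, he, hu, hm⟩
    refine Runs.seq (m := 7) (n := 2) (R := fun s' =>
      ∃ r', ScanningState I t d J cnt B q pw₀ r' head e s' ∧
      e < I.deg (s'.arr 0 head) ∧ s'.arr 1 (I.nbr (s'.arr 0 head) e) ≠ 0 ∧
      s'.reg 6 = s'.arr 1 (I.nbr (s'.arr 0 head) e)) (Runs.ifLT (fun hlt => ?_) fun hlt => ?_) ?_
    · refine (Runs.block _ ?_)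
      rw [h.reg_one, hm, Nat.lt_one_iff] at hlt
      -- Weight 0 excludes the ancestors of `t`, so the neighbour is an unlisted vertex of the
      -- component.
      have hBu : I.nbr (s.arr 0 head) e ∈ B := by
        rcases hB.nbr_mem _ (h.exploring.mem head h.lt) e he with h1 | ⟨i, hi, h1⟩
        · exact h1
        · rw [h1, h.exploring.weight i hi] at hlt
          exact absurd hlt (by positivity)
      have hex := h.exploring.append hBu hlt
      have hhead : Function.update (s.arr 0) r (I.nbr (s.arr 0 head) e) head = s.arr 0 head :=
        Function.update_of_ne h.lt.ne _ _
      have hupd : ∀ e' < e, Function.update (s.arr 1) (I.nbr (s.arr 0 head) e) (2 ^ (d + r))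
          (I.nbr (s.arr 0 head) e') = s.arr 1 (I.nbr (s.arr 0 head) e') := fun e' he' =>
        Function.update_of_ne (fun h1 => h.nonzero e' he' (by rw [h1]; exact hlt)) _ _
      refine ⟨r + 1, ?_⟩
      simp only [List.foldl, Instr.step]
      refine ⟨⟨⟨⟨?_, ?_, ?_, ?_, ?_, ?_⟩, ?_, ?_, ?_, ?_⟩, Nat.lt_succ_of_lt h.lt, ?_, ?_, ?_, ?_, ?_,
        ?_⟩, ?_, ?_, ?_⟩ <;>
        simp only [State.setReg_reg, State.setReg_arr, State.setArr_reg, State.setArr_arr,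
          reduceIte, Nat.reduceEqDiff, h.reg_len, h.reg_cur, h.reg_one, hu, hhead, one_ne_zero,
          zero_ne_one, zero_add, OfNat.ofNat_ne_zero, OfNat.zero_ne_ofNat, OfNat.ofNat_ne_one,
          Function.update_self]
      case refine_14 =>
        intro e' he'
        rw [hupd e' he']
        exact h.nonzero e' he'
      case refine_15 =>
        rw [h.reg_sum]
        exact Finset.sum_congr rfl fun e' he' => (hupd e' (Finset.mem_range.1 he')).symm
      case refine_18 => positivity
      exacts [h.reg_two, h.reg_pow, h.reg_depth, h.reg_next, h.count, hex, by ring, h.reg_head,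
        h.reg_vertex, h.reg_deg, h.reg_nbr, h.nbr_le, he]
    · rw [h.reg_one, hm, Nat.lt_one_iff] at hlt
      exact (Runs.skip ⟨r, h, he, hlt, hm⟩).mono (Nat.zero_le _) fun _ h => h
    · clear h he hu hm s
      rintro s ⟨r', h, he, hne, hm⟩
      refine Runs.block _ ⟨r', ?_⟩
      simp only [List.foldl, Instr.step]
      refine ⟨⟨⟨?_, ?_, ?_, ?_, ?_, ?_⟩, ?_, ?_, ?_, ?_⟩, h.lt, ?_, ?_, ?_, ?_, ?_, he⟩ <;>
        simp only [State.setReg_reg, State.setReg_arr, reduceIte, Nat.reduceEqDiff, h.reg_one,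
          h.reg_nbr, h.reg_sum, hm, OfNat.zero_ne_ofNat]
      case refine_14 =>
        intro e' he'
        rcases (Nat.lt_succ_iff.1 he').lt_or_eq with h1 | rfl
        · exact h.nonzero e' h1
        · exact hne
      case refine_15 => rw [Finset.sum_range_succ]
      exacts [h.reg_two, h.reg_pow, h.reg_depth, h.reg_next, h.count, h.exploring, h.reg_len,
        h.reg_cur, h.reg_head, h.reg_vertex, h.reg_deg]

theorem runs_scanVertex (hB : IsPart I t d B q) {b : ℕ} (hb : B.card ≤ b) {r head : ℕ} {s : State}
    (h : ExploringState I t d J cnt B q pw₀ r head s) (hlt : head < r) :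
    Runs I scanVertex s (4 + (((d + b) * (11 + 1) + 1) + 2))
      (fun s' => ∃ r', ExploringState I t d J cnt B q pw₀ r' (head + 1) s') := by
  refine Runs.seq (R := ScanningState I t d J cnt B q pw₀ r head 0) (Runs.block _ ?_) ?_
  · simp only [List.foldl, Instr.step]
    refine ⟨⟨⟨?_, ?_, ?_, ?_, ?_, ?_⟩, ?_, ?_, ?_, ?_⟩, hlt, ?_, ?_, ?_, ?_, ?_, Nat.zero_le _⟩ <;>
      simp only [State.setReg_reg, State.setReg_arr, reduceIte, Nat.reduceEqDiff, h.reg_head,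
        OfNat.zero_ne_ofNat]
    exacts [h.reg_two, h.reg_one, h.reg_pow, h.reg_depth, h.reg_next, h.count, h.exploring,
      h.reg_len, h.reg_cur, fun e' he' => absurd he' (Nat.not_lt_zero _), rfl]
  · intro s hs
    refine Runs.seq (Runs.whileLT (N := d + b) (τ := 11)
      (fun e s => ∃ r', ScanningState I t d J cnt B q pw₀ r' head e s) ?_ ⟨r, hs⟩) ?_
    · rintro e s ⟨r', h⟩ hlt
      rw [h.reg_nbr, h.reg_deg] at hlt
      have := hB.deg_le (h.exploring.mem head h.lt)
      exact ⟨by omega, runs_scanNeighbour hB h hlt⟩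
    · rintro s ⟨e, ⟨r', h⟩, hge⟩
      rw [h.reg_nbr, h.reg_deg] at hge
      obtain rfl : e = I.deg (s.arr 0 head) := le_antisymm h.nbr_le (by omega)
      refine Runs.block _ ⟨r', ?_⟩
      have hex := h.exploring.scan h.lt h.nonzero
      rw [← h.reg_sum] at hex
      simp only [List.foldl, Instr.step]
      refine ⟨⟨?_, ?_, ?_, ?_, ?_, ?_⟩, ?_, ?_, ?_, ?_⟩ <;>
        simp only [State.setReg_reg, State.setReg_arr, State.setArr_reg, State.setArr_arr,
          reduceIte, Nat.reduceEqDiff, h.reg_head, h.reg_one, OfNat.zero_ne_ofNat,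
          OfNat.one_ne_ofNat]
      exacts [h.reg_two, h.reg_pow, h.reg_depth, h.reg_next, h.count, hex, h.reg_len, h.reg_cur]

theorem runs_explore (hB : IsPart I t d B q) {b : ℕ} (hb : B.card ≤ b) (hq : q = I.child t J)
    {s : State} (h : Between t d J cnt s) (hw : ∀ i < d, s.arr 1 (I.parent^[i] t) = 2 ^ i)
    (hz : ∀ x ∈ B, s.arr 1 x = 0) :
    Runs I explore s (10 + (b * (4 + (((d + b) * (11 + 1) + 1) + 2) + 1) + 1))
      (fun s' => ∃ r, ExploringState I t d (J + 1) cnt B q (s.arr 1) r r s') := by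
  refine Runs.seq (R := ExploringState I t d (J + 1) cnt B q (s.arr 1) 1 0) (Runs.block _ ?_) ?_
  · have hex := hB.exploring_start (l := s.arr 0) (S := s.arr 2) hw hz
    simp only [List.foldl, Instr.step]
    refine ⟨⟨?_, ?_, ?_, ?_, ?_, ?_⟩, ?_, ?_, ?_, ?_⟩ <;>
      simp only [State.setReg_reg, State.setReg_arr, State.setArr_reg, State.setArr_arr,
        reduceIte, Nat.reduceEqDiff, h.reg_two, h.reg_next, h.reg_one, h.reg_pow, h.reg_depth,
        OfNat.zero_ne_ofNat, OfNat.ofNat_ne_zero, OfNat.ofNat_ne_one,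
        one_ne_zero, zero_ne_one, zero_add, ← hq, h.count]
    exacts [hex, by ring]
  · intro s' hs'
    refine (Runs.whileLT (N := b) (τ := 4 + (((d + b) * (11 + 1) + 1) + 2)) (fun n s' => ∃ r,
      ExploringState I t d (J + 1) cnt B q (s.arr 1) r n s') ?_ ⟨1, hs'⟩).mono le_rfl ?_
    · rintro n s' ⟨r, h⟩ hlt
      rw [h.reg_head, h.reg_len] at hlt
      have := h.exploring.le_card
      exact ⟨by omega, runs_scanVertex hB hb h hlt⟩
    · rintro s' ⟨n, ⟨r, h⟩, hge⟩
      rw [h.reg_head, h.reg_len] at hge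
      obtain rfl : n = r := le_antisymm h.exploring.le (by omega)
      exact ⟨n, h⟩

end runs

/-! ### Codes -/

/-- The number with leading digit `1` and the digits `S 0, ..., S (r - 1)` in base `2 ^ L`. -/
def digitCode (S : ℕ → ℕ) (L : ℕ) : ℕ → ℕ
  | 0 => 1
  | a + 1 => digitCode S L a * 2 ^ L + S a

theorem two_pow_le_digitCode (S : ℕ → ℕ) (L r : ℕ) : 2 ^ (r * L) ≤ digitCode S L r := by
  induction r with
  | zero => simp [digitCode]
  | succ r ih =>
    rw [digitCode, add_mul, one_mul, pow_add]
    exact (Nat.mul_le_mul_right _ ih).trans (Nat.le_add_right _ _)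

theorem digitCode_lt {S : ℕ → ℕ} {L r : ℕ} (hS : ∀ a < r, S a < 2 ^ L) :
    digitCode S L r < 2 ^ (r * L + 1) := by
  induction r with
  | zero => simp [digitCode]
  | succ r ih =>
    have h1 := ih fun a ha => hS a (by omega)
    have h2 := hS r (by omega)
    rw [digitCode, show (r + 1) * L + 1 = (r * L + 1) + L by ring, pow_add _ (r * L + 1)]
    have h3 := Nat.mul_le_mul_right (2 ^ L) (Nat.succ_le_of_lt h1)
    rw [Nat.succ_mul] at h3
    omega

theorem digitCode_congr {S S' : ℕ → ℕ} {L r : ℕ} (h : ∀ a < r, S a = S' a) :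
    digitCode S L r = digitCode S' L r := by
  induction r with
  | zero => rfl
  | succ r ih => rw [digitCode, digitCode, ih fun a ha => h a (by omega), h r (by omega)]

/-- The last digit is the residue modulo 2^L; cancelling it leaves shorter codes. -/
theorem eq_of_digitCode_eq {S S' : ℕ → ℕ} {L r : ℕ} (hS : ∀ a < r, S a < 2 ^ L)
    (hS' : ∀ a < r, S' a < 2 ^ L) (h : digitCode S L r = digitCode S' L r) :
    ∀ a < r, S a = S' a := by
  induction r with
  | zero => intro a ha; omega
  | succ r ih =>
    rw [digitCode, digitCode] at h
    have hm := congrArg (· % 2 ^ L) h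
    have hd := congrArg (· / 2 ^ L) h
    have hpos : 0 < 2 ^ L := by positivity
    simp only [Nat.mul_add_mod_self_right, Nat.mod_eq_of_lt (hS r (by omega)),
      Nat.mod_eq_of_lt (hS' r (by omega))] at hm
    have hd' : digitCode S L r = digitCode S' L r := by
      rw [hm] at h
      exact Nat.eq_of_mul_eq_mul_right hpos (Nat.add_right_cancel h)
    intro a ha
    rcases (Nat.lt_succ_iff.1 ha).lt_or_eq with h1 | rfl
    · exact ih (fun a ha => hS a (by omega)) (fun a ha => hS' a (by omega)) hd' a h1
    · exact hm

/-- The code of a list of the vertices of a component. -/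
noncomputable def listCode (I : Input) (t d : ℕ) (l : ℕ → ℕ) (r : ℕ) : ℕ :=
  digitCode (fun a => ∑ i ∈ nbrPositions I t d l r (l a), 2 ^ i) (d + r) r

theorem sum_nbrPositions_lt (I : Input) (t d : ℕ) (l : ℕ → ℕ) (r v : ℕ) :
    ∑ i ∈ nbrPositions I t d l r v, 2 ^ i < 2 ^ (d + r) :=
  Nat.geomSum_lt le_rfl fun _ hk => Finset.mem_range.1 (Finset.mem_filter.1 hk).1

theorem listCode_lt (I : Input) (t d : ℕ) (l : ℕ → ℕ) (r : ℕ) :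
    listCode I t d l r < 2 ^ (r * (d + r) + 1) :=
  digitCode_lt fun _ _ => sum_nbrPositions_lt _ _ _ _ _ _

/-- Lists with the same code have the same length and the same adjacencies. -/
theorem eq_of_listCode_eq {I : Input} {t d r r' : ℕ} {l l' : ℕ → ℕ}
    (h : listCode I t d l r = listCode I t d l' r') :
    r = r' ∧ ∀ a < r, nbrPositions I t d l r (l a) = nbrPositions I t d l' r' (l' a) := by
  -- The leading digit 1 makes r(d + r) the binary logarithm of the code, rounded down, and this
  -- determines r. Only then is the base 2^(d + r) known to agree.
  have key : ∀ {r r' l l'}, listCode I t d l r = listCode I t d l' r' → r' ≤ r := by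
    intro r r' l l' h
    have h1 := listCode_lt I t d l r
    have h2 : 2 ^ (r' * (d + r')) ≤ listCode I t d l' r' := two_pow_le_digitCode _ _ _
    have h3 : r' * (d + r') < r * (d + r) + 1 :=
      (Nat.pow_lt_pow_iff_right one_lt_two).1 (by omega)
    by_contra hlt
    have h4 : r + 1 ≤ r' := by omega
    have h5 := Nat.mul_le_mul h4 (Nat.add_le_add_left h4 d)
    nlinarith
  obtain rfl : r = r' := le_antisymm (key h.symm) (key h)
  refine ⟨rfl, fun a ha => Finset.geomSum_injective le_rfl ?_⟩
  exact eq_of_digitCode_eq (fun _ _ => sum_nbrPositions_lt _ _ _ _ _ _)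
    (fun _ _ => sum_nbrPositions_lt _ _ _ _ _ _) h a ha

section runs

variable {I : Input} {t d J : ℕ} {cnt : ℕ → ℕ}

/-- The state of the memory while the code is computed: `a` digits have been processed, and the
code and the threshold are `x` and `y`. -/
structure Encoding (t d J : ℕ) (cnt : ℕ → ℕ) (A : ℕ → ℕ → ℕ) (r a x y : ℕ) (s : State) : Prop
    extends Between t d J cnt s where
  arr_eq : s.arr = A
  reg_len : s.reg 0 = r
  reg_digits : s.reg 18 = d + r
  reg_index : s.reg 20 = a
  le : a ≤ r
  reg_code : s.reg 19 = x
  reg_thr : s.reg 9 = y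

/-- Multiplication by the base 2^(d + r) is done by d + r doublings; the threshold is quadrupled in
the same rounds. -/
theorem runs_encode {b r : ℕ} (hr : r ≤ b) {s : State} (h : Between t d J cnt s)
    (hlen : s.reg 0 = r) :
    Runs I encode s (4 + (b * (1 + (((d + b) * (4 + 1) + 1) + 3) + 1) + 1))
      (Encoding t d J cnt s.arr r r (digitCode (s.arr 2) (d + r) r) (4 ^ (r * (d + r)))) := by
  refine Runs.seq (R := Encoding t d J cnt s.arr r 0 1 1) (Runs.block _ ?_) ?_
  · simp only [List.foldl, Instr.step]
    refine ⟨⟨?_, ?_, ?_, ?_, ?_, ?_⟩, ?_, ?_, ?_, ?_, Nat.zero_le _, ?_, ?_⟩ <;>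
      simp only [State.setReg_reg, State.setReg_arr, reduceIte, Nat.reduceEqDiff, hlen,
        h.reg_depth, OfNat.zero_ne_ofNat]
    exacts [h.reg_two, h.reg_one, h.reg_pow, h.reg_next, h.count]
  intro s' hs'
  refine (Runs.whileLT (N := b) (τ := 1 + (((d + b) * (4 + 1) + 1) + 3)) (fun a => Encoding t d J
    cnt s.arr r a (digitCode (s.arr 2) (d + r) a) (4 ^ (a * (d + r)))) ?_
    (by simpa [digitCode] using hs')).mono le_rfl ?_
  · clear hs' s'
    intro a s' h hlt
    rw [h.reg_index, h.reg_len] at hlt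
    refine ⟨by omega, ?_⟩
    refine Runs.seq (R := fun s' => Encoding t d J cnt s.arr r a (digitCode (s.arr 2) (d + r) a)
      (4 ^ (a * (d + r))) s' ∧ s'.reg 21 = 0) (Runs.block _ ?_) ?_
    · simp only [List.foldl, Instr.step]
      refine ⟨⟨⟨?_, ?_, ?_, ?_, ?_, ?_⟩, ?_, ?_, ?_, ?_, h.le, ?_, ?_⟩, ?_⟩ <;>
        simp only [State.setReg_reg, State.setReg_arr, reduceIte, Nat.reduceEqDiff,
          OfNat.zero_ne_ofNat]
      exacts [h.reg_two, h.reg_one, h.reg_pow, h.reg_depth, h.reg_next, h.count, h.arr_eq,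
        h.reg_len, h.reg_digits, h.reg_index, h.reg_code, h.reg_thr]
    · clear h s'
      rintro s' ⟨h, h0⟩
      refine Runs.seq (Runs.whileLT (N := d + b) (τ := 4) (fun c s' => Encoding t d J cnt s.arr r a
        (digitCode (s.arr 2) (d + r) a * 2 ^ c) (4 ^ (a * (d + r)) * 4 ^ c) s' ∧ s'.reg 21 = c ∧
        c ≤ d + r) ?_ ⟨by simpa using h, h0, Nat.zero_le _⟩) ?_
      · clear h h0 s'
        rintro c s' ⟨h, hc, -⟩ hlt'
        rw [hc, h.reg_digits] at hlt'
        refine ⟨by omega, Runs.block _ ?_⟩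
        simp only [List.foldl, Instr.step]
        refine ⟨⟨⟨?_, ?_, ?_, ?_, ?_, ?_⟩, ?_, ?_, ?_, ?_, h.le, ?_, ?_⟩, ?_, hlt'⟩ <;>
          simp only [State.setReg_reg, State.setReg_arr, reduceIte, Nat.reduceEqDiff,
            OfNat.zero_ne_ofNat, h.reg_code, h.reg_thr, hc, h.reg_one]
        exacts [h.reg_two, h.reg_pow, h.reg_depth, h.reg_next, h.count, h.arr_eq,
          h.reg_len, h.reg_digits, h.reg_index, by ring, by ring]
      · clear h h0 s'
        rintro s' ⟨c, ⟨h, hc, hle⟩, hge⟩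
        rw [hc, h.reg_digits] at hge
        obtain rfl : c = d + r := by omega
        refine Runs.block _ ?_
        simp only [List.foldl, Instr.step]
        refine ⟨⟨?_, ?_, ?_, ?_, ?_, ?_⟩, ?_, ?_, ?_, ?_, hlt, ?_, ?_⟩ <;>
          simp only [State.setReg_reg, State.setReg_arr, reduceIte, Nat.reduceEqDiff,
            OfNat.zero_ne_ofNat, h.reg_code, h.reg_thr, h.reg_one, h.reg_index]
        exacts [h.reg_two, h.reg_pow, h.reg_depth, h.reg_next, h.count, h.arr_eq,
          h.reg_len, h.reg_digits, by rw [digitCode, h.arr_eq], by ring]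
  · rintro s' ⟨a, h, hge⟩
    rw [h.reg_index, h.reg_len] at hge
    obtain rfl : a = r := le_antisymm h.le (by omega)
    exact h

end runs

/-! ### The search -/

/-- The vertex sets `B j`, `j < n`, are the components of the children of `t`. -/
structure IsParts (I : Input) (t d b n : ℕ) (B : ℕ → Finset ℕ) : Prop where
  isPart : ∀ j < n, IsPart I t d (B j) (I.child t j)
  card_le : ∀ j < n, (B j).card ≤ b
  disj : ∀ i < n, ∀ j < n, ∀ x ∈ B i, x ∈ B j → i = j

/-- The lists `l j` of lengths `ρ j` of the first `J` components have been found. -/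
structure Searching (I : Input) (t d b n : ℕ) (B : ℕ → Finset ℕ) (J : ℕ) (l : ℕ → ℕ → ℕ)
    (ρ : ℕ → ℕ) (s : State) : Prop
    extends Between t d J (fun x => Nat.count (fun j => listCode I t d (l j) (ρ j) = x) J) s where
  le : J ≤ n
  weight : ∀ i < d, s.arr 1 (I.parent^[i] t) = 2 ^ i
  weight_zero : ∀ j, J ≤ j → j < n → ∀ x ∈ B j, s.arr 1 x = 0
  bijOn : ∀ j < J, Set.BijOn (l j) (Set.Iio (ρ j)) (B j)
  count_lt : s.reg 8 < s.reg 9 → ∀ x, s.arr 3 x < 4 ^ (b * (d + b))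
  of_zero : J = 0 → s.reg 8 < s.reg 9
  of_succ : ∀ j, J = j + 1 → s.reg 0 = ρ j ∧ s.arr 0 = l j ∧
    s.reg 8 = s.arr 3 (listCode I t d (l j) (ρ j)) ∧ s.reg 9 = 4 ^ (ρ j * (d + ρ j))

section runs

variable {I : Input} {t d b n J : ℕ} {B : ℕ → Finset ℕ} {l : ℕ → ℕ → ℕ} {ρ : ℕ → ℕ} {s : State}

theorem IsParts.length_le (hB : IsParts I t d b n B) {j : ℕ} (hj : j < n) {l : ℕ → ℕ} {r : ℕ}
    (h : Set.BijOn l (Set.Iio r) (B j)) : r ≤ b := by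
  refine le_trans ?_ (hB.card_le j hj)
  rw [← Finset.card_range r]
  exact Finset.card_le_card_of_injOn l (fun i hi => h.1 (Finset.mem_range.1 hi))
    (by simpa using h.2.1)

/-- Pigeonhole: while the search goes on, every code has occurred fewer than 4^(b(d+b)) times, and
there are at most 2^(b(d+b)+1) codes. -/
theorem Searching.lt (hB : IsParts I t d b n B) (h : Searching I t d b n B J l ρ s)
    (hlt : s.reg 8 < s.reg 9) : J < 4 ^ (b * (d + b)) * 2 ^ (b * (d + b) + 1) := by
  classical
  have hM := h.count_lt hlt
  set M := 4 ^ (b * (d + b)) with hMdef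
  set K := 2 ^ (b * (d + b) + 1) with hKdef
  have hKpos : 0 < K := by positivity
  have hMpos : 0 < M := by positivity
  have h1 := Finset.card_le_mul_card_image (f := fun j => listCode I t d (l j) (ρ j))
    (Finset.range J) (M - 1) (by
      intro x _
      have := hM x
      rw [h.count] at this
      rw [← Nat.count_eq_card_filter_range]
      exact Nat.le_sub_one_of_lt this)
  have h2 : ((Finset.range J).image (fun j => listCode I t d (l j) (ρ j))).card ≤ K := by
    rw [← Finset.card_range K]
    apply Finset.card_le_card
    intro x hx
    obtain ⟨j, hj, rfl⟩ := Finset.mem_image.1 hx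
    have hj := Finset.mem_range.1 hj
    have hr := hB.length_le (hj.trans_le h.le) (h.bijOn j hj)
    refine Finset.mem_range.2 ((listCode_lt I t d (l j) (ρ j)).trans_le ?_)
    apply Nat.pow_le_pow_right two_pos
    have := Nat.mul_le_mul hr (Nat.add_le_add_left hr d)
    omega
  rw [Finset.card_range] at h1
  calc J ≤ (M - 1) * K := h1.trans (Nat.mul_le_mul_left _ h2)
    _ < M * K := Nat.mul_lt_mul_of_pos_right (by omega) hKpos

/-- A bound for the time that is spent on one component. -/
def partTime (b d : ℕ) : ℕ :=
  10 + (b * (4 + (((d + b) * (11 + 1) + 1) + 2) + 1) + 1) +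
    (4 + (b * (1 + (((d + b) * (4 + 1) + 1) + 3) + 1) + 1) + 3)

theorem runs_search_step (hB : IsParts I t d b n B) (h : Searching I t d b n B J l ρ s)
    (hlt : s.reg 8 < s.reg 9) (hJ : J < n) :
    Runs I (.seq explore (.seq encode (Prog.block [.load 8 3 19, .add 8 8 3, .store 3 19 8]))) s
      (partTime b d) (fun s' => ∃ l ρ, Searching I t d b n B (J + 1) l ρ s') := by
  have hP := hB.isPart J hJ
  refine Runs.seq (runs_explore hP (hB.card_le J hJ) rfl h.toBetween h.weight
    (h.weight_zero J le_rfl hJ)) ?_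
  rintro s₁ ⟨r, h₁⟩
  have hr := hB.length_le hJ (h₁.exploring.bijOn hP)
  refine Runs.seq (runs_encode hr h₁.toBetween h₁.reg_len) ?_
  intro s₂ h₂
  have hcode : digitCode (s₁.arr 2) (d + r) r = listCode I t d (s₁.arr 0) r :=
    digitCode_congr fun a ha => h₁.exploring.sums_eq hP ha
  rw [hcode] at h₂
  set l' := Function.update l J (s₁.arr 0)
  set ρ' := Function.update ρ J r
  have hl : ∀ j < J, l' j = l j := fun j hj => Function.update_of_ne hj.ne _ _
  have hρ : ∀ j < J, ρ' j = ρ j := fun j hj => Function.update_of_ne hj.ne _ _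
  have hlJ : l' J = s₁.arr 0 := Function.update_self _ _ _
  have hρJ : ρ' J = r := Function.update_self _ _ _
  have hcount : ∀ x, Nat.count (fun j => listCode I t d (l' j) (ρ' j) = x) J =
      Nat.count (fun j => listCode I t d (l j) (ρ j) = x) J := by
    intro x
    rw [Nat.count_eq_card_filter_range, Nat.count_eq_card_filter_range]
    congr 1
    refine Finset.filter_congr fun j hj => ?_
    rw [hl j (Finset.mem_range.1 hj), hρ j (Finset.mem_range.1 hj)]
  have hcnt : Function.update (s₂.arr 3) (listCode I t d (s₁.arr 0) r)
      (s₂.arr 3 (listCode I t d (s₁.arr 0) r) + 1) =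
      fun x => Nat.count (fun j => listCode I t d (l' j) (ρ' j) = x) (J + 1) := by
    ext x
    rw [Nat.count_succ, hcount, hlJ, hρJ, Function.update_apply, h₂.count]
    by_cases hx : x = listCode I t d (s₁.arr 0) r
    · simp [hx]
    · simp [hx, Ne.symm hx]
  -- The threshold depends on the size of the current component; the worst case bounds all counts
  -- uniformly.
  have hthr : 4 ^ (r * (d + r)) ≤ 4 ^ (b * (d + b)) := by
    apply Nat.pow_le_pow_right (by norm_num)
    exact Nat.mul_le_mul hr (Nat.add_le_add_left hr d)
  have hbij : ∀ j < J + 1, Set.BijOn (l' j) (Set.Iio (ρ' j)) (B j) := by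
    intro j hj
    rcases (Nat.lt_succ_iff.1 hj).lt_or_eq with h1 | rfl
    · rw [hl j h1, hρ j h1]
      exact h.bijOn j h1
    · rw [hlJ, hρJ]
      exact h₁.exploring.bijOn hP
  refine Runs.block _ ⟨l', ρ', ?_⟩
  simp only [List.foldl, Instr.step]
  refine ⟨⟨?_, ?_, ?_, ?_, ?_, ?_⟩, hJ, ?_, ?_, hbij, ?_,
    fun h => absurd h (Nat.succ_ne_zero _), ?_⟩ <;>
    simp only [State.setReg_reg, State.setReg_arr, State.setArr_reg, State.setArr_arr, reduceIte,
      Nat.reduceEqDiff, OfNat.zero_ne_ofNat, OfNat.one_ne_ofNat, h₂.reg_code, h₂.reg_one, hcnt]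
  case refine_7 =>
    intro i hi
    rw [h₂.arr_eq]
    exact h₁.exploring.weight i hi
  case refine_8 =>
    intro j hj hjn x hx
    -- Old weights are never erased. This does no harm, as the parts still to be explored are
    -- disjoint from the explored ones.
    rw [h₂.arr_eq, h₁.exploring.outside x]
    · exact h.weight_zero j (by omega) hjn x hx
    · intro hxJ
      have := hB.disj j hjn J hJ x hx hxJ
      omega
  case refine_9 =>
    intro hc x
    rw [h₂.reg_thr] at hc
    refine (congrFun hcnt x).symm.trans_lt ?_
    rw [Function.update_apply]
    split_ifs
    · exact hc.trans_le hthr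
    · have := h.count_lt hlt x
      rw [h.count] at this
      rw [h₂.count]
      exact this
  case refine_10 =>
    rintro j hj
    obtain rfl : J = j := by omega
    have hx := congrFun hcnt (listCode I t d (s₁.arr 0) r)
    rw [Function.update_self] at hx
    rw [hlJ, hρJ]
    exact ⟨h₂.reg_len, congrFun h₂.arr_eq 0, hx, h₂.reg_thr⟩
  exacts [h₂.reg_two, h₂.reg_pow, h₂.reg_depth, h₂.reg_next]

/-- The program finds a component the code of which occurs often. -/
theorem runs_findComponent (hB : IsParts I t d b n B)
    (hinj : Set.InjOn (fun m => I.parent^[m] t) (Set.Iio d))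
    (hlast : ∃ i < d, I.parent^[d] t = I.parent^[i] t)
    (hn : 4 ^ (b * (d + b)) * 2 ^ (b * (d + b) + 1) ≤ n) (k i : ℕ) :
    Runs I findComponent (initState k i t) (3 + (d * (5 + 1) + 1) + (1 +
      (4 ^ (b * (d + b)) * 2 ^ (b * (d + b) + 1) * (partTime b d + 1) + 1)))
      (fun s => ∃ j < n, ∃ (l : ℕ → ℕ → ℕ) (ρ : ℕ → ℕ),
        (∀ i ≤ j, Set.BijOn (l i) (Set.Iio (ρ i)) (B i)) ∧
        4 ^ (ρ j * (d + ρ j)) ≤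
          Nat.count (fun i => listCode I t d (l i) (ρ i) = listCode I t d (l j) (ρ j)) (j + 1) ∧
        s.reg 0 = ρ j ∧ s.arr 0 = l j) := by
  refine Runs.seq (runs_weighAncestors hinj hlast) fun s hs => ?_
  refine Runs.seq (R := fun s => ∃ l ρ, Searching I t d b n B 0 l ρ s) (Runs.block _ ?_) ?_
  · refine ⟨fun _ _ => 0, fun _ => 0, ?_⟩
    simp only [List.foldl, Instr.step]
    refine ⟨⟨?_, ?_, ?_, ?_, ?_, ?_⟩, Nat.zero_le _, ?_, ?_, fun j hj => absurd hj (Nat.not_lt_zero _),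
      ?_, ?_, fun j hj => absurd hj (Nat.succ_ne_zero _).symm⟩ <;>
      simp only [State.setReg_reg, State.setReg_arr, reduceIte, Nat.reduceEqDiff, hs.reg_count]
    case refine_8 =>
      intro j _ hj x hx
      refine hs.weight_zero x fun i hi he => ?_
      exact (hB.isPart j hj).notMem i hi (he ▸ hx)
    exacts [hs.reg_two, hs.reg_one, hs.reg_pow, hs.reg_depth, hs.reg_next,
      funext fun x => by simp [hs.count], hs.weight,
      fun _ x => by rw [hs.count]; positivity, fun _ => one_pos]
  · clear hs s
    rintro s ⟨l, ρ, hs⟩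
    refine (Runs.whileLT (N := 4 ^ (b * (d + b)) * 2 ^ (b * (d + b) + 1)) (τ := partTime b d)
      (fun J s => ∃ l ρ, Searching I t d b n B J l ρ s) ?_ ⟨l, ρ, hs⟩).mono le_rfl ?_
    · rintro J s ⟨l, ρ, h⟩ hlt
      have h1 := h.lt hB hlt
      exact ⟨h1, runs_search_step hB h hlt (h1.trans_le hn)⟩
    · rintro s ⟨J, ⟨l, ρ, h⟩, hge⟩
      cases J with
      -- The threshold starts at 1 and the count at 0, so at least one component is explored.
      | zero => exact absurd (h.of_zero rfl) hge
      | succ j =>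
        obtain ⟨h1, h2, h3, h4⟩ := h.of_succ j rfl
        refine ⟨j, h.le, l, ρ, fun i hi => h.bijOn i (by omega), ?_, h1, h2⟩
        rw [h3, h4, h.count] at hge
        exact not_lt.1 hge

end runs

/-! ### Components of the represented graph -/

section Represents

variable {V : Type u} [Fintype V] {G : SimpleGraph V} {T : RTree V} {t : V} {I : Input}
  {name : V ≃ Fin (Fintype.card V)}

theorem name_injective (name : V ≃ Fin (Fintype.card V)) :
    Function.Injective (fun w => (name w : ℕ)) :=
  Fin.val_injective.comp name.injective

theorem Input.Represents.adj_iff (hI : I.Represents G T name) {v w : V} :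
    G.Adj v w ↔ ∃ e < I.deg (name v), I.nbr (name v) e = name w := by
  constructor
  · intro h
    exact (hI.nbr_bijOn v).2.2 ⟨w, h, rfl⟩
  · rintro ⟨e, he, h⟩
    obtain ⟨w', hw', h'⟩ := (hI.nbr_bijOn v).1 he
    rw [h] at h'
    obtain rfl := name_injective name h'
    exact hw'

theorem Input.Represents.iterate_parent (hI : I.Represents G T name) (m : ℕ) (v : V) :
    I.parent^[m] (name v) = name (T.parent^[m] v) := by
  induction m generalizing v with
  | zero => rfl
  | succ m ih =>
    rw [Function.iterate_succ_apply, Function.iterate_succ_apply, hI.parent_eq, ih]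

theorem Input.Represents.numChild_eq (hI : I.Represents G T name) :
    {q | T.IsChild q t}.ncard = I.numChild (name t) := by
  rw [← Set.ncard_image_of_injective _ (name_injective name), ← (hI.child_bijOn t).image_eq,
    (hI.child_bijOn t).2.1.ncard_image]
  simp [Set.ncard_eq_toFinset_card']

/-- The names of the vertices that can be reached from `q` without entering `P`. -/
noncomputable def reachNames (G : SimpleGraph V) (P : Set V) (name : V ≃ Fin (Fintype.card V))
    (q : V) : Finset ℕ :=
  (Set.toFinite (reach G P q)).toFinset.map ⟨fun w => (name w : ℕ), name_injective name⟩

theorem mem_reachNames {P : Set V} {q : V} {x : ℕ} :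
    x ∈ reachNames G P name q ↔ ∃ v ∈ reach G P q, (name v : ℕ) = x := by
  simp [reachNames]

theorem name_mem_reachNames {P : Set V} {q v : V} :
    (name v : ℕ) ∈ reachNames G P name q ↔ v ∈ reach G P q := by
  rw [mem_reachNames]
  constructor
  · rintro ⟨w, hw, h⟩
    rwa [← name_injective name h]
  · exact fun h => ⟨v, h, rfl⟩

theorem Input.Represents.isPart (hI : I.Represents G T name) {q : V} (hq : T.IsChild q t) :
    IsPart I (name t) (T.depth t) (reachNames G (T.ancestors t) name q) (name q) where
  mem := name_mem_reachNames.2 mem_reach_self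
  notMem i _ h := by
    rw [hI.iterate_parent, name_mem_reachNames] at h
    exact notMem_of_mem_reach hq.notMem_ancestors h ⟨i, rfl⟩
  anc_inj m hm n hn h := by
    simp only [hI.iterate_parent] at h
    exact RTree.iterate_parent_injOn t hm hn (name_injective name h)
  nbr_mem v hv e he := by
    obtain ⟨a, ha, rfl⟩ := mem_reachNames.1 hv
    obtain ⟨w, hw, hw'⟩ := (hI.nbr_bijOn a).1 he
    rw [← hw']
    by_cases hP : w ∈ T.ancestors t
    · obtain ⟨m, hm, rfl⟩ := RTree.mem_ancestors_iff.1 hP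
      exact Or.inr ⟨m, hm, (hI.iterate_parent m t).symm⟩
    · exact Or.inl (name_mem_reachNames.2 (reach_closed ha hw hP))
  nbr_inj v hv := by
    obtain ⟨a, -, rfl⟩ := mem_reachNames.1 hv
    exact (hI.nbr_bijOn a).2.1
  subset X hX hcl v hv := by
    obtain ⟨a, ha, rfl⟩ := mem_reachNames.1 hv
    refine reach_subset (X := {a | (name a : ℕ) ∈ X}) hX ?_ ha
    intro v hv hvr w hvw hw
    obtain ⟨e, he, hee⟩ := hI.adj_iff.1 hvw
    have := hcl _ hv (name_mem_reachNames.2 hvr) e he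
    rw [hee] at this
    exact this (name_mem_reachNames.2 (reach_closed hvr hvw hw))

theorem Input.Represents.isParts [Nonempty V] (hI : I.Represents G T name)
    (hT : T.IsTreedepthDecomposition G) {b : ℕ} (hb : T.maxCompSize G t ≤ b) :
    ∃ c : ℕ → V, (∀ j < I.numChild (name t), T.IsChild (c j) t) ∧
      Set.InjOn c (Set.Iio (I.numChild (name t))) ∧
      IsParts I (name t) (T.depth t) b (I.numChild (name t))
        (fun j => reachNames G (T.ancestors t) name (c j)) := by
  have hex : ∀ j, j < I.numChild (name t) → ∃ q, T.IsChild q t ∧ (name q : ℕ) = I.child (name t) j :=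
    fun j hj => (hI.child_bijOn t).1 hj
  choose! c hc hc' using hex
  have hinj : Set.InjOn c (Set.Iio (I.numChild (name t))) := by
    intro i hi j hj h
    refine (hI.child_bijOn t).2.1 hi hj ?_
    rw [← hc' i hi, ← hc' j hj, h]
  refine ⟨c, hc, hinj, fun j hj => ?_, fun j hj => ?_, fun i hi j hj x hx hx' => ?_⟩
  · rw [← hc' j hj]
    exact hI.isPart (hc j hj)
  · rw [reachNames, Finset.card_map, ← Set.ncard_eq_toFinset_card]
    exact (ncard_reach_le (hc j hj)).trans hb
  · obtain ⟨v, hv, rfl⟩ := mem_reachNames.1 hx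
    exact hinj hi hj (eq_of_mem_reach hT (hc i hi) (hc j hj) hv (name_mem_reachNames.1 hx'))

/-- Components with the same code are copies of each other. -/
theorem Input.Represents.isCopyFamily (hI : I.Represents G T name) (hG : G.Connected)
    (hT : T.IsTreedepthDecomposition G) {J : Type*} {c : J → V} (hc : ∀ j, T.IsChild (c j) t)
    (hcinj : Function.Injective c) {l : J → ℕ → ℕ} {r : ℕ} {β : J → Fin r → V}
    (hl : ∀ j, Set.BijOn (l j) (Set.Iio r) (reachNames G (T.ancestors t) name (c j)))
    (hβ : ∀ j x, (name (β j x) : ℕ) = l j x) (j₀ : J)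
    (hcode : ∀ j, ∀ a < r, nbrPositions I (name t) (T.depth t) (l j) r (l j a) =
      nbrPositions I (name t) (T.depth t) (l j₀) r (l j₀ a)) :
    IsCopyFamily G (G.comap (β j₀)) (T.ancestors t) (fun x v => G.Adj (β j₀ x) v) β ∧
      Set.range (β j₀) = reach G (T.ancestors t) (c j₀) := by
  have hmem : ∀ j x, β j x ∈ reach G (T.ancestors t) (c j) := fun j x => by
    rw [← name_mem_reachNames (name := name), hβ]
    exact (hl j).1 x.2
  have hsurj : ∀ j, ∀ v ∈ reach G (T.ancestors t) (c j), ∃ x, β j x = v := by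
    intro j v hv
    obtain ⟨a, ha, h⟩ := (hl j).2.2 (name_mem_reachNames.2 hv)
    refine ⟨⟨a, ha⟩, name_injective name ?_⟩
    simpa [hβ] using h
  have hinj : ∀ j, Function.Injective (β j) := fun j x y hxy => by
    refine Fin.ext ((hl j).2.1 x.2 y.2 ?_)
    rw [← hβ, ← hβ, hxy]
  -- Positions below d stand for ancestors of `t`, which are common to all copies; position d + y
  -- stands for the y-th vertex of the copy. Equal rows thus give equal adjacencies of both kinds.
  have hpos : ∀ j (x : Fin r) w (i : ℕ), i < T.depth t + r →
      ancestorsThen I (name t) (T.depth t) (l j) i = name w →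
      (G.Adj (β j x) w ↔ i ∈ nbrPositions I (name t) (T.depth t) (l j) r (l j x)) := by
    intro j x w i hi hw
    rw [hI.adj_iff, hβ, nbrPositions, Finset.mem_filter, Finset.mem_range, hw]
    exact ⟨fun h => ⟨hi, h⟩, fun h => h.2⟩
  have hadj : ∀ j x y, G.Adj (β j x) (β j y) ↔ G.Adj (β j₀ x) (β j₀ y) := by
    intro j x y
    rw [hpos j x (β j y) (T.depth t + y) (by omega) (by simp [ancestorsThen, hβ]), hcode j x x.2,
      ← hpos j₀ x (β j₀ y) (T.depth t + y) (by omega) (by simp [ancestorsThen, hβ])]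
  have hadjP : ∀ j x, ∀ p ∈ T.ancestors t, G.Adj (β j x) p ↔ G.Adj (β j₀ x) p := by
    intro j x p hp
    obtain ⟨m, hm, rfl⟩ := RTree.mem_ancestors_iff.1 hp
    rw [hpos j x (T.parent^[m] t) m (by omega) (by simp [ancestorsThen, hm, hI.iterate_parent]), hcode j x x.2,
      ← hpos j₀ x (T.parent^[m] t) m (by omega) (by simp [ancestorsThen, hm, hI.iterate_parent])]
  have hnot : ∀ j x, β j x ∉ T.ancestors t :=
    fun j x => notMem_of_mem_reach (hc j).notMem_ancestors (hmem j x)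
  refine ⟨⟨?_, hnot, ?_, ?_, ?_⟩, ?_⟩
  · obtain ⟨x₀, hx₀⟩ := hsurj j₀ (c j₀) mem_reach_self
    have key : ∀ v ∈ reach G (T.ancestors t) (c j₀),
        ∃ y, β j₀ y = v ∧ (G.comap (β j₀)).Reachable x₀ y := by
      intro v hv
      refine reach_subset (X := {v | ∃ y, β j₀ y = v ∧ (G.comap (β j₀)).Reachable x₀ y})
        ⟨x₀, hx₀, SimpleGraph.Reachable.refl _⟩ ?_ hv
      rintro _ ⟨y, rfl, hy⟩ hyr w hyw hw
      obtain ⟨z, rfl⟩ := hsurj j₀ w (reach_closed hyr hyw hw)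
      exact ⟨z, rfl, hy.trans (SimpleGraph.Adj.reachable hyw)⟩
    have hreach : ∀ y, (G.comap (β j₀)).Reachable x₀ y := by
      intro y
      obtain ⟨z, hz, h⟩ := key _ (hmem j₀ y)
      rwa [hinj j₀ hz] at h
    have : Nonempty (Fin r) := ⟨x₀⟩
    exact ⟨fun x y => (hreach x).symm.trans (hreach y)⟩
  · intro i j x y h
    have hij : i = j := by
      refine hcinj (eq_of_mem_reach hT (hc i) (hc j) (hmem i x) ?_)
      rw [h]
      exact hmem j y
    subst hij
    exact ⟨rfl, hinj i h⟩
  · intro j x v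
    constructor
    · intro h
      by_cases hv : v ∈ T.ancestors t
      · exact Or.inr ⟨hv, (hadjP j x v hv).1 h⟩
      · obtain ⟨y, rfl⟩ := hsurj j v (reach_closed (hmem j x) h hv)
        exact Or.inl ⟨y, rfl, (hadj j x y).1 h⟩
    · rintro (⟨y, rfl, h⟩ | ⟨hv, h⟩)
      · exact (hadj j x y).2 h
      · exact (hadjP j x v hv).2 h
  · obtain ⟨v, hv, p, hp, h⟩ := exists_adj_of_mem_reach hG ⟨t, RTree.IsAncestor.refl t⟩
      (hc j₀).notMem_ancestors
    obtain ⟨x, rfl⟩ := hsurj j₀ v hv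
    exact ⟨x, p, hp, h⟩
  · exact Set.Subset.antisymm (Set.range_subset_iff.2 (hmem j₀)) fun v hv => hsurj j₀ v hv

/-- If the program has found sufficiently many components of one code, then the last one can be
removed. -/
theorem Input.Represents.queueNumber_eq_one_iff (hI : I.Represents G T name) (hG : G.Connected)
    (hT : T.IsTreedepthDecomposition G) {c : ℕ → V} {n : ℕ} (hc : ∀ j < n, T.IsChild (c j) t)
    (hcinj : Set.InjOn c (Set.Iio n)) {j : ℕ} (hj : j < n) {l : ℕ → ℕ → ℕ} {ρ : ℕ → ℕ}
    (hl : ∀ i ≤ j, Set.BijOn (l i) (Set.Iio (ρ i)) (reachNames G (T.ancestors t) name (c i)))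
    (hcard : 4 ^ (ρ j * (T.depth t + ρ j)) ≤ Nat.count (fun i =>
      listCode I (name t) (T.depth t) (l i) (ρ i) = listCode I (name t) (T.depth t) (l j) (ρ j))
      (j + 1)) :
    queueNumber (G.induce (reach G (T.ancestors t) (c j))ᶜ) = 1 ↔ queueNumber G = 1 := by
  classical
  -- The copies are the explored components with the code of the last one, which is itself the copy
  -- to be removed.
  let F := (Finset.range (j + 1)).filter (fun i =>
      listCode I (name t) (T.depth t) (l i) (ρ i) = listCode I (name t) (T.depth t) (l j) (ρ j))
  have hF : ∀ i : F, i.1 ≤ j ∧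
      listCode I (name t) (T.depth t) (l i) (ρ i) = listCode I (name t) (T.depth t) (l j) (ρ j) := by
    intro i
    obtain ⟨h1, h2⟩ := Finset.mem_filter.1 i.2
    exact ⟨Nat.lt_succ_iff.1 (Finset.mem_range.1 h1), h2⟩
  have hρ : ∀ i : F, ρ i = ρ j := fun i => (eq_of_listCode_eq (hF i).2).1
  have hl' : ∀ i : F, Set.BijOn (l i) (Set.Iio (ρ j))
      (reachNames G (T.ancestors t) name (c i)) := by
    intro i
    rw [← hρ i]
    exact hl i (hF i).1
  have hβ : ∀ (i : F) (x : Fin (ρ j)), ∃ v, (name v : ℕ) = l i x := by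
    intro i x
    obtain ⟨v, -, hv⟩ := mem_reachNames.1 ((hl' i).1 x.2)
    exact ⟨v, hv⟩
  choose β hβ using hβ
  let j₀ : F := ⟨j, Finset.mem_filter.2 ⟨Finset.self_mem_range_succ j, rfl⟩⟩
  have hcn : ∀ i : F, i.1 < n := fun i => (hF i).1.trans_lt hj
  obtain ⟨hfam, hrange⟩ := hI.isCopyFamily hG hT (c := fun i : F => c i) (l := fun i : F => l i)
    (fun i => hc i (hcn i)) (fun i i' h => Subtype.ext (hcinj (hcn i) (hcn i') h)) hl' hβ j₀ (by
      intro i a ha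
      have := (eq_of_listCode_eq (hF i).2).2 a (by rw [hρ i]; exact ha)
      rwa [hρ i] at this)
  have := Fintype.ofFinite (T.ancestors t)
  have key := hfam.queueNumber_eq_one_iff (by
    rw [Fintype.card_coe, Fintype.card_fin, ← Nat.card_eq_fintype_card, Nat.card_coe_set_eq,
      RTree.ncard_ancestors, add_comm (ρ j), ← Nat.count_eq_card_filter_range]
    exact hcard) j₀
  rwa [hrange] at key

end Represents

/-! ### Bounds -/

/-- The first bound serves the running time, the second guarantees enough children for the
pigeonhole argument. Already 2^((k+1)s² + (k+s)²), a lower bound for the number of children, is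
large enough. -/
theorem le_childrenOfSize {k s d : ℕ} (hs : 1 ≤ s) (hd : d + 1 ≤ k) (hd0 : 1 ≤ d) :
    2 ^ (4 * (s * (d + s)) + 12) ≤ childrenOfSize k s ^ 2 ∧
      4 ^ (s * (d + s)) * 2 ^ (s * (d + s) + 1) ≤ childrenOfSize k s := by
  have h1 : 2 ^ ((k + 1) * s ^ 2 + (k + s) ^ 2) ≤ childrenOfSize k s := by
    unfold childrenOfSize
    rw [pow_add, pow_mul]
    apply Nat.mul_le_mul_right
    have h2 : (2 ^ (k + 1)) ^ s ^ 2 ≤ (2 ^ (k + 1) + 1) ^ s ^ 2 := Nat.pow_le_pow_left (by omega) _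
    calc (2 ^ (k + 1)) ^ s ^ 2 ≤ ((2 ^ (k + 1) + 1) ^ s ^ 2 + 1) := by omega
      _ ≤ _ := Nat.le_mul_of_pos_right _ (Nat.factorial_pos _)
  -- In the slack variables e, f, g the differences of the exponents are polynomials with
  -- nonnegative coefficients, written out below.
  obtain ⟨e, rfl⟩ : ∃ e, k = d + 1 + e := ⟨k - (d + 1), by omega⟩
  obtain ⟨f, rfl⟩ : ∃ f, d = f + 1 := ⟨d - 1, by omega⟩
  obtain ⟨g, rfl⟩ : ∃ g, s = g + 1 := ⟨s - 1, by omega⟩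
  constructor
  · refine le_trans ?_ (Nat.pow_le_pow_left h1 2)
    rw [← pow_mul]
    apply Nat.pow_le_pow_right two_pos
    refine (Nat.le_add_right _ (2 * f * g ^ 2 + 2 * e * g ^ 2 + 2 * f ^ 2 + 2 * e ^ 2 + 4 * g ^ 2 +
      4 * f * e + 4 * f * g + 8 * e * g + 10 * f + 14 * e + 12 * g + 4)).trans_eq ?_
    ring
  · refine le_trans ?_ h1
    rw [show (4 : ℕ) = 2 ^ 2 by norm_num, ← pow_mul, ← pow_add]
    apply Nat.pow_le_pow_right two_pos
    refine (Nat.le_add_right _ (f * g ^ 2 + e * g ^ 2 + f ^ 2 + e ^ 2 + g ^ 2 + 2 * f * e + f * g +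
      4 * e * g + 4 * f + 7 * e + 3 * g + 5)).trans_eq ?_
    ring

/-- With x = s(d + s) and y = 2^x there are at most 2y³ rounds of at most 60x < 60y steps each. The
total is a constant times y⁴, and the constant is below 4096 = 2^12. -/
theorem time_le {k s d : ℕ} (hs : 1 ≤ s) (hd : d + 1 ≤ k) (hd0 : 1 ≤ d) :
    3 + (d * (5 + 1) + 1) + (1 + (4 ^ (s * (d + s)) * 2 ^ (s * (d + s) + 1) *
      (partTime s d + 1) + 1)) ≤ s ! * childrenOfSize k s ^ 2 := by
  have h1 := (le_childrenOfSize hs hd hd0).1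
  have h2 : childrenOfSize k s ^ 2 ≤ s ! * childrenOfSize k s ^ 2 :=
    Nat.le_mul_of_pos_left _ (Nat.factorial_pos _)
  refine le_trans ?_ (h1.trans h2)
  set x := s * (d + s) with hx
  have hsx : s ≤ x := Nat.le_mul_of_pos_right _ (by omega)
  have hdx : d ≤ x := (Nat.le_add_right d s).trans (Nat.le_mul_of_pos_left _ (by omega))
  have hpart : partTime s d + 1 ≤ 60 * x := by
    have : partTime s d = 17 * x + 14 * s + 19 := by
      rw [hx, partTime]; ring
    omega
  have hlt : x < 2 ^ x := Nat.lt_two_pow_self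
  have e1 : 4 ^ x * 2 ^ (x + 1) = 2 * (2 ^ x) ^ 3 := by
    rw [show (4 : ℕ) = 2 ^ 2 by norm_num, ← pow_mul, ← pow_mul]
    ring
  have e2 : 2 ^ (4 * x + 12) = 4096 * (2 ^ x) ^ 4 := by
    rw [← pow_mul]
    ring
  rw [e1, e2]
  generalize 2 ^ x = y at hlt
  have h3 : 2 * y ^ 3 * (partTime s d + 1) ≤ 2 * y ^ 3 * (60 * y) :=
    Nat.mul_le_mul_left _ (hpart.trans (by omega))
  have h4 : 2 * y ^ 3 * (60 * y) = 120 * y ^ 4 := by ring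
  have h5 : y ≤ y ^ 4 := Nat.le_self_pow (by norm_num) y
  omega

theorem one_le_size {k i : ℕ} (hi : 2 ≤ i) : 1 ≤ size k i := by
  obtain ⟨j, rfl⟩ : ∃ j, i = j + 1 := ⟨i - 1, by omega⟩
  rw [size_succ k j (by omega)]
  omega

/-! ### Assembling the result -/

/-- Some input stores `G` and `T`. -/
theorem exists_represents {V : Type u} [Fintype V] (G : SimpleGraph V) (T : RTree V)
    (name : V ≃ Fin (Fintype.card V)) : ∃ I : Input, I.Represents G T name := by
  have hex : ∀ S : V → Set V, ∃ (n : ℕ → ℕ) (f : ℕ → ℕ → ℕ), ∀ v,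
      Set.BijOn (f (name v)) (Set.Iio (n (name v))) ((fun w => (name w : ℕ)) '' S v) := by
    intro S
    have h : ∀ v, ∃ (n : ℕ) (f : ℕ → ℕ),
        Set.BijOn f (Set.Iio n) ((fun w => (name w : ℕ)) '' S v) := by
      intro v
      obtain ⟨f, hf⟩ := (Set.finite_Iio (((fun w => (name w : ℕ)) '' S v).ncard)).exists_bijOn_of_encard_eq
        (t := (fun w => (name w : ℕ)) '' S v) (by
          rw [← Set.Finite.cast_ncard_eq (Set.finite_Iio _), ← Set.Finite.cast_ncard_eq (Set.toFinite _)]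
          simp [Set.ncard_eq_toFinset_card'])
      exact ⟨_, f, hf⟩
    choose n f hf using h
    refine ⟨fun a => if ha : a < Fintype.card V then n (name.symm ⟨a, ha⟩) else 0,
      fun a => if ha : a < Fintype.card V then f (name.symm ⟨a, ha⟩) else 0, fun v => ?_⟩
    simpa using hf v
  obtain ⟨deg, nbr, h1⟩ := hex fun v => {w | G.Adj v w}
  obtain ⟨numChild, child, h2⟩ := hex fun v => {w | T.IsChild w v}
  refine ⟨⟨deg, nbr, fun a => if ha : a < Fintype.card V then name (T.parent (name.symm ⟨a, ha⟩))
    else 0, numChild, child⟩, h1, fun v => ?_, h2⟩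
  simp

/-- The program finds a component that can be removed. -/
theorem runs_findComponent_represents {V : Type u} [Fintype V] {G : SimpleGraph V} {T : RTree V}
    {k s : ℕ} {t : V} (hG : G.Connected) (hT : T.IsTreedepthDecomposition G)
    (hk : ∀ v, T.depth v ≤ k) (hs : 1 ≤ s) (hcomps : childrenOfSize k s ≤ (T.comps G t).ncard)
    (hsize : T.maxCompSize G t ≤ s) {I : Input} {name : V ≃ Fin (Fintype.card V)}
    (hI : I.Represents G T name) (i : ℕ) :
    ∃ B ∈ T.comps G t, (queueNumber (G.induce Bᶜ) = 1 ↔ queueNumber G = 1) ∧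
      Runs I findComponent (initState k i (name t)) (s ! * childrenOfSize k s ^ 2)
        (fun σ => σ.Outputs name B) := by
  have : Nonempty V := ⟨t⟩
  have hd0 : 1 ≤ T.depth t := RTree.depth_pos t
  have hcpos : 0 < childrenOfSize k s := by unfold childrenOfSize; positivity
  -- There is a component, so `t` has a child, which is one level deeper and still within height
  -- `k`.
  have hd : T.depth t + 1 ≤ k := by
    obtain ⟨B, hB⟩ := Set.nonempty_of_ncard_ne_zero (s := T.comps G t) (by omega)
    obtain ⟨q, hq, -⟩ := exists_eq_reach hB
    rw [← hq.depth_eq]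
    exact hk q
  obtain ⟨c, hc, hcinj, hB⟩ := hI.isParts hT hsize
  have hn : childrenOfSize k s ≤ I.numChild (name t) := by
    rw [← hI.numChild_eq]
    exact hcomps.trans comps_ncard_le
  have hinj : Set.InjOn (fun m => I.parent^[m] (name t)) (Set.Iio (T.depth t)) :=
    (hB.isPart 0 (by omega)).anc_inj
  obtain ⟨τ, hτ, σ, hex, j, hj, l, ρ, hl, hcard, hlen, hlist⟩ := runs_findComponent hB hinj
    -- The ancestor with index d - 1 is the root, and so is its parent.
    ⟨T.depth t - 1, by omega, by
      rw [hI.iterate_parent, hI.iterate_parent, RTree.iterate_parent_of_depth_le (by omega),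
        RTree.iterate_parent_of_depth_le (by omega)]⟩
    ((le_childrenOfSize hs hd hd0).2.trans hn) k i
  refine ⟨_, reach_mem_comps (hc j hj), hI.queueNumber_eq_one_iff hG hT hc hcinj hj hl hcard, τ,
    hτ.trans (time_le hs hd hd0), σ, hex, ?_⟩
  change Set.BijOn (σ.arr 0) (Set.Iio (σ.reg 0)) _
  rw [hlen, hlist]
  have := hl j le_rfl
  rwa [reachNames, Finset.coe_map, Set.Finite.coe_toFinset] at this

end QueueTD

theorem lemma1 :
    ∃ p : QueueTD.Prog,
      ∀ (V : Type u) [Fintype V] (G : SimpleGraph V) (T : QueueTD.RTree V) (k i : ℕ) (t : V),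
        G.Connected →
        T.IsTreedepthDecomposition G →
        (∀ v, T.depth v ≤ k) →
        2 ≤ i →
        QueueTD.numChildren k i ≤ (T.comps G t).ncard →
        T.maxCompSize G t ≤ QueueTD.size k i →
        (∀ q, T.IsDescendant q t → (T.comps G q).ncard ≤ QueueTD.numChildren k (i - 1)) →
        (∃ B ∈ T.comps G t,
          (QueueTD.queueNumber (G.induce Bᶜ) = 1 ↔ QueueTD.queueNumber G = 1)) ∧
        ∀ (I : QueueTD.Input) (name : V ≃ Fin (Fintype.card V)), I.Represents G T name →
          ∃ B ∈ T.comps G t,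
            (QueueTD.queueNumber (G.induce Bᶜ) = 1 ↔ QueueTD.queueNumber G = 1) ∧
            ∃ (τ : ℕ) (s : QueueTD.State),
              QueueTD.Exec I p (QueueTD.initState k i (name t)) τ s ∧
              τ ≤ (QueueTD.size k i).factorial * QueueTD.numChildren k i ^ 2 ∧
              s.Outputs name B := by
  refine ⟨QueueTD.findComponent, ?_⟩
  intro V _ G T k i t hG hT hk hi hcomps hsize _
  have hnum : QueueTD.numChildren k i = QueueTD.childrenOfSize k (QueueTD.size k i) := by
    rw [QueueTD.numChildren, if_neg (by omega)]
  rw [hnum] at hcomps ⊢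
  have key := fun (I : QueueTD.Input) (name : V ≃ Fin (Fintype.card V))
      (hI : I.Represents G T name) => QueueTD.runs_findComponent_represents hG hT hk
    (QueueTD.one_le_size hi) hcomps hsize hI i
  constructor
  -- Existence without reference to an input follows from a run of the program on any input that
  -- stores `G` and `T`.
  · obtain ⟨I, hI⟩ := QueueTD.exists_represents G T (Fintype.equivFin V)
    obtain ⟨B, hB, h, -⟩ := key I _ hI
    exact ⟨B, hB, h⟩
  · intro I name hI
    obtain ⟨B, hB, h, τ, hτ, s, hex, hout⟩ := key I name hI
    exact ⟨B, hB, h, τ, s, hex, hτ, hout⟩
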